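/- **Setting.** Let $r\ge 0$, let $\xi=(\xi_1\ge\dots\ge\xi_r\ge 0)$ be a partition, $n=|\xi|=\xi_1+\dots+\xi_r$, and let $\xi^t_i=\#\{j:\xi_j\ge i\}$ be the parts of the transposed partition. *The module $V(\xi)$.* Let $\mathbb C\langle\mathcal X,\mathcal Y\rangle$ be the associative algebra generated by $\mathcal X,\mathcal Y$ with the relation $\mathcal Y\mathcal X-\mathcal X\mathcal Y=\mathcal X$, filtered by $F^k=\mathrm{span}\{\mathcal X^i\mathcal Y^j: j\le k\}$, and let $\mathcal G_r=\mathfrak{gl}_r\otimes\mathbb C\langle\mathcal X,\mathcal Y\rangle$ be the Lie algebra of $r\times r$ matrices over it, with $F^k\mathcal G_r=\mathfrak{gl}_r\otimes F^k$. Let $U^{\le m}(\mathcal G_r)$ be the span in the universal enveloping algebra of the products $g_1\cdots g_s$ with $g_i\in F^{d_i}\mathcal G_r$, $\sum d_i\le m$. Fix $N\in\mathbb Z$. With $\mathcal X=x$ and $\mathcal Y=x\,\partial/\partial x$, $\mathcal G_r$ acts on $V_r^{(N)}=V_r\otimes(\mathbb C[x,x^{-1}]/x^N\mathbb C[x])$,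 where $V_r=\mathbb C^r$ has basis $u_1,\dots,u_r$; put $u^i_j=u_j\otimes x^i$. Let $\mathcal V(\xi,N)\subset\bigwedge^nV_r^{(N)}$ be the $\mathcal G_r$-submodule generated by $v_\xi^{(N)}=\bigwedge_{j=1}^r\bigwedge_{i=N-\xi_j}^{N-1}u^i_j$. It is filtered by $F^m\mathcal V(\xi,N)=U^{\le m}(\mathcal G_r)\,v^{(N)}_\xi$ (with $F^{-1}=0$). It is also graded: $\mathcal V^m(\xi,N)$ consists of the elements of $\mathcal V(\xi,N)$ that are linear combinations of monomials $u_H^{(N)}=\bigwedge_{(i,j)\in H}u_j^{N-i}$, $H\subset\{1,2,\dots\}\times\{1,\dots,r\}$, $|H|=n$, with $\sum_i i\,\xi^t_i-\sum_{(i,j)\in H}i=m$. Put $$F^j\mathcal V^i(\xi,N)=\mathcal V^i(\xi,N)\cap F^j\mathcal V(\xi,N),\qquad V^{ij}(\xi)=F^j\mathcal V^i(\xi,N)/F^{j-1}\mathcal V^i(\xi,N),\qquad V(\xi)=\bigoplus_{i,j}V^{ij}(\xi).$$ The algebra $\mathfrak{gl}_r=\mathfrak{gl}_r\otimes 1$ acts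 on each $V^{ij}(\xi)$. For a $\mathfrak{gl}_r$-module $M$ let $\mathrm{ch}\,M=\sum_\eta\dim M^\eta\,e^\eta$, where $M^\eta$ is the subspace on which each $E_{ii}$ acts by $\eta_i$, and let $\mathrm{ch}_xV(\xi)$ be the specialization at $y=1$ of $\mathrm{ch}_{x,y}V(\xi)=\sum_{i,j}x^iy^j\,\mathrm{ch}\,V^{ij}(\xi)$. *Parking functions.* Let $\rho=(1^{\xi^t_1}2^{\xi^t_2}\cdots)$ be the partition in which each $j$ appears $\xi^t_j$ times; write $\rho=(\rho_1\ge\dots\ge\rho_k)$. A function $f:\{1,\dots,n\}\to\{1,\dots,n\}$ is a $\rho$-parking function if $|f^{-1}(\{1,\dots,\rho_{k-s+1}\})|\ge s$ for $s=1,\dots,k$. Put $|f|=|\rho|-\sum_{i=1}^nf(i)$. The symmetric group $\Sigma_n$ acts on $\rho$-parking functions by permuting the domain, and $\mathbb C\mathrm{PF}^m_n(\rho)$ is the permutation representation on those with $|f|=m$. *Frobenius map.* For a partition $\lambda$ let $\pi_\lambda$ be the corresponding irreducible representation of $\Sigma_{|\lambda|}$ and $\pi^\lambda$ the irreducible $\mathfrak{gl}_r$-module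 with highest weight $\lambda$. Let $\mathcal F^r_n$ be the additive map from the Grothendieck group of $\Sigma_n$ to that of $\mathfrak{gl}_r$ with $[\pi_\lambda]\mapsto[\pi^\lambda]$ if $\lambda_{r+1}=0$ and $[\pi_\lambda]\mapsto 0$ otherwise. **Theorem.** For every $N$, $$\mathrm{ch}_xV(\xi)=\sum_m x^m\,\mathrm{ch}\left(V_r^{\otimes n}\otimes\mathbb C\mathrm{PF}^m_n(\rho)\otimes\mathrm{Sign}\right)^{\Sigma_n},$$ where $\Sigma_n$ acts diagonally, permuting the factors of $V_r^{\otimes n}$, and $\mathfrak{gl}_r$ acts on $V_r^{\otimes n}$; equivalently, $$\mathrm{ch}_xV(\xi)=\sum_m x^m\,\mathrm{ch}\,\mathcal F^r_n\left(\mathbb C\mathrm{PF}^m_n(\rho)\otimes\mathrm{Sign}\right).$$ -/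

import Mathlib

open scoped TensorProduct LaurentPolynomial

namespace ParkingWeyl

attribute [local instance 100] LieRing.ofAssociativeRing

noncomputable section

/-! ### The derivation action on exterior and tensor powers -/

section PowerAction

variable {R M N : Type*} [CommRing R] [AddCommGroup M] [Module R M] [AddCommGroup N] [Module R N]
variable {n : ℕ}

/-- For a multilinear `φ` and an endomorphism `f`, the multilinear map
`v ↦ ∑ i, φ (v 0, …, f (v i), …, v (n-1))`. -/
def derivMulti (φ : MultilinearMap R (fun _ : Fin n => M) N) (f : Module.End R M) :
    MultilinearMap R (fun _ : Fin n => M) N :=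
  ∑ i : Fin n, φ.compLinearMap (Function.update (fun _ => LinearMap.id) i f)

theorem derivMulti_apply (φ : MultilinearMap R (fun _ : Fin n => M) N) (f : Module.End R M)
    (v : Fin n → M) :
    derivMulti φ f v = ∑ i : Fin n, φ (Function.update v i (f (v i))) := by
  rw [derivMulti, sum_apply]
  refine Finset.sum_congr rfl fun i _ => ?_
  rw [MultilinearMap.compLinearMap_apply]
  congr 1
  funext j
  by_cases h : j = i
  · subst h; simp
  · simp [h]

theorem derivMulti_add (φ : MultilinearMap R (fun _ : Fin n => M) N) (f g : Module.End R M) :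
    derivMulti φ (f + g) = derivMulti φ f + derivMulti φ g := by
  ext v
  simp [derivMulti_apply, Finset.sum_add_distrib]

theorem derivMulti_smul (φ : MultilinearMap R (fun _ : Fin n => M) N) (c : R)
    (f : Module.End R M) :
    derivMulti φ (c • f) = c • derivMulti φ f := by
  ext v
  simp [derivMulti_apply, Finset.smul_sum]

/-- The commutator identity behind the Lie action on tensor and exterior powers. -/
theorem derivMulti_comm (φ : MultilinearMap R (fun _ : Fin n => M) N) (f g : Module.End R M)
    (v : Fin n → M) :
    ∑ i, derivMulti φ f (Function.update v i (g (v i)))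
      = derivMulti φ ⁅f, g⁆ v + ∑ i, derivMulti φ g (Function.update v i (f (v i))) := by
  simp only [derivMulti_apply]
  have key : ∀ i j : Fin n,
      φ (Function.update (Function.update v i (g (v i))) j
          (f (Function.update v i (g (v i)) j)))
        = (if i = j then φ (Function.update v i (f (g (v i)))) - φ (Function.update v i (g (f (v i))))
            else 0)
          + φ (Function.update (Function.update v j (f (v j))) i
              (g (Function.update v j (f (v j)) i))) := by
    intro i j
    by_cases h : i = j
    · subst h; simp
    · rw [if_neg h, zero_add, Function.update_of_ne (Ne.symm h), Function.update_of_ne h,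
        Function.update_comm h]
  rw [Finset.sum_congr rfl fun i _ => Finset.sum_congr rfl fun j _ => key i j]
  simp only [Finset.sum_add_distrib, Finset.sum_ite_eq, Finset.mem_univ, if_true]
  congr 1
  · refine Finset.sum_congr rfl fun i _ => ?_
    rw [LieRing.of_associative_ring_bracket, LinearMap.sub_apply, φ.map_update_sub]
    rfl
  · rw [Finset.sum_comm]

/-- `derivMulti` of an alternating map is alternating. -/
def derivAlt (φ : M [⋀^Fin n]→ₗ[R] N) (f : Module.End R M) : M [⋀^Fin n]→ₗ[R] N :=
  { derivMulti φ.toMultilinearMap f with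
    map_eq_zero_of_eq' := by
      intro v a b hab hne
      change derivMulti φ.toMultilinearMap f v = 0
      rw [derivMulti_apply]
      have hz : ∀ i, i ∉ ({a, b} : Finset (Fin n)) →
          φ.toMultilinearMap (Function.update v i (f (v i))) = 0 := by
        intro i hi
        simp only [Finset.mem_insert, Finset.mem_singleton, not_or] at hi
        refine φ.map_eq_zero_of_eq _ ?_ hne
        rw [Function.update_of_ne (Ne.symm hi.1), Function.update_of_ne (Ne.symm hi.2), hab]
      rw [← Finset.sum_subset (Finset.subset_univ {a, b}) fun i _ hi => hz i hi,
        Finset.sum_pair hne]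
      have hs : Function.update v b (f (v b)) = Function.update v a (f (v a)) ∘ Equiv.swap a b := by
        funext j
        by_cases hja : j = a
        · subst hja; simp [Function.update_of_ne hne, Function.update_of_ne (Ne.symm hne), hab]
        · by_cases hjb : j = b
          · subst hjb; simp [hab]
          · simp [Equiv.swap_apply_of_ne_of_ne hja hjb, hja, hjb]
      have := φ.map_swap (Function.update v a (f (v a))) hne
      rw [hs]
      change φ _ + φ _ = 0
      rw [this]
      simp }

theorem derivAlt_apply (φ : M [⋀^Fin n]→ₗ[R] N) (f : Module.End R M) (v : Fin n → M) :
    derivAlt φ f v = ∑ i : Fin n, φ (Function.update v i (f (v i))) :=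
  derivMulti_apply φ.toMultilinearMap f v

/-- The endomorphism `v₁ ∧ … ∧ vₙ ↦ ∑ i, v₁ ∧ … ∧ f vᵢ ∧ … ∧ vₙ`. -/
def wedgeEnd (n : ℕ) (f : Module.End R M) : Module.End R (⋀[R]^n M) :=
  exteriorPower.alternatingMapLinearEquiv (derivAlt (exteriorPower.ιMulti R n) f)

theorem wedgeEnd_ιMulti (f : Module.End R M) (v : Fin n → M) :
    wedgeEnd n f (exteriorPower.ιMulti R n v)
      = ∑ i, exteriorPower.ιMulti R n (Function.update v i (f (v i))) := by
  rw [wedgeEnd, exteriorPower.alternatingMapLinearEquiv_apply_ιMulti, derivAlt_apply]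

/-- The endomorphism `v₁ ⊗ … ⊗ vₙ ↦ ∑ i, v₁ ⊗ … ⊗ f vᵢ ⊗ … ⊗ vₙ`. -/
def tensorEnd (n : ℕ) (f : Module.End R M) : Module.End R (⨂[R] _ : Fin n, M) :=
  PiTensorProduct.lift (derivMulti (PiTensorProduct.tprod R) f)

theorem tensorEnd_tprod (f : Module.End R M) (v : Fin n → M) :
    tensorEnd n f (PiTensorProduct.tprod R v)
      = ∑ i, PiTensorProduct.tprod R (Function.update v i (f (v i))) := by
  rw [tensorEnd, PiTensorProduct.lift.tprod, derivMulti_apply]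

/-- The Lie algebra homomorphism `gl(M) → gl(⋀ⁿ M)`. -/
def wedgeLie (R M : Type*) [CommRing R] [AddCommGroup M] [Module R M] (n : ℕ) :
    Module.End R M →ₗ⁅R⁆ Module.End R (⋀[R]^n M) where
  toFun := wedgeEnd n
  map_add' f g := by
    refine exteriorPower.linearMap_ext (AlternatingMap.ext fun v => ?_)
    simp [wedgeEnd_ιMulti, Finset.sum_add_distrib]
  map_smul' c f := by
    refine exteriorPower.linearMap_ext (AlternatingMap.ext fun v => ?_)
    simp [wedgeEnd_ιMulti, Finset.smul_sum]
  map_lie' := by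
    intro f g
    refine exteriorPower.linearMap_ext (AlternatingMap.ext fun v => ?_)
    have h := derivMulti_comm (exteriorPower.ιMulti R n (M := M)).toMultilinearMap f g v
    rw [LieRing.of_associative_ring_bracket (wedgeEnd n f)]
    simp only [LinearMap.compAlternatingMap_apply, LinearMap.sub_apply, Module.End.mul_apply,
      wedgeEnd_ιMulti, map_sum]
    simp only [derivMulti_apply] at h
    exact eq_sub_of_add_eq h.symm

/-- The Lie algebra homomorphism `gl(M) → gl(M^{⊗ n})`. -/
def tensorLie (R M : Type*) [CommRing R] [AddCommGroup M] [Module R M] (n : ℕ) :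
    Module.End R M →ₗ⁅R⁆ Module.End R (⨂[R] _ : Fin n, M) where
  toFun := tensorEnd n
  map_add' f g := by
    refine PiTensorProduct.ext (MultilinearMap.ext fun v => ?_)
    simp [tensorEnd_tprod, Finset.sum_add_distrib]
  map_smul' c f := by
    refine PiTensorProduct.ext (MultilinearMap.ext fun v => ?_)
    simp [tensorEnd_tprod, Finset.smul_sum]
  map_lie' := by
    intro f g
    refine PiTensorProduct.ext (MultilinearMap.ext fun v => ?_)
    have h := derivMulti_comm (PiTensorProduct.tprod R (s := fun _ : Fin n => M)) f g v
    rw [LieRing.of_associative_ring_bracket (tensorEnd n f)]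
    simp only [LinearMap.compMultilinearMap_apply, LinearMap.sub_apply, Module.End.mul_apply,
      tensorEnd_tprod, map_sum]
    simp only [derivMulti_apply] at h
    exact eq_sub_of_add_eq h.symm

variable {L : Type*} [LieRing L] [LieAlgebra R L] [LieRingModule L M] [LieModule R L M]

instance wedgeLieRingModule : LieRingModule L (⋀[R]^n M) :=
  LieRingModule.compLieHom _ ((wedgeLie R M n).comp (LieModule.toEnd R L M))

instance wedgeLieModule : LieModule R L (⋀[R]^n M) :=
  LieModule.compLieHom _ ((wedgeLie R M n).comp (LieModule.toEnd R L M))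

instance tensorLieRingModule : LieRingModule L (⨂[R] _ : Fin n, M) :=
  LieRingModule.compLieHom _ ((tensorLie R M n).comp (LieModule.toEnd R L M))

instance tensorLieModule : LieModule R L (⨂[R] _ : Fin n, M) :=
  LieModule.compLieHom _ ((tensorLie R M n).comp (LieModule.toEnd R L M))

theorem lie_ιMulti (x : L) (v : Fin n → M) :
    ⁅x, exteriorPower.ιMulti R n v⁆
      = ∑ i, exteriorPower.ιMulti R n (Function.update v i ⁅x, v i⁆) :=
  wedgeEnd_ιMulti (LieModule.toEnd R L M x) v

theorem lie_tprod (x : L) (v : Fin n → M) :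
    ⁅x, PiTensorProduct.tprod R v⁆
      = ∑ i, PiTensorProduct.tprod R (Function.update v i ⁅x, v i⁆) :=
  tensorEnd_tprod (LieModule.toEnd R L M x) v

end PowerAction

/-! ### Characters of `gl_r`-modules -/

/-- The Lie algebra `gl_r` of complex `r × r` matrices with the commutator. -/
abbrev Gl (r : ℕ) : Type := Matrix (Fin r) (Fin r) ℂ

/-- The ring of formal characters: finite `ℤ`-linear combinations of the formal exponentials `e^η`
of the weights `η` of the diagonal Cartan subalgebra. -/
abbrev CharRing (r : ℕ) : Type := AddMonoidAlgebra ℤ (Fin r → ℂ)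

section Character

variable (r : ℕ) (M : Type) [AddCommGroup M] [Module ℂ M] [LieRingModule (Gl r) M]
  [LieModule ℂ (Gl r) M]

/-- The weight subspace on which each `E_ii` acts by the scalar `η i`. -/
def weightSubspace (η : Fin r → ℂ) : Submodule ℂ M where
  carrier := {v | ∀ i : Fin r, ⁅(Matrix.single i i 1 : Gl r), v⁆ = η i • v}
  zero_mem' := by intro i; simp
  add_mem' := by intro v w hv hw i; rw [lie_add, hv i, hw i, smul_add]
  smul_mem' := by intro c v hv i; rw [lie_smul, hv i, smul_comm]

/-- The character `∑ η, dim M^η · e^η` of a finite-dimensional `gl_r`-module. -/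
def ch : CharRing r :=
  ∑ᶠ η : Fin r → ℂ, AddMonoidAlgebra.single η (Module.finrank ℂ (weightSubspace r M η) : ℤ)

end Character

/-! ### The algebra `ℂ⟨𝒳, 𝒴⟩` and the Lie algebra `𝒢_r` -/

/-- The relation `𝒴𝒳 - 𝒳𝒴 = 𝒳` on the free algebra on two generators `𝒳 = ι 0`, `𝒴 = ι 1`. -/
inductive XYRel : FreeAlgebra ℂ (Fin 2) → FreeAlgebra ℂ (Fin 2) → Prop
  | comm : XYRel
      (FreeAlgebra.ι ℂ 1 * FreeAlgebra.ι ℂ 0 - FreeAlgebra.ι ℂ 0 * FreeAlgebra.ι ℂ 1)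
      (FreeAlgebra.ι ℂ 0)

/-- The associative algebra generated by `𝒳`, `𝒴` under the relation `𝒴𝒳 - 𝒳𝒴 = 𝒳`. -/
abbrev XYAlg : Type := RingQuot XYRel

/-- The generator `𝒳`. -/
def genX : XYAlg := RingQuot.mkAlgHom ℂ XYRel (FreeAlgebra.ι ℂ 0)

/-- The generator `𝒴`. -/
def genY : XYAlg := RingQuot.mkAlgHom ℂ XYRel (FreeAlgebra.ι ℂ 1)

/-- The subspace `Fⁿ ℂ⟨𝒳, 𝒴⟩` spanned by the `𝒳^i 𝒴^j` with `j ≤ n`. -/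
def algFil (n : ℕ) : Submodule ℂ XYAlg :=
  Submodule.span ℂ {a | ∃ i j : ℕ, j ≤ n ∧ a = genX ^ i * genY ^ j}

/-- The Lie algebra `𝒢_r = gl_r ⊗ ℂ⟨𝒳, 𝒴⟩` of matrices over `ℂ⟨𝒳, 𝒴⟩` with the commutator. -/
abbrev GXY (r : ℕ) : Type := Matrix (Fin r) (Fin r) XYAlg

/-- `g` lies in `Fⁿ 𝒢_r = gl_r ⊗ Fⁿ ℂ⟨𝒳, 𝒴⟩`. -/
def InLieFil (r n : ℕ) (g : GXY r) : Prop := ∀ i j, g i j ∈ algFil n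

/-- The inclusion `gl_r ⊗ 1 ⊂ 𝒢_r`. -/
def constLie (r : ℕ) : Gl r →ₗ⁅ℂ⁆ GXY r :=
  ((Algebra.ofId ℂ XYAlg).mapMatrix : Gl r →ₐ[ℂ] GXY r).toLieHom

/-- The subspace `U^{≤ m}(𝒢_r)` of the universal enveloping algebra, spanned by the products
`g₁ ⋯ g_k` with `g_i ∈ F^{d_i} 𝒢_r` and `d₁ + ⋯ + d_k ≤ m`; it is zero for `m < 0`. -/
def envFil (r : ℕ) (m : ℤ) : Submodule ℂ (UniversalEnvelopingAlgebra ℂ (GXY r)) :=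
  Submodule.span ℂ {u | ∃ l : List (ℕ × GXY r), (∀ p ∈ l, InLieFil r p.1 p.2) ∧
    ((l.map Prod.fst).sum : ℤ) ≤ m ∧
    u = (l.map fun p => UniversalEnvelopingAlgebra.ι ℂ p.2).prod}

/-! ### The space `V_r^{(N)}` -/

/-- The subspace `x^N ℂ[x]` of `ℂ[x, x⁻¹]`. -/
def xPow (N : ℤ) : Submodule ℂ ℂ[T;T⁻¹] :=
  Submodule.span ℂ {p | ∃ m : ℤ, N ≤ m ∧ p = LaurentPolynomial.T m}

/-- The space `ℂ[x, x⁻¹] / x^N ℂ[x]`. -/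
def LQuot (N : ℤ) : Type := ℂ[T;T⁻¹] ⧸ xPow N

instance (N : ℤ) : AddCommGroup (LQuot N) := inferInstanceAs (AddCommGroup (ℂ[T;T⁻¹] ⧸ xPow N))

instance (N : ℤ) : Module ℂ (LQuot N) := inferInstanceAs (Module ℂ (ℂ[T;T⁻¹] ⧸ xPow N))

/-- Multiplication by `x` on `ℂ[x, x⁻¹]`. -/
def opX : Module.End ℂ ℂ[T;T⁻¹] := LinearMap.mulLeft ℂ (LaurentPolynomial.T 1)

/-- The operator `x ∂/∂x` on `ℂ[x, x⁻¹]`. -/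
def opY : Module.End ℂ ℂ[T;T⁻¹] :=
  (Finsupp.linearCombination ℂ fun m : ℤ => (m : ℂ) • (LaurentPolynomial.T m : ℂ[T;T⁻¹])) ∘ₗ
    (AddMonoidAlgebra.coeffLinearEquiv ℂ).toLinearMap

theorem opX_T (m : ℤ) : opX (LaurentPolynomial.T m) = LaurentPolynomial.T (m + 1) := by
  rw [opX, LinearMap.mulLeft_apply, ← LaurentPolynomial.T_add, add_comm]

theorem opY_T (m : ℤ) :
    opY (LaurentPolynomial.T m) = (m : ℂ) • (LaurentPolynomial.T m : ℂ[T;T⁻¹]) := by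
  change Finsupp.linearCombination ℂ (fun m : ℤ => (m : ℂ) • (LaurentPolynomial.T m : ℂ[T;T⁻¹]))
    (Finsupp.single m 1) = _
  rw [Finsupp.linearCombination_single, one_smul]

theorem laurent_end_ext {E : Type*} [AddCommGroup E] [Module ℂ E] {f g : ℂ[T;T⁻¹] →ₗ[ℂ] E}
    (h : ∀ m : ℤ, f (LaurentPolynomial.T m) = g (LaurentPolynomial.T m)) : f = g := by
  refine AddMonoidAlgebra.lhom_ext' fun m => LinearMap.ext_ring ?_
  exact h m

theorem opY_opX : opY * opX - opX * opY = opX := by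
  refine laurent_end_ext fun m => ?_
  simp only [LinearMap.sub_apply, Module.End.mul_apply, opX_T, opY_T, map_smul]
  rw [← sub_smul]
  simp

theorem xPow_le_opX (N : ℤ) : xPow N ≤ (xPow N).comap opX := by
  refine Submodule.span_le.2 ?_
  rintro _ ⟨m, hm, rfl⟩
  change opX _ ∈ xPow N
  rw [opX_T]
  exact Submodule.subset_span ⟨m + 1, by omega, rfl⟩

theorem xPow_le_opY (N : ℤ) : xPow N ≤ (xPow N).comap opY := by
  refine Submodule.span_le.2 ?_
  rintro _ ⟨m, hm, rfl⟩
  change opY _ ∈ xPow N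
  rw [opY_T]
  exact Submodule.smul_mem _ _ (Submodule.subset_span ⟨m, hm, rfl⟩)

/-- The operator induced by `x` on `ℂ[x, x⁻¹] / x^N ℂ[x]`. -/
def quotX (N : ℤ) : Module.End ℂ (LQuot N) := (xPow N).mapQ (xPow N) opX (xPow_le_opX N)

/-- The operator induced by `x ∂/∂x` on `ℂ[x, x⁻¹] / x^N ℂ[x]`. -/
def quotY (N : ℤ) : Module.End ℂ (LQuot N) := (xPow N).mapQ (xPow N) opY (xPow_le_opY N)

theorem quotY_quotX (N : ℤ) : quotY N * quotX N - quotX N * quotY N = quotX N := by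
  refine LinearMap.ext fun q => ?_
  obtain ⟨p, rfl⟩ := Submodule.Quotient.mk_surjective (xPow N) q
  exact congrArg (Submodule.Quotient.mk (p := xPow N)) (LinearMap.congr_fun opY_opX p)

/-- The action of `ℂ⟨𝒳, 𝒴⟩` on `ℂ[x, x⁻¹] / x^N ℂ[x]` in which `𝒳` acts by `x` and `𝒴` by
`x ∂/∂x`. -/
def algAction (N : ℤ) : XYAlg →ₐ[ℂ] Module.End ℂ (LQuot N) :=
  RingQuot.liftAlgHom ℂ ⟨FreeAlgebra.lift ℂ ![quotX N, quotY N], by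
    intro a b h
    induction h
    simpa using quotY_quotX N⟩

/-- The space `V_r^{(N)} = V_r ⊗ (ℂ[x, x⁻¹] / x^N ℂ[x])`, as the space of column vectors of
length `r` over the second factor. -/
def VN (r : ℕ) (N : ℤ) : Type := Fin r → LQuot N

instance (r : ℕ) (N : ℤ) : AddCommGroup (VN r N) := inferInstanceAs (AddCommGroup (Fin r → LQuot N))

instance (r : ℕ) (N : ℤ) : Module ℂ (VN r N) := inferInstanceAs (Module ℂ (Fin r → LQuot N))

/-- A matrix over `ℂ⟨𝒳, 𝒴⟩` acts on column vectors. -/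
instance (r : ℕ) (N : ℤ) : LieRingModule (GXY r) (VN r N) where
  bracket g v := fun i => ∑ j, algAction N (g i j) (v j)
  add_lie g h v := by
    funext i
    change ∑ j, algAction N ((g + h) i j) (v j)
      = ∑ j, algAction N (g i j) (v j) + ∑ j, algAction N (h i j) (v j)
    simp [Finset.sum_add_distrib]
  lie_add g v w := by
    funext i
    change ∑ j, algAction N (g i j) (v j + w j)
      = ∑ j, algAction N (g i j) (v j) + ∑ j, algAction N (g i j) (w j)
    simp [Finset.sum_add_distrib]
  leibniz_lie g h v := by
    have hm : ∀ (a b : GXY r) (i : Fin r), ∑ j, algAction N ((a * b) i j) (v j)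
        = ∑ j, algAction N (a i j) (∑ k, algAction N (b j k) (v k)) := by
      intro a b i
      simp only [Matrix.mul_apply, map_sum, map_mul, LinearMap.sum_apply, Module.End.mul_apply]
      exact Finset.sum_comm
    funext i
    change ∑ j, algAction N (g i j) (∑ k, algAction N (h j k) (v k))
      = ∑ j, algAction N ((g * h - h * g) i j) (v j)
        + ∑ j, algAction N (h i j) (∑ k, algAction N (g j k) (v k))
    rw [← hm, ← hm, ← Finset.sum_add_distrib]
    refine Finset.sum_congr rfl fun j _ => ?_
    simp

instance (r : ℕ) (N : ℤ) : LieModule ℂ (GXY r) (VN r N) where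
  smul_lie c g v := by
    funext i
    change ∑ j, algAction N ((c • g) i j) (v j) = c • ∑ j, algAction N (g i j) (v j)
    simp [Finset.smul_sum]
  lie_smul c g v := by
    funext i
    change ∑ j, algAction N (g i j) (c • v j) = c • ∑ j, algAction N (g i j) (v j)
    simp [Finset.smul_sum]

/-- The action of the constants `gl_r ⊗ 1` on `V_r^{(N)}`. -/
instance (r : ℕ) (N : ℤ) : LieRingModule (Gl r) (VN r N) :=
  LieRingModule.compLieHom _ (constLie r)

instance (r : ℕ) (N : ℤ) : LieModule ℂ (Gl r) (VN r N) :=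
  LieModule.compLieHom _ (constLie r)

/-- The vector `u^i_j = u_j ⊗ x^i` of `V_r^{(N)}`. -/
def uVec {r : ℕ} (N i : ℤ) (j : Fin r) : VN r N :=
  Pi.single (M := fun _ => LQuot N) j (Submodule.Quotient.mk (LaurentPolynomial.T i))

theorem uVec_same {r : ℕ} (N i : ℤ) (j : Fin r) :
    uVec N i j j = Submodule.Quotient.mk (LaurentPolynomial.T i) :=
  Pi.single_eq_same (M := fun _ : Fin r => LQuot N) j _

theorem uVec_of_ne {r : ℕ} (N i : ℤ) {j k : Fin r} (h : k ≠ j) : uVec N i j k = 0 :=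
  Pi.single_eq_of_ne (M := fun _ : Fin r => LQuot N) h _

theorem const_lie_uVec {r : ℕ} (N i : ℤ) (j : Fin r) (g : Gl r) :
    ⁅g, uVec N i j⁆ = ∑ l, g l j • uVec N i l := by
  have hc : ∀ k l : Fin r, constLie r g k l = algebraMap ℂ XYAlg (g k l) := fun _ _ => rfl
  funext k
  change ∑ l, algAction N (constLie r g k l) (uVec N i j l) = _
  have h1 : (∑ l, g l j • uVec N i l : VN r N) k = ∑ l, (g l j • uVec N i l : VN r N) k :=
    Finset.sum_apply (M := fun _ : Fin r => LQuot N) k Finset.univ _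
  rw [h1, Finset.sum_eq_single j, Finset.sum_eq_single k]
  · rw [hc, AlgHom.commutes]
    change g k j • uVec N i j j = g k j • uVec N i k k
    rw [uVec_same, uVec_same]
  · intro l _ hl
    change g l j • uVec N i l k = 0
    rw [uVec_of_ne N i (Ne.symm hl), smul_zero]
  · simp
  · intro l _ hl
    rw [uVec_of_ne N i hl, map_zero]
  · simp

/-! ### The deformed modules `𝒱(ξ, N)` -/

/-- The space `⋀ⁿ V_r^{(N)}`. -/
abbrev WedgeVN (r n : ℕ) (N : ℤ) : Type := ⋀[ℂ]^n (VN r N)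

theorem const_lie_wedge {r n : ℕ} {N : ℤ} (g : Gl r) (w : WedgeVN r n N) :
    ⁅g, w⁆ = ⁅constLie r g, w⁆ := rfl

section Weyl

variable {r : ℕ}

/-- The vector `v_ξ^{(N)} = ⋀_{j=1}^r ⋀_{i=N-ξ_j}^{N-1} u^i_j`. -/
def cyclicVec (ξ : Fin r → ℕ) (N : ℤ) : WedgeVN r (∑ j, ξ j) N :=
  exteriorPower.ιMulti ℂ (∑ j, ξ j) fun k : Fin (∑ j, ξ j) =>
    let p : (j : Fin r) × Fin (ξ j) := finSigmaFinEquiv.symm k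
    uVec N (N - ξ p.1 + (p.2 : ℕ)) p.1

/-- The module `𝒱(ξ, N)`: the `𝒢_r`-submodule generated by `v_ξ^{(N)}`. -/
def deformedWeyl (ξ : Fin r → ℕ) (N : ℤ) : LieSubmodule ℂ (GXY r) (WedgeVN r (∑ j, ξ j) N) :=
  LieSubmodule.lieSpan ℂ (GXY r) {cyclicVec ξ N}

/-- The action of `U(𝒢_r)` on the exterior power. -/
def envAction (r n : ℕ) (N : ℤ) :
    UniversalEnvelopingAlgebra ℂ (GXY r) →ₐ[ℂ] Module.End ℂ (WedgeVN r n N) :=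
  UniversalEnvelopingAlgebra.lift ℂ (LieModule.toEnd ℂ (GXY r) (WedgeVN r n N))

theorem const_mul_mem_envFil {m : ℤ} (g : Gl r) {u : UniversalEnvelopingAlgebra ℂ (GXY r)}
    (hu : u ∈ envFil r m) : UniversalEnvelopingAlgebra.ι ℂ (constLie r g) * u ∈ envFil r m := by
  have h0 : InLieFil r 0 (constLie r g) := by
    intro i j
    have : constLie r g i j = g i j • (1 : XYAlg) := Algebra.algebraMap_eq_smul_one (g i j)
    rw [this]
    exact Submodule.smul_mem _ _ (Submodule.subset_span ⟨0, 0, le_rfl, by simp⟩)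
  induction hu using Submodule.span_induction with
  | mem u hu =>
    obtain ⟨l, hl, hm, rfl⟩ := hu
    refine Submodule.subset_span ⟨(0, constLie r g) :: l, ?_, ?_, ?_⟩
    · rintro p hp
      rcases List.mem_cons.1 hp with rfl | hp
      · exact h0
      · exact hl p hp
    · simpa using hm
    · simp
  | zero => simp
  | add u w _ _ hu hw => rw [mul_add]; exact Submodule.add_mem _ hu hw
  | smul c u _ hu => rw [mul_smul_comm]; exact Submodule.smul_mem _ c hu

theorem envAction_ι_mul {n : ℕ} {N : ℤ} (x : GXY r) (u : UniversalEnvelopingAlgebra ℂ (GXY r))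
    (w : WedgeVN r n N) :
    envAction r n N (UniversalEnvelopingAlgebra.ι ℂ x * u) w = ⁅x, envAction r n N u w⁆ := by
  rw [map_mul, envAction, UniversalEnvelopingAlgebra.lift_ι_apply]
  rfl

/-- The filtration `F^m 𝒱(ξ, N) = U^{≤ m}(𝒢_r) · v_ξ^{(N)}` by `gl_r`-submodules; it is zero for
`m < 0`. -/
def weylFil (ξ : Fin r → ℕ) (N m : ℤ) : LieSubmodule ℂ (Gl r) (WedgeVN r (∑ j, ξ j) N) where
  __ := (envFil r m).map
    ((LinearMap.applyₗ (cyclicVec ξ N)).comp (envAction r (∑ j, ξ j) N).toLinearMap)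
  lie_mem := by
    rintro g _ ⟨u, hu, rfl⟩
    exact ⟨_, const_mul_mem_envFil g hu, envAction_ι_mul (constLie r g) u (cyclicVec ξ N)⟩

/-- The parts of the transposed partition: `ξ^t_i` is the number of `j` with `ξ_j ≥ i`. -/
def transposePart (ξ : Fin r → ℕ) (i : ℕ) : ℕ := (Finset.univ.filter fun j => i ≤ ξ j).card

/-- The monomial `u_H^{(N)} = ⋀_{(i, j) ∈ H} u_j^{N-i}`, where `H ⊂ {1, 2, …} × {1, …, r}` is given
by an enumeration `e` (if `e` repeats an element, the monomial is zero). -/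
def monomialVec {n : ℕ} (N : ℤ) (e : Fin n → ℕ+ × Fin r) : WedgeVN r n N :=
  exteriorPower.ιMulti ℂ n fun k => uVec N (N - ((e k).1 : ℕ)) (e k).2

/-- The number `d(H) = ∑_i i ξ^t_i - ∑_{(i, j) ∈ H} i` for the set `H` enumerated by `e`. -/
def monomialDeg (ξ : Fin r → ℕ) {n : ℕ} (e : Fin n → ℕ+ × Fin r) : ℤ :=
  ∑ i ∈ Finset.Icc 1 (∑ j, ξ j), (i : ℤ) * transposePart ξ i - ∑ k, (((e k).1 : ℕ) : ℤ)

theorem const_lie_monomialVec {n : ℕ} (N : ℤ) (g : Gl r) (e : Fin n → ℕ+ × Fin r) :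
    ⁅g, monomialVec N e⁆
      = ∑ k, ∑ l, g l (e k).2 • monomialVec N (Function.update e k ((e k).1, l)) := by
  rw [monomialVec, lie_ιMulti]
  refine Finset.sum_congr rfl fun k _ => ?_
  rw [const_lie_uVec, AlternatingMap.map_update_sum]
  refine Finset.sum_congr rfl fun l _ => ?_
  rw [AlternatingMap.map_update_smul, monomialVec]
  congr 2
  funext k'
  by_cases h : k' = k
  · subst h; simp
  · simp [h]

/-- The span of the monomials `u_H^{(N)}` with `d(H) = m`. -/
def wedgeGrade (ξ : Fin r → ℕ) (N m : ℤ) : LieSubmodule ℂ (Gl r) (WedgeVN r (∑ j, ξ j) N) where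
  __ := Submodule.span ℂ {w | ∃ e : Fin (∑ j, ξ j) → ℕ+ × Fin r,
    monomialDeg ξ e = m ∧ w = monomialVec N e}
  lie_mem := by
    intro g w hw
    change w ∈ Submodule.span ℂ _ at hw
    change ⁅g, w⁆ ∈ Submodule.span ℂ _
    induction hw using Submodule.span_induction with
    | mem w hw =>
      obtain ⟨e, he, rfl⟩ := hw
      rw [const_lie_monomialVec]
      refine Submodule.sum_mem _ fun k _ => Submodule.sum_mem _ fun l _ =>
        Submodule.smul_mem _ _ (Submodule.subset_span ⟨_, ?_, rfl⟩)
      rw [← he, monomialDeg, monomialDeg]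
      congr 1
      refine Finset.sum_congr rfl fun k' _ => ?_
      by_cases h : k' = k
      · subst h; simp
      · simp [h]
    | zero => simp
    | add v w _ _ hv hw => rw [lie_add]; exact Submodule.add_mem _ hv hw
    | smul c w _ hw => rw [lie_smul]; exact Submodule.smul_mem _ c hw

/-- The graded component `𝒱^m(ξ, N)`: the elements of `𝒱(ξ, N)` that are combinations of monomials
`u_H^{(N)}` with `d(H) = m`. -/
def weylGrade (ξ : Fin r → ℕ) (N m : ℤ) : LieSubmodule ℂ (Gl r) (WedgeVN r (∑ j, ξ j) N) where
  __ := (deformedWeyl ξ N).toSubmodule ⊓ (wedgeGrade ξ N m).toSubmodule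
  lie_mem := by
    rintro g w ⟨h₁, h₂⟩
    exact ⟨(deformedWeyl ξ N).lie_mem (x := constLie r g) h₁, (wedgeGrade ξ N m).lie_mem h₂⟩

/-- The `gl_r`-module `F^j 𝒱^i(ξ, N) = 𝒱^i(ξ, N) ∩ F^j 𝒱(ξ, N)`. -/
def weylFilGrade (ξ : Fin r → ℕ) (N i j : ℤ) :
    LieSubmodule ℂ (Gl r) (WedgeVN r (∑ j, ξ j) N) :=
  weylGrade ξ N i ⊓ weylFil ξ N j

/-- The `gl_r`-module `V^{ij}(ξ) = F^j 𝒱^i(ξ, N) / F^{j-1} 𝒱^i(ξ, N)`: the component of bidegree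
`(i, j)` of the associated graded module `V(ξ) = gr F^• 𝒱(ξ, N)`. -/
abbrev DegenerateWeyl (ξ : Fin r → ℕ) (N i j : ℤ) : Type :=
  ↥(weylFilGrade ξ N i j) ⧸ (weylFilGrade ξ N i (j - 1)).comap (weylFilGrade ξ N i j).incl

/-- The character `ch_{x,y} V(ξ) = ∑_{i,j} x^i y^j ch V^{ij}(ξ)`: a polynomial in `y` over Laurent
polynomials in `x` over the ring of formal characters. -/
def chXY (ξ : Fin r → ℕ) (N : ℤ) : Polynomial (LaurentPolynomial (CharRing r)) :=
  ∑ᶠ p : ℤ × ℕ, Polynomial.monomial p.2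
    (LaurentPolynomial.C (ch r (DegenerateWeyl ξ N p.1 p.2)) * LaurentPolynomial.T p.1)

/-- The character `ch_x V(ξ)`: the specialization of `ch_{x,y} V(ξ)` at `y = 1`. -/
def chX (ξ : Fin r → ℕ) (N : ℤ) : LaurentPolynomial (CharRing r) := (chXY ξ N).eval 1

end Weyl

/-! ### `ρ`-parking functions -/

/-- The partition `(1^{η_1} 2^{η_2} ⋯ b^{η_b})`, in which each `j ≤ b` appears `η_j` times, as a
weakly decreasing list. -/
def expPartition (b : ℕ) (η : ℕ → ℕ) : List ℕ :=
  (List.range b).reverse.flatMap fun i => List.replicate (η (i + 1)) (i + 1)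

/-- The partition `ρ = (1^{ξ^t_1} 2^{ξ^t_2} ⋯)`; note that `ξ^t_i = 0` for `i > |ξ|`. -/
def rhoPartition {r : ℕ} (ξ : Fin r → ℕ) : List ℕ := expPartition (∑ j, ξ j) (transposePart ξ)

/-- For `ρ = (ρ_1 ≥ ⋯ ≥ ρ_k ≥ 0)`, a function `f : {1, …, n} → {1, …, n}` is a `ρ`-parking function
if `|f⁻¹ {1, …, ρ_{k-s+1}}| ≥ s` for `s = 1, …, k`. The domain is indexed by `Fin n`. -/
def IsParking (n : ℕ) (ρ : List ℕ) (f : Fin n → Finset.Icc 1 n) : Prop :=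
  ∀ s : ℕ, 1 ≤ s → s ≤ ρ.length →
    s ≤ (Finset.univ.filter fun i => (f i : ℕ) ≤ ρ.getD (ρ.length - s) 0).card

/-- The integer `|f| = |ρ| - ∑ f(i)`. -/
def parkingDeg {n : ℕ} (ρ : List ℕ) (f : Fin n → Finset.Icc 1 n) : ℤ :=
  (ρ.sum : ℤ) - ∑ i, ((f i : ℕ) : ℤ)

/-- The set of `ρ`-parking functions `f` with `|f| = m`. -/
def PF (n : ℕ) (ρ : List ℕ) (m : ℤ) : Type :=
  {f : Fin n → Finset.Icc 1 n // IsParking n ρ f ∧ parkingDeg ρ f = m}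

theorem IsParking.comp_perm {n : ℕ} {ρ : List ℕ} {f : Fin n → Finset.Icc 1 n}
    (hf : IsParking n ρ f) (σ : Equiv.Perm (Fin n)) : IsParking n ρ (f ∘ σ) := by
  intro s h1 h2
  refine (hf s h1 h2).trans (Finset.card_le_card_of_injOn σ.symm ?_ σ.symm.injective.injOn)
  intro i hi
  simpa using hi

theorem parkingDeg_comp_perm {n : ℕ} (ρ : List ℕ) (f : Fin n → Finset.Icc 1 n)
    (σ : Equiv.Perm (Fin n)) : parkingDeg ρ (f ∘ σ) = parkingDeg ρ f := by
  rw [parkingDeg, parkingDeg]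
  congr 1
  exact Equiv.sum_comp σ fun i => ((f i : ℕ) : ℤ)

/-- The symmetric group acts on parking functions by permutation of the domain. -/
instance (n : ℕ) (ρ : List ℕ) (m : ℤ) : MulAction (Equiv.Perm (Fin n)) (PF n ρ m) where
  smul σ f := ⟨f.1 ∘ σ.symm, f.2.1.comp_perm σ.symm,
    (parkingDeg_comp_perm ρ f.1 σ.symm).trans f.2.2⟩
  one_smul _ := rfl
  mul_smul _ _ _ := rfl

/-- The permutation representation `ℂPF_n^m(ρ)`. -/
def parkingRep (n : ℕ) (ρ : List ℕ) (m : ℤ) :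
    Representation ℂ (Equiv.Perm (Fin n)) (MonoidAlgebra ℂ (PF n ρ m)) :=
  Representation.ofMulAction ℂ (Equiv.Perm (Fin n)) (PF n ρ m)

/-- The sign representation of the symmetric group. -/
def signRep (n : ℕ) : Representation ℂ (Equiv.Perm (Fin n)) ℂ where
  toFun σ := ((Equiv.Perm.sign σ : ℤ) : ℂ) • LinearMap.id
  map_one' := by ext; simp
  map_mul' σ τ := by ext; simp [mul_comm]

/-- The representation `ℂPF_n^m(ρ) ⊗ Sign`. -/
def parkingSignRep (n : ℕ) (ρ : List ℕ) (m : ℤ) :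
    Representation ℂ (Equiv.Perm (Fin n)) (MonoidAlgebra ℂ (PF n ρ m) ⊗[ℂ] ℂ) :=
  (parkingRep n ρ m).tprod (signRep n)

/-! ### Invariants in `V_r^{⊗ n} ⊗ W` -/

/-- The space `V_r^{⊗ n}`, where `V_r = ℂ^r` is the vector representation of `gl_r`. -/
abbrev TensorPow (r n : ℕ) : Type := ⨂[ℂ] _ : Fin n, (Fin r → ℂ)

/-- The permutation of the factors of `V_r^{⊗ n}` by `σ`. -/
def permEnd (r n : ℕ) (σ : Equiv.Perm (Fin n)) : Module.End ℂ (TensorPow r n) :=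
  (PiTensorProduct.reindex ℂ (fun _ : Fin n => Fin r → ℂ) σ).toLinearMap

theorem permEnd_tprod (r n : ℕ) (σ : Equiv.Perm (Fin n)) (v : Fin n → Fin r → ℂ) :
    permEnd r n σ (PiTensorProduct.tprod ℂ v) = PiTensorProduct.tprod ℂ fun i => v (σ.symm i) :=
  PiTensorProduct.reindex_tprod σ v

/-- The symmetric group permutes the factors of `V_r^{⊗ n}`. -/
def permRep (r n : ℕ) : Representation ℂ (Equiv.Perm (Fin n)) (TensorPow r n) where
  toFun := permEnd r n
  map_one' := by
    refine PiTensorProduct.ext (MultilinearMap.ext fun v => ?_)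
    exact permEnd_tprod r n 1 v
  map_mul' σ τ := by
    refine PiTensorProduct.ext (MultilinearMap.ext fun v => ?_)
    simp only [LinearMap.compMultilinearMap_apply, Module.End.mul_apply, permEnd_tprod]
    rfl

theorem permRep_lie (r n : ℕ) (σ : Equiv.Perm (Fin n)) (g : Gl r) (t : TensorPow r n) :
    permRep r n σ ⁅g, t⁆ = ⁅g, permRep r n σ t⁆ := by
  have h : permEnd r n σ ∘ₗ LieModule.toEnd ℂ (Gl r) (TensorPow r n) g
      = LieModule.toEnd ℂ (Gl r) (TensorPow r n) g ∘ₗ permEnd r n σ := by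
    refine PiTensorProduct.ext (MultilinearMap.ext fun v => ?_)
    simp only [LinearMap.compMultilinearMap_apply, LinearMap.comp_apply,
      LieModule.toEnd_apply_apply, permEnd_tprod, lie_tprod, map_sum]
    refine Fintype.sum_equiv σ _ _ fun i => ?_
    congr 1
    funext j
    by_cases hj : j = σ i
    · subst hj; simp
    · have : σ.symm j ≠ i := fun h => hj (by rw [← h, Equiv.apply_symm_apply])
      simp [hj, this]
  exact LinearMap.congr_fun h t

section Invariants

variable (r n : ℕ) {W : Type} [AddCommGroup W] [Module ℂ W]
  (τ : Representation ℂ (Equiv.Perm (Fin n)) W)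

/-- The `gl_r`-module `V_r^{⊗ n} ⊗ W`, where `gl_r` acts on the factor `V_r^{⊗ n}` only. -/
abbrev TensorPowWith (r n : ℕ) (W : Type) [AddCommGroup W] [Module ℂ W] : Type :=
  TensorPow r n ⊗[ℂ] TrivialLieModule ℂ (Gl r) W

/-- The diagonal action of the symmetric group on `V_r^{⊗ n} ⊗ W`. -/
def diagRep : Representation ℂ (Equiv.Perm (Fin n)) (TensorPowWith r n W) :=
  (permRep r n).tprod (W := TrivialLieModule ℂ (Gl r) W) τ

theorem diagRep_tmul (σ : Equiv.Perm (Fin n)) (t : TensorPow r n)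
    (w : TrivialLieModule ℂ (Gl r) W) :
    diagRep r n τ σ (t ⊗ₜ w) = permRep r n σ t ⊗ₜ[ℂ] (τ σ w : TrivialLieModule ℂ (Gl r) W) :=
  rfl

/-- The `gl_r`-module `(V_r^{⊗ n} ⊗ W)^{Σ_n}`. -/
def tensorInvariants : LieSubmodule ℂ (Gl r) (TensorPowWith r n W) where
  __ := (diagRep r n τ).invariants
  lie_mem := by
    intro g t ht σ
    have hg : ∀ (a : TensorPow r n) (b : TrivialLieModule ℂ (Gl r) W),
        ⁅g, a ⊗ₜ[ℂ] b⁆ = ⁅g, a⁆ ⊗ₜ[ℂ] b := by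
      intro a b
      rw [TensorProduct.LieModule.lie_tmul_right,
        trivial_lie_zero (Gl r) (TrivialLieModule ℂ (Gl r) W), TensorProduct.tmul_zero,
        add_zero]
    have h : diagRep r n τ σ ∘ₗ LieModule.toEnd ℂ (Gl r) (TensorPowWith r n W) g
        = LieModule.toEnd ℂ (Gl r) (TensorPowWith r n W) g ∘ₗ diagRep r n τ σ := by
      refine TensorProduct.ext' fun t w => ?_
      simp only [LinearMap.comp_apply, LieModule.toEnd_apply_apply, hg, diagRep_tmul, permRep_lie]
      exact (hg _ _).symm
    have h2 := LinearMap.congr_fun h t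
    simp only [LinearMap.comp_apply, LieModule.toEnd_apply_apply] at h2
    rw [h2, ht σ]

end Invariants

/-! ### Irreducible representations and the Frobenius map -/

section Specht

variable {n : ℕ}

/-- The parts of a partition in weakly decreasing order. -/
def partList (p : n.Partition) : List ℕ := p.parts.sort (· ≥ ·)

/-- The part `p_{i+1}` of a partition `p = (p_1 ≥ p_2 ≥ ⋯)`, zero beyond the last part. -/
def part (p : n.Partition) (i : ℕ) : ℕ := (partList p).getD i 0

theorem sum_partList (p : n.Partition) :
    ∑ i : Fin (partList p).length, (partList p).get i = n := by
  have h : (partList p).sum = n := by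
    rw [← Multiset.sum_coe, partList, Multiset.sort_eq, p.parts_sum]
  exact (Fin.sum_univ_getElem _).trans h

/-- The tableau of shape `p` that is filled with the elements of `Fin n` row by row: a bijection
between the boxes (row, position in the row) of the Young diagram and `Fin n`. -/
def tableau (p : n.Partition) :
    ((i : Fin (partList p).length) × Fin ((partList p).get i)) ≃ Fin n :=
  finSigmaFinEquiv.trans (finCongr (sum_partList p))

/-- The row of the tableau that contains `k`. -/
def rowOf (p : n.Partition) (k : Fin n) : ℕ := ((tableau p).symm k).1

/-- The column of the tableau that contains `k`. -/
def colOf (p : n.Partition) (k : Fin n) : ℕ := ((tableau p).symm k).2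

/-- The Young symmetrizer: the sum of the permutations that preserve each row, times the signed sum
of the permutations that preserve each column. -/
def youngSymmetrizer (p : n.Partition) : MonoidAlgebra ℂ (Equiv.Perm (Fin n)) :=
  (∑ σ ∈ Finset.univ.filter fun σ : Equiv.Perm (Fin n) => ∀ k, rowOf p (σ k) = rowOf p k,
      MonoidAlgebra.single σ 1) *
    ∑ σ ∈ Finset.univ.filter fun σ : Equiv.Perm (Fin n) => ∀ k, colOf p (σ k) = colOf p k,
      MonoidAlgebra.single σ ((Equiv.Perm.sign σ : ℤ) : ℂ)

/-- The left ideal of the group algebra generated by the Young symmetrizer. -/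
def spechtSpace (p : n.Partition) : Submodule ℂ (MonoidAlgebra ℂ (Equiv.Perm (Fin n))) :=
  LinearMap.range (LinearMap.mulRight ℂ (youngSymmetrizer p))

/-- The irreducible representation `π_p` of the symmetric group, realized on the left ideal
generated by the Young symmetrizer. -/
def spechtRep (p : n.Partition) : Representation ℂ (Equiv.Perm (Fin n)) (spechtSpace p) :=
  (Representation.leftRegular ℂ (Equiv.Perm (Fin n))).subrepresentation (spechtSpace p) (by
    rintro σ _ ⟨x, rfl⟩
    have h : ∀ y, Representation.leftRegular ℂ (Equiv.Perm (Fin n)) σ y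
        = MonoidAlgebra.single σ 1 * y := by
      intro y
      induction y using MonoidAlgebra.induction_linear with
      | zero => simp
      | add a b ha hb => rw [map_add, ha, hb, mul_add]
      | single τ c => simp [MonoidAlgebra.single_mul_single]
    exact ⟨MonoidAlgebra.single σ 1 * x, by
      rw [h, LinearMap.mulRight_apply, LinearMap.mulRight_apply, mul_assoc]⟩)

/-- The class of a finite-dimensional representation `τ` in the Grothendieck group of `Σ_n`, the
free abelian group on the irreducible representations `π_p`: the coefficient at `p` is the
multiplicity `dim Hom_{Σ_n}(π_p, τ)`. -/
def symClass {W : Type} [AddCommGroup W] [Module ℂ W]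
    (τ : Representation ℂ (Equiv.Perm (Fin n)) W) : n.Partition →₀ ℤ :=
  Finsupp.equivFunOnFinite.symm fun p =>
    (Module.finrank ℂ ((spechtRep p).IntertwiningMap τ) : ℤ)

end Specht

section HighestWeight

/-- The left ideal of `U(gl_r)` generated by `E_ij` for `i < j` and by `E_ii - w_i`; the quotient by
it is the Verma module of highest weight `w`. -/
def vermaIdeal (r : ℕ) (w : Fin r → ℂ) :
    Submodule (UniversalEnvelopingAlgebra ℂ (Gl r)) (UniversalEnvelopingAlgebra ℂ (Gl r)) :=
  Submodule.span _
    ({u | ∃ i j : Fin r, i < j ∧ u = UniversalEnvelopingAlgebra.ι ℂ (Matrix.single i j 1 : Gl r)} ∪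
      {u | ∃ i : Fin r, u = UniversalEnvelopingAlgebra.ι ℂ (Matrix.single i i 1 : Gl r) -
        algebraMap ℂ _ (w i)})

/-- The preimage in `U(gl_r)` of the sum of all proper submodules of the Verma module. -/
def maxVermaIdeal (r : ℕ) (w : Fin r → ℂ) :
    Submodule (UniversalEnvelopingAlgebra ℂ (Gl r)) (UniversalEnvelopingAlgebra ℂ (Gl r)) :=
  sSup {J | vermaIdeal r w ≤ J ∧ J ≠ ⊤}

/-- The irreducible `gl_r`-module `π^w` of highest weight `w`: the quotient of the Verma module by
its largest proper submodule. -/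
def IrrGl (r : ℕ) (w : Fin r → ℂ) : Type :=
  UniversalEnvelopingAlgebra ℂ (Gl r) ⧸ maxVermaIdeal r w

instance (r : ℕ) (w : Fin r → ℂ) : AddCommGroup (IrrGl r w) :=
  inferInstanceAs (AddCommGroup (UniversalEnvelopingAlgebra ℂ (Gl r) ⧸ maxVermaIdeal r w))

instance (r : ℕ) (w : Fin r → ℂ) : Module (UniversalEnvelopingAlgebra ℂ (Gl r)) (IrrGl r w) :=
  inferInstanceAs (Module (UniversalEnvelopingAlgebra ℂ (Gl r))
    (UniversalEnvelopingAlgebra ℂ (Gl r) ⧸ maxVermaIdeal r w))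

instance (r : ℕ) (w : Fin r → ℂ) : Module ℂ (IrrGl r w) :=
  inferInstanceAs (Module ℂ (UniversalEnvelopingAlgebra ℂ (Gl r) ⧸ maxVermaIdeal r w))

instance (r : ℕ) (w : Fin r → ℂ) :
    IsScalarTower ℂ (UniversalEnvelopingAlgebra ℂ (Gl r)) (IrrGl r w) :=
  inferInstanceAs (IsScalarTower ℂ (UniversalEnvelopingAlgebra ℂ (Gl r))
    (UniversalEnvelopingAlgebra ℂ (Gl r) ⧸ maxVermaIdeal r w))

instance (r : ℕ) (w : Fin r → ℂ) : LieRingModule (Gl r) (IrrGl r w) where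
  bracket g m := UniversalEnvelopingAlgebra.ι ℂ g • m
  add_lie g h m := by
    change UniversalEnvelopingAlgebra.ι ℂ (g + h) • m = _ • m + _ • m
    rw [map_add, add_smul]
  lie_add g m m' := smul_add _ m m'
  leibniz_lie g h m := by
    change UniversalEnvelopingAlgebra.ι ℂ g • UniversalEnvelopingAlgebra.ι ℂ h • m
      = UniversalEnvelopingAlgebra.ι ℂ ⁅g, h⁆ • m
        + UniversalEnvelopingAlgebra.ι ℂ h • UniversalEnvelopingAlgebra.ι ℂ g • m
    rw [LieHom.map_lie, LieRing.of_associative_ring_bracket, sub_smul, mul_smul, mul_smul,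
      sub_add_cancel]

instance (r : ℕ) (w : Fin r → ℂ) : LieModule ℂ (Gl r) (IrrGl r w) where
  smul_lie c g m := by
    change UniversalEnvelopingAlgebra.ι ℂ (c • g) • m = c • UniversalEnvelopingAlgebra.ι ℂ g • m
    rw [map_smul, smul_assoc]
  lie_smul c g m := by
    change UniversalEnvelopingAlgebra.ι ℂ g • c • m = c • UniversalEnvelopingAlgebra.ι ℂ g • m
    rw [smul_algebra_smul_comm]

/-- The highest weights of the finite-dimensional irreducible representations of `gl_r`. -/
def DominantWeight (r : ℕ) : Type :=
  {w : Fin r → ℂ // ∀ i j, i ≤ j → ∃ k : ℕ, w i - w j = k}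

/-- The character on the Grothendieck group of finite-dimensional `gl_r`-modules, the free abelian
group on the irreducible modules `π^w`. -/
def grothendieckCh (r : ℕ) : (DominantWeight r →₀ ℤ) →ₗ[ℤ] CharRing r :=
  Finsupp.linearCombination ℤ fun w => ch r (IrrGl r w.1)

theorem part_antitone {n : ℕ} (p : n.Partition) : Antitone (part p) := by
  intro i j hij
  have hs : (partList p).Pairwise (· ≥ ·) := Multiset.pairwise_sort _ _
  unfold part
  by_cases hj : j < (partList p).length
  · rw [List.getD_eq_getElem _ _ hj, List.getD_eq_getElem _ _ (hij.trans_lt hj)]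
    rcases hij.eq_or_lt with rfl | h
    · exact le_rfl
    · exact List.pairwise_iff_getElem.1 hs i j _ _ h
  · rw [List.getD_eq_default _ _ (not_lt.1 hj)]
    exact Nat.zero_le _

/-- The first `r` parts of a partition as a dominant weight of `gl_r`. -/
def partWeight (r : ℕ) {n : ℕ} (p : n.Partition) : DominantWeight r :=
  ⟨fun i => (part p i : ℂ), fun i j hij =>
    ⟨part p i - part p j, by rw [Nat.cast_sub (part_antitone p hij)]⟩⟩

/-- The Frobenius map `𝓕_n^r` between the Grothendieck groups of `Σ_n` and of `gl_r`: it sends `π_p`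
to `π^p` if `p_{r+1} = 0` and to zero otherwise. -/
def frobeniusMap (n r : ℕ) : (n.Partition →₀ ℤ) →ₗ[ℤ] (DominantWeight r →₀ ℤ) :=
  Finsupp.linearCombination ℤ fun p =>
    if part p r = 0 then Finsupp.single (partWeight r p) 1 else 0

end HighestWeight

end

end ParkingWeyl

open scoped TensorProduct LaurentPolynomial

namespace ParkingWeyl

attribute [local instance 100] LieRing.ofAssociativeRing

noncomputable section

/-! ### Combinatorics of the standard filling -/

section Diagram

/-! At $y=1$ the characters of $F^j\mathcal V^i/F^{j-1}\mathcal V^i$ telescope in $j$: characters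
are additive on weight modules (`ch_quotient_add`), the filtration vanishes in negative degrees, and
it exhausts $\mathcal V(\xi,N)$ after finitely many steps. By `chX_eq_finsum` only the graded
components $\mathcal V^m(\xi,N)$ matter.

These components are spanned by monomials. By `deformedWeyl_toSubmodule`, $\mathcal V(\xi,N)$ is the
span of the $u_H$ such that, for every $s$, $H$ has at least as many boxes with $i\le s$ as $v_\xi$
has. This span is stable because $\mathcal X$ raises the exponent of $x$ and $\mathcal Y$ preserves
it, so that $i$ can only decrease. Conversely, a polynomial in $\mathcal Y$ selects a row, a matrix
unit selects a column, and a power of $\mathcal X$ moves the selected box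
(`exists_lie_monomialVec`); `exists_exchange` supplies the moves that lead from $v_\xi$ to any such
$u_H$.

For the sequence of first coordinates of the boxes, the condition on $H$ is the $\rho$-parking
condition (`isParking_rhoPartition_iff`). The map $(\otimes u_k)\otimes f\mapsto\bigwedge u_k\otimes
x^{N-f(k)}$ is constant on $\Sigma_n$-orbits, since the sign twist cancels the sign of the wedge
product. Averaging shows that its restriction to invariants has the same image, and determinant
functionals show that this restriction is injective (`ch_tensorInvariants_eq_of_basis`). This gives
the first formula.

The second formula is Schur–Weyl duality on the level of characters, for every finite-dimensional
representation of $\Sigma_n$ (`ch_tensorInvariants_eq_frobenius`). Weight multiplicities of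
invariants are averages of traces against the character of the representation, and that character is
a combination of Specht characters. Against the character of $\pi_p$ the average is a weight
multiplicity of the image of a Young symmetrizer on $V_r^{\otimes n}$. This image is zero if
$p_{r+1}\ne0$. Otherwise it is irreducible, because operators commuting with $\Sigma_n$ come from
$U(\mathfrak{gl}_r)$, and it contains an explicit highest weight vector, which identifies it with
$\pi^p$. -/

theorem card_lt_and_eq_le {α : Type*} [Fintype α] {row col row' col' : α → ℕ}
    (h : ∀ x y, row x = row y → col x = col y → x = y)
    (hcl : ∀ y, ∀ i ≤ row' y, ∃ z, row' z = i ∧ col' z = col' y)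
    (hc : ∀ j, (Finset.univ.filter fun x => col x = j).card
      ≤ (Finset.univ.filter fun x => col' x = j).card) (s j : ℕ) :
    (Finset.univ.filter fun x => row x < s ∧ col x = j).card
      ≤ (Finset.univ.filter fun y => row' y < s ∧ col' y = j).card := by
  -- If the primed column `j` reaches row `s`, it meets all `s` rows below, whereas the unprimed
  -- column has at most one element in each of them. Otherwise the whole primed column lies below
  -- row `s`, and the bound is `hc`.
  by_cases hy : ∃ y, col' y = j ∧ s ≤ row' y
  · obtain ⟨y, rfl, hsy⟩ := hy
    have h1 : (Finset.univ.filter fun x => row x < s ∧ col x = col' y).card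
        ≤ (Finset.range s).card := by
      refine Finset.card_le_card_of_injOn row (fun x hx => ?_) fun x hx z hz hxz => ?_
      · simp only [Finset.coe_filter, Finset.mem_univ, true_and, Set.mem_ofPred_eq] at hx
        simpa using hx.1
      · simp only [Finset.coe_filter, Finset.mem_univ, true_and, Set.mem_ofPred_eq] at hx hz
        exact h x z hxz (hx.2.trans hz.2.symm)
    refine h1.trans ?_
    refine (Finset.card_le_card (t := (Finset.univ.filter fun z => row' z < s ∧
      col' z = col' y).image row') fun i hi => ?_).trans Finset.card_image_le
    have hi' := Finset.mem_range.1 hi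
    obtain ⟨z, hz1, hz2⟩ := hcl y i (hi'.le.trans hsy)
    exact Finset.mem_image.2 ⟨z, by simp [hz1, hz2, hi'], hz1⟩
  · push Not at hy
    refine (Finset.card_le_card fun x hx => ?_).trans ((hc j).trans
      (Finset.card_le_card fun x hx => ?_))
    · simp only [Finset.mem_filter, Finset.mem_univ, true_and] at hx ⊢
      exact hx.2
    · simp only [Finset.mem_filter, Finset.mem_univ, true_and] at hx ⊢
      exact ⟨hy x hx, hx⟩

variable {n : ℕ}

theorem eq_of_rowOf_colOf (p : n.Partition) {x y : Fin n} (h1 : rowOf p x = rowOf p y)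
    (h2 : colOf p x = colOf p y) : x = y := by
  apply (tableau p).symm.injective
  unfold rowOf colOf at *
  generalize (tableau p).symm x = a at *
  generalize (tableau p).symm y = b at *
  obtain ⟨a, a'⟩ := a
  obtain ⟨b, b'⟩ := b
  have h1 := Fin.ext h1
  dsimp only at h1
  subst h1
  obtain rfl : a' = b' := Fin.ext h2
  rfl

theorem part_eq_get (p : n.Partition) (i : Fin (partList p).length) :
    part p i = (partList p).get i := by
  simp [part]

theorem exists_rowOf_colOf (p : n.Partition) {i j : ℕ} (h : j < part p i) :
    ∃ z, rowOf p z = i ∧ colOf p z = j := by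
  have hi : i < (partList p).length := by
    by_contra hi
    rw [part, List.getD_eq_default _ _ (not_lt.1 hi)] at h
    exact absurd h (Nat.not_lt_zero _)
  refine ⟨tableau p ⟨⟨i, hi⟩, ⟨j, ?_⟩⟩, ?_, ?_⟩
  · rw [← part_eq_get]; exact h
  · simp [rowOf]
  · unfold colOf
    rw [Equiv.symm_apply_apply]

theorem colOf_lt_part (p : n.Partition) (x : Fin n) : colOf p x < part p (rowOf p x) := by
  unfold colOf rowOf
  rw [part_eq_get]
  exact Fin.is_lt _

theorem exists_rowOf_le (p : n.Partition) (y : Fin n) (i : ℕ) (hi : i ≤ rowOf p y) :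
    ∃ z, rowOf p z = i ∧ colOf p z = colOf p y :=
  exists_rowOf_colOf p ((colOf_lt_part p y).trans_le (part_antitone p hi))

theorem card_rowOf_eq (p : n.Partition) (i : ℕ) :
    (Finset.univ.filter fun x => rowOf p x = i).card = part p i := by
  rw [← Finset.card_range (part p i)]
  refine Finset.card_bij (fun x _ => colOf p x) (fun x hx => ?_) (fun x hx y hy hxy => ?_)
    fun j hj => ?_
  · simp only [Finset.mem_filter, Finset.mem_univ, true_and] at hx
    simpa [← hx] using colOf_lt_part p x
  · simp only [Finset.mem_filter, Finset.mem_univ, true_and] at hx hy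
    exact eq_of_rowOf_colOf p (hx.trans hy.symm) hxy
  · obtain ⟨z, h1, h2⟩ := exists_rowOf_colOf p (Finset.mem_range.1 hj)
    exact ⟨z, by simpa using h1, h2⟩

/-- Parts are positive, so the first zero of `part` is the length of the list of parts; the default
value 0 therefore loses no information. -/
theorem partition_ext_part {p q : n.Partition} (h : ∀ i, part p i = part q i) : p = q := by
  have hpos : ∀ (p : n.Partition) (i : ℕ), i < (partList p).length ↔ 0 < part p i := by
    intro p i
    constructor
    · intro hi
      rw [part, List.getD_eq_getElem _ _ hi]
      have hm : (partList p)[i] ∈ p.parts := by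
        rw [← Multiset.sort_eq p.parts (· ≥ ·)]
        exact List.getElem_mem hi
      exact p.parts_pos hm
    · intro hi
      by_contra hlt
      rw [part, List.getD_eq_default _ _ (not_lt.1 hlt)] at hi
      exact absurd hi (lt_irrefl _)
  have hl : (partList p).length = (partList q).length := by
    refine eq_of_forall_lt_iff fun i => ?_
    rw [hpos, hpos, h]
  have hpq : partList p = partList q := by
    refine List.ext_getElem hl fun i h1 h2 => ?_
    have := h i
    rwa [part, part, List.getD_eq_getElem _ _ h1, List.getD_eq_getElem _ _ h2] at this
  apply Nat.Partition.ext
  rw [← Multiset.sort_eq p.parts (· ≥ ·), ← Multiset.sort_eq q.parts (· ≥ ·)]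
  exact congrArg _ hpq

/-- No two elements lie in one row of the tableau of `p` and in one column of the tableau of `q`
moved by `σ`. -/
def Separated (p q : n.Partition) (σ : Equiv.Perm (Fin n)) : Prop :=
  ∀ x y, rowOf p x = rowOf p y → colOf q (σ⁻¹ x) = colOf q (σ⁻¹ y) → x = y

variable {p q : n.Partition} {σ : Equiv.Perm (Fin n)}

theorem Separated.card_le (h : Separated p q σ) (s j : ℕ) :
    (Finset.univ.filter fun x => rowOf p x < s ∧ colOf q (σ⁻¹ x) = j).card
      ≤ (Finset.univ.filter fun y => rowOf q y < s ∧ colOf q y = j).card := by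
  refine card_lt_and_eq_le h (exists_rowOf_le q) (fun j => ?_) s j
  refine Finset.card_le_card_of_injOn (σ⁻¹ : Equiv.Perm (Fin n)) (fun x hx => ?_)
    (Equiv.injective _).injOn
  simpa using hx

theorem card_rowOf_lt_eq_sum (p : n.Partition) (c : Fin n → ℕ) (hc : ∀ x, c x < n) (s : ℕ) :
    (Finset.univ.filter fun x => rowOf p x < s).card
      = ∑ j ∈ Finset.range n, (Finset.univ.filter fun x => rowOf p x < s ∧ c x = j).card := by
  rw [Finset.card_eq_sum_card_fiberwise (f := c) (t := Finset.range n)]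
  · simp only [Finset.filter_filter]
  · intro x _
    simpa using hc x

theorem colOf_lt (p : n.Partition) (x : Fin n) : colOf p x < n := by
  refine (colOf_lt_part p x).trans_le ?_
  rw [← card_rowOf_eq]
  exact (Finset.card_le_univ _).trans (by simp)

/-- This is the dominance order on partitions. Summing the column-wise bounds compares the sums of
the first `s` parts. -/
theorem Separated.card_rowOf_lt_le (h : Separated p q σ) (s : ℕ) :
    (Finset.univ.filter fun x => rowOf p x < s).card
      ≤ (Finset.univ.filter fun x => rowOf q x < s).card := by
  rw [card_rowOf_lt_eq_sum p (fun x => colOf q (σ⁻¹ x)) (fun x => colOf_lt q _) s,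
    card_rowOf_lt_eq_sum q (colOf q) (colOf_lt q) s]
  exact Finset.sum_le_sum fun j _ => h.card_le s j

theorem card_rowOf_lt_succ (p : n.Partition) (P : Fin n → Prop) [DecidablePred P] (i : ℕ) :
    (Finset.univ.filter fun x => rowOf p x < i + 1 ∧ P x).card
      = (Finset.univ.filter fun x => rowOf p x < i ∧ P x).card
        + (Finset.univ.filter fun x => rowOf p x = i ∧ P x).card := by
  rw [← Finset.card_union_of_disjoint]
  · congr 1
    ext x
    simp only [Finset.mem_filter, Finset.mem_univ, true_and, Finset.mem_union, Nat.lt_succ_iff_lt_or_eq]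
    tauto
  · rw [Finset.disjoint_left]
    intro x hx hx'
    simp only [Finset.mem_filter, Finset.mem_univ, true_and] at hx hx'
    omega

/-- Dominance in both directions makes all partial sums of parts equal, and their differences are
the parts. -/
theorem Separated.partition_eq {τ : Equiv.Perm (Fin n)} (h : Separated p q σ)
    (h' : Separated q p τ) : p = q := by
  have hD : ∀ s, (Finset.univ.filter fun x => rowOf p x < s ∧ True).card
      = (Finset.univ.filter fun x => rowOf q x < s ∧ True).card := by
    intro s
    simpa only [and_true] using le_antisymm (h.card_rowOf_lt_le s) (h'.card_rowOf_lt_le s)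
  refine partition_ext_part fun i => ?_
  have h1 := card_rowOf_lt_succ p (fun _ => True) i
  have h2 := card_rowOf_lt_succ q (fun _ => True) i
  rw [hD, hD, h2] at h1
  have h3 := Nat.add_left_cancel h1
  simp only [and_true] at h3
  rw [← card_rowOf_eq p, ← card_rowOf_eq q]
  exact h3.symm

/-- Von Neumann's lemma: `σ = τ⁻¹ (τ σ)` is a row permutation times a column permutation. For equal
shapes the dominance inequalities are equalities, so the row of `x` contains an element whose column
is that of `σ⁻¹ x`; `τ` sends `x` to it. -/
theorem Separated.exists_perm (h : Separated p p σ) :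
    ∃ τ : Equiv.Perm (Fin n), (∀ k, rowOf p (τ k) = rowOf p k) ∧
      ∀ k, colOf p (τ (σ k)) = colOf p k := by
  have hE : ∀ s, ∀ j ∈ Finset.range n,
      (Finset.univ.filter fun x => rowOf p x < s ∧ colOf p (σ⁻¹ x) = j).card
        = (Finset.univ.filter fun y => rowOf p y < s ∧ colOf p y = j).card := by
    intro s
    -- Both totals count the elements of the first `s` rows, so the inequalities in the single
    -- columns cannot be strict.
    refine (Finset.sum_eq_sum_iff_of_le fun j _ => h.card_le s j).1 ?_
    rw [← card_rowOf_lt_eq_sum p (fun x => colOf p (σ⁻¹ x)) (fun x => colOf_lt p _) s,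
      ← card_rowOf_lt_eq_sum p (colOf p) (colOf_lt p) s]
  have hex : ∀ x, ∃ y, rowOf p y = rowOf p x ∧ colOf p y = colOf p (σ⁻¹ x) := by
    intro x
    have hj : colOf p (σ⁻¹ x) ∈ Finset.range n := Finset.mem_range.2 (colOf_lt p _)
    have h1 := card_rowOf_lt_succ p (fun z => colOf p (σ⁻¹ z) = colOf p (σ⁻¹ x)) (rowOf p x)
    have h2 := card_rowOf_lt_succ p (fun z => colOf p z = colOf p (σ⁻¹ x)) (rowOf p x)
    rw [hE _ _ hj, hE _ _ hj, h2] at h1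
    have h3 := Nat.add_left_cancel h1
    have h4 : 0 < (Finset.univ.filter fun z => rowOf p z = rowOf p x ∧
        colOf p (σ⁻¹ z) = colOf p (σ⁻¹ x)).card := Finset.card_pos.2 ⟨x, by simp⟩
    rw [← h3] at h4
    obtain ⟨y, hy⟩ := Finset.card_pos.1 h4
    exact ⟨y, by simpa using hy⟩
  choose τ hτ1 hτ2 using hex
  have hinj : Function.Injective τ := by
    intro x y hxy
    refine h x y ?_ ?_
    · rw [← hτ1 x, ← hτ1 y, hxy]
    · rw [← hτ2 x, ← hτ2 y, hxy]
  refine ⟨Equiv.ofBijective τ (Finite.injective_iff_bijective.1 hinj), fun k => hτ1 k, fun k => ?_⟩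
  change colOf p (τ (σ k)) = _
  rw [hτ2]
  simp

end Diagram
/-! ### Young symmetrizers -/

section Young

variable {n : ℕ}

/-- The group algebra of the symmetric group. -/
abbrev SymAlg (n : ℕ) : Type := MonoidAlgebra ℂ (Equiv.Perm (Fin n))

/-- The permutation `σ` as an element of the group algebra. -/
abbrev permElt (σ : Equiv.Perm (Fin n)) : SymAlg n := MonoidAlgebra.single σ 1

/-- The sum of the permutations that preserve the rows of the tableau. -/
def rowSum (p : n.Partition) : SymAlg n :=
  ∑ σ ∈ Finset.univ.filter fun σ : Equiv.Perm (Fin n) => ∀ k, rowOf p (σ k) = rowOf p k,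
    MonoidAlgebra.single σ 1

/-- The signed sum of the permutations that preserve the columns of the tableau. -/
def colSum (p : n.Partition) : SymAlg n :=
  ∑ σ ∈ Finset.univ.filter fun σ : Equiv.Perm (Fin n) => ∀ k, colOf p (σ k) = colOf p k,
    MonoidAlgebra.single σ ((Equiv.Perm.sign σ : ℤ) : ℂ)

theorem youngSymmetrizer_eq (p : n.Partition) : youngSymmetrizer p = rowSum p * colSum p := rfl

theorem permElt_mul (σ τ : Equiv.Perm (Fin n)) : permElt σ * permElt τ = permElt (σ * τ) := by
  simp [permElt, MonoidAlgebra.single_mul_single]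

theorem single_eq_smul_permElt (σ : Equiv.Perm (Fin n)) (c : ℂ) :
    (MonoidAlgebra.single σ c : SymAlg n) = c • permElt σ := by
  simp [permElt]

theorem rowSum_mul_permElt (p : n.Partition) {σ : Equiv.Perm (Fin n)}
    (hσ : ∀ k, rowOf p (σ k) = rowOf p k) : rowSum p * permElt σ = rowSum p := by
  unfold rowSum
  rw [Finset.sum_mul]
  refine Finset.sum_equiv (Equiv.mulRight σ) (fun τ => ?_) fun τ _ => ?_
  · simp only [Finset.mem_filter, Finset.mem_univ, true_and, Equiv.coe_mulRight,
      Equiv.Perm.mul_apply]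
    refine ⟨fun h k => (h _).trans (hσ k), fun h k => ?_⟩
    have h1 := h (σ⁻¹ k)
    have h2 := hσ (σ⁻¹ k)
    have h3 : σ (σ⁻¹ k) = k := σ.apply_symm_apply k
    rw [h3] at h1 h2
    exact h1.trans h2.symm
  · rw [MonoidAlgebra.single_mul_single]
    simp

theorem colSum_mul_permElt (p : n.Partition) {σ : Equiv.Perm (Fin n)}
    (hσ : ∀ k, colOf p (σ k) = colOf p k) :
    colSum p * permElt σ = ((Equiv.Perm.sign σ : ℤ) : ℂ) • colSum p := by
  unfold colSum
  rw [Finset.sum_mul, Finset.smul_sum]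
  refine Finset.sum_equiv (Equiv.mulRight σ) (fun τ => ?_) fun τ _ => ?_
  · simp only [Finset.mem_filter, Finset.mem_univ, true_and, Equiv.coe_mulRight,
      Equiv.Perm.mul_apply]
    refine ⟨fun h k => (h _).trans (hσ k), fun h k => ?_⟩
    have h1 := h (σ⁻¹ k)
    have h2 := hσ (σ⁻¹ k)
    have h3 : σ (σ⁻¹ k) = k := σ.apply_symm_apply k
    rw [h3] at h1 h2
    exact h1.trans h2.symm
  · rw [MonoidAlgebra.single_mul_single, MonoidAlgebra.smul_single]
    congr 1
    have h : ((Equiv.Perm.sign σ : ℤ) : ℂ) * ((Equiv.Perm.sign σ : ℤ) : ℂ) = 1 := by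
      rw [← Int.cast_mul, ← Units.val_mul, Int.units_mul_self]
      simp
    simp only [Equiv.coe_mulRight, Equiv.Perm.sign_mul, Units.val_mul, Int.cast_mul, smul_eq_mul,
      mul_one]
    rw [mul_comm, mul_assoc, h, mul_one]

/-- The anti-involution `σ ↦ σ⁻¹` of the group algebra. -/
def invMap (n : ℕ) : SymAlg n →ₗ[ℂ] SymAlg n := MonoidAlgebra.mapDomainLinearMap ℂ ℂ (·⁻¹)

theorem invMap_single (σ : Equiv.Perm (Fin n)) (c : ℂ) :
    invMap n (MonoidAlgebra.single σ c) = MonoidAlgebra.single σ⁻¹ c :=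
  MonoidAlgebra.mapDomainLinearMap_single ..

theorem invMap_mul (x y : SymAlg n) : invMap n (x * y) = invMap n y * invMap n x := by
  induction x using MonoidAlgebra.induction_linear with
  | zero => simp
  | add a b ha hb => rw [add_mul, map_add, map_add, mul_add, ha, hb]
  | single σ c =>
    induction y using MonoidAlgebra.induction_linear with
    | zero => simp
    | add a b ha hb => rw [mul_add, map_add, map_add, add_mul, ha, hb]
    | single τ d =>
      rw [MonoidAlgebra.single_mul_single, invMap_single, invMap_single, invMap_single,
        MonoidAlgebra.single_mul_single, mul_inv_rev, mul_comm]

theorem invMap_rowSum (p : n.Partition) : invMap n (rowSum p) = rowSum p := by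
  unfold rowSum
  rw [map_sum]
  refine Finset.sum_equiv (Equiv.inv _) (fun τ => ?_) fun τ _ => by
    rw [invMap_single]; rfl
  simp only [Finset.mem_filter, Finset.mem_univ, true_and, Equiv.inv_apply]
  refine ⟨fun h k => ?_, fun h k => ?_⟩
  · simpa using (h (τ⁻¹ k)).symm
  · simpa using (h (τ k)).symm

theorem invMap_colSum (p : n.Partition) : invMap n (colSum p) = colSum p := by
  unfold colSum
  rw [map_sum]
  refine Finset.sum_equiv (Equiv.inv _) (fun τ => ?_) fun τ _ => by
    rw [invMap_single]; simp
  simp only [Finset.mem_filter, Finset.mem_univ, true_and, Equiv.inv_apply]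
  refine ⟨fun h k => ?_, fun h k => ?_⟩
  · simpa using (h (τ⁻¹ k)).symm
  · simpa using (h (τ k)).symm

theorem invMap_invMap (x : SymAlg n) : invMap n (invMap n x) = x := by
  induction x using MonoidAlgebra.induction_linear with
  | zero => simp
  | add a b ha hb => rw [map_add, map_add, ha, hb]
  | single σ c => rw [invMap_single, invMap_single, inv_inv]

theorem permElt_mul_colSum (p : n.Partition) {σ : Equiv.Perm (Fin n)}
    (hσ : ∀ k, colOf p (σ k) = colOf p k) :
    permElt σ * colSum p = ((Equiv.Perm.sign σ : ℤ) : ℂ) • colSum p := by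
  have h : ∀ k, colOf p (σ⁻¹ k) = colOf p k := fun k => by simpa using (hσ (σ⁻¹ k)).symm
  have := congrArg (invMap n) (colSum_mul_permElt p h)
  rwa [invMap_mul, map_smul, invMap_colSum, permElt, invMap_single, inv_inv,
    Equiv.Perm.sign_inv] at this

/-- The transposition of two elements that violate separation is absorbed by the row sum. Conjugated
by `σ`, it is absorbed by the column sum with sign -1. Hence the product equals its negative. -/
theorem rowSum_permElt_colSum_of_not_separated {p q : n.Partition} {σ : Equiv.Perm (Fin n)}
    (h : ¬ Separated p q σ) : rowSum p * permElt σ * colSum q = 0 := by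
  unfold Separated at h
  push Not at h
  obtain ⟨x, y, h1, h2, hxy⟩ := h
  have hr : ∀ k, rowOf p (Equiv.swap x y k) = rowOf p k := by
    intro k
    rcases eq_or_ne k x with rfl | hx
    · simp [h1]
    · rcases eq_or_ne k y with rfl | hy
      · simp [h1]
      · rw [Equiv.swap_apply_of_ne_of_ne hx hy]
  have hc : ∀ k, colOf q (Equiv.swap (σ⁻¹ x) (σ⁻¹ y) k) = colOf q k := by
    intro k
    rcases eq_or_ne k (σ⁻¹ x) with rfl | hx
    · simp only [Equiv.swap_apply_left, h2]
    · rcases eq_or_ne k (σ⁻¹ y) with rfl | hy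
      · simp only [Equiv.swap_apply_right, h2]
      · rw [Equiv.swap_apply_of_ne_of_ne hx hy]
  have hsw : σ * Equiv.swap (σ⁻¹ x) (σ⁻¹ y) = Equiv.swap x y * σ := by
    rw [Equiv.swap_apply_apply, inv_inv]
    group
  have e1 : rowSum p * permElt σ * colSum q = -(rowSum p * permElt σ * colSum q) := by
    conv_lhs => rw [← rowSum_mul_permElt p hr, mul_assoc (rowSum p), permElt_mul, ← hsw,
      ← permElt_mul, ← mul_assoc, mul_assoc _ _ (colSum q), permElt_mul_colSum q hc]
    rw [Equiv.Perm.sign_swap (fun h => hxy (σ⁻¹.injective h))]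
    simp
  have e2 := add_eq_zero_iff_eq_neg.2 e1
  rw [← two_smul ℂ] at e2
  exact (smul_eq_zero.1 e2).resolve_left two_ne_zero

theorem rowSum_mul_colSum_eq_zero {p q : n.Partition} (h : ∀ σ, ¬ Separated p q σ)
    (x : SymAlg n) : rowSum p * x * colSum q = 0 := by
  induction x using MonoidAlgebra.induction_linear with
  | zero => simp
  | add a b ha hb => rw [mul_add, add_mul, ha, hb, add_zero]
  | single σ c =>
    rw [single_eq_smul_permElt, mul_smul_comm, smul_mul_assoc,
      rowSum_permElt_colSum_of_not_separated (h σ), smul_zero]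

/-- For distinct shapes, separation fails for all permutations in at least one of the two orders. In
the first case the outer factors, rows of `p` and columns of `q`, give zero. In the second the inner
factors, columns of `p` and rows of `q`, do, after the anti-involution has exchanged their order. -/
theorem youngSymmetrizer_mul_mul_of_ne {p q : n.Partition} (h : p ≠ q) (x : SymAlg n) :
    youngSymmetrizer p * x * youngSymmetrizer q = 0 := by
  simp only [youngSymmetrizer_eq]
  by_cases h1 : ∀ σ, ¬ Separated p q σ
  · have := rowSum_mul_colSum_eq_zero h1 (colSum p * x * rowSum q)
    simpa only [mul_assoc] using this
  · have h2 : ∀ σ, ¬ Separated q p σ := by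
      push Not at h1
      obtain ⟨σ, hσ⟩ := h1
      exact fun τ hτ => h (hσ.partition_eq hτ)
    have h3 := rowSum_mul_colSum_eq_zero h2 (invMap n x)
    have h4 : colSum p * x * rowSum q = 0 := by
      have := congrArg (invMap n) h3
      rw [invMap_mul, invMap_mul, invMap_invMap, invMap_rowSum, invMap_colSum, map_zero] at this
      rwa [mul_assoc]
    rw [mul_assoc, mul_assoc, ← mul_assoc x, ← mul_assoc (colSum p), ← mul_assoc (colSum p), h4]
    simp

/-- It suffices to take one permutation. If it is separated, it factors into a row and a column
permutation, which are absorbed up to sign; otherwise the product vanishes. -/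
theorem exists_rowSum_mul_colSum (p : n.Partition) (x : SymAlg n) :
    ∃ c : ℂ, rowSum p * x * colSum p = c • youngSymmetrizer p := by
  induction x using MonoidAlgebra.induction_linear with
  | zero => exact ⟨0, by simp⟩
  | add a b ha hb =>
    obtain ⟨c, hc⟩ := ha
    obtain ⟨d, hd⟩ := hb
    exact ⟨c + d, by rw [mul_add, add_mul, hc, hd, add_smul]⟩
  | single σ c =>
    rw [single_eq_smul_permElt, mul_smul_comm, smul_mul_assoc]
    suffices ∃ d : ℂ, rowSum p * permElt σ * colSum p = d • youngSymmetrizer p by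
      obtain ⟨d, hd⟩ := this
      exact ⟨c * d, by rw [hd, mul_smul]⟩
    by_cases h : Separated p p σ
    · obtain ⟨τ, h1, h2⟩ := h.exists_perm
      refine ⟨((Equiv.Perm.sign (τ * σ) : ℤ) : ℂ), ?_⟩
      rw [← rowSum_mul_permElt p h1, mul_assoc (rowSum p), permElt_mul, mul_assoc,
        permElt_mul_colSum p h2, mul_smul_comm, youngSymmetrizer_eq]
    · exact ⟨0, by rw [rowSum_permElt_colSum_of_not_separated h, zero_smul]⟩

theorem coeff_one_mul_comm (x y : SymAlg n) : (x * y).coeff 1 = (y * x).coeff 1 := by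
  induction x using MonoidAlgebra.induction_linear with
  | zero => simp
  | add a b ha hb => rw [add_mul, mul_add, MonoidAlgebra.coeff_add, MonoidAlgebra.coeff_add,
      Finsupp.add_apply, Finsupp.add_apply, ha, hb]
  | single σ c =>
    induction y using MonoidAlgebra.induction_linear with
    | zero => simp
    | add a b ha hb => rw [add_mul, mul_add, MonoidAlgebra.coeff_add, MonoidAlgebra.coeff_add,
        Finsupp.add_apply, Finsupp.add_apply, ha, hb]
    | single τ d =>
      rw [MonoidAlgebra.single_mul_single, MonoidAlgebra.single_mul_single,
        MonoidAlgebra.coeff_single, MonoidAlgebra.coeff_single, Finsupp.single_apply,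
        Finsupp.single_apply, mul_comm c d]
      refine if_congr ⟨fun h => ?_, fun h => ?_⟩ rfl rfl
      · rw [eq_inv_of_mul_eq_one_left h, mul_inv_cancel]
      · rw [eq_inv_of_mul_eq_one_left h, mul_inv_cancel]

theorem coeff_permElt_mul (σ τ : Equiv.Perm (Fin n)) (x : SymAlg n) :
    (permElt σ * x).coeff τ = x.coeff (σ⁻¹ * τ) := by
  induction x using MonoidAlgebra.induction_linear with
  | zero => simp
  | add a b ha hb => rw [mul_add, MonoidAlgebra.coeff_add, MonoidAlgebra.coeff_add,
      Finsupp.add_apply, Finsupp.add_apply, ha, hb]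
  | single ρ c =>
    rw [MonoidAlgebra.single_mul_single, MonoidAlgebra.coeff_single, MonoidAlgebra.coeff_single,
      Finsupp.single_apply, Finsupp.single_apply, one_mul]
    simp only [eq_inv_mul_iff_mul_eq]

/-- Only the identity preserves both rows and columns, so the identity arises from a single pair of
factors. -/
theorem coeff_one_youngSymmetrizer (p : n.Partition) : (youngSymmetrizer p).coeff 1 = 1 := by
  rw [youngSymmetrizer_eq, rowSum, colSum, Finset.sum_mul, MonoidAlgebra.coeff_sum,
    Finsupp.finsetSum_apply, Finset.sum_eq_single 1]
  · rw [Finset.mul_sum, MonoidAlgebra.coeff_sum, Finsupp.finsetSum_apply, Finset.sum_eq_single 1]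
    · simp [MonoidAlgebra.single_mul_single]
    · intro τ _ hτ
      rw [MonoidAlgebra.single_mul_single, MonoidAlgebra.coeff_single, Finsupp.single_apply, if_neg]
      simpa using hτ
    · simp
  · intro σ hσ hσ1
    rw [Finset.mul_sum, MonoidAlgebra.coeff_sum, Finsupp.finsetSum_apply]
    refine Finset.sum_eq_zero fun τ hτ => ?_
    rw [MonoidAlgebra.single_mul_single, MonoidAlgebra.coeff_single, Finsupp.single_apply, if_neg]
    intro h
    simp only [Finset.mem_filter, Finset.mem_univ, true_and] at hσ hτ
    apply hσ1
    obtain rfl : τ = σ⁻¹ := (inv_eq_of_mul_eq_one_right h).symm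
    ext k : 1
    refine eq_of_rowOf_colOf p (hσ k) ?_
    simpa using (hτ (σ k)).symm
  · simp

theorem trace_mulRight (x : SymAlg n) :
    LinearMap.trace ℂ (SymAlg n) (LinearMap.mulRight ℂ x) = (n.factorial : ℂ) * x.coeff 1 := by
  classical
  rw [LinearMap.trace_eq_matrix_trace ℂ (MonoidAlgebra.basis (Equiv.Perm (Fin n)) ℂ), Matrix.trace]
  have h : ∀ σ : Equiv.Perm (Fin n), Matrix.diag (LinearMap.toMatrix
      (MonoidAlgebra.basis (Equiv.Perm (Fin n)) ℂ) (MonoidAlgebra.basis (Equiv.Perm (Fin n)) ℂ)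
      (LinearMap.mulRight ℂ x)) σ = x.coeff 1 := by
    intro σ
    rw [Matrix.diag_apply, LinearMap.toMatrix_apply, MonoidAlgebra.basis_apply,
      LinearMap.mulRight_apply]
    change (permElt σ * x).coeff σ = _
    rw [coeff_permElt_mul, inv_mul_cancel]
  rw [Finset.sum_congr rfl fun σ _ => h σ]
  simp [Fintype.card_perm]

/-- If the square were zero, right multiplication by the symmetrizer would be nilpotent and of trace
0. Its trace is `n!` times the coefficient at 1, that is, `n!`. -/
theorem exists_youngSymmetrizer_mul_self (p : n.Partition) :
    ∃ κ : ℂ, κ ≠ 0 ∧ youngSymmetrizer p * youngSymmetrizer p = κ • youngSymmetrizer p := by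
  obtain ⟨κ, hκ⟩ := exists_rowSum_mul_colSum p (colSum p * rowSum p)
  have h : youngSymmetrizer p * youngSymmetrizer p = κ • youngSymmetrizer p := by
    rw [← hκ, youngSymmetrizer_eq]
    simp only [mul_assoc]
  refine ⟨κ, ?_, h⟩
  rintro rfl
  rw [zero_smul] at h
  have hnil : IsNilpotent (LinearMap.mulRight ℂ (youngSymmetrizer p)) := by
    refine ⟨2, LinearMap.ext fun y => ?_⟩
    rw [pow_two, Module.End.mul_apply, LinearMap.mulRight_apply, LinearMap.mulRight_apply, mul_assoc,
      h, mul_zero, LinearMap.zero_apply]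
  have h1 := (LinearMap.isNilpotent_trace_of_isNilpotent hnil).eq_zero
  rw [trace_mulRight, coeff_one_youngSymmetrizer, mul_one] at h1
  exact Nat.factorial_ne_zero n (by exact_mod_cast h1)

/-- The scalar `κ` with `c² = κ c` for the Young symmetrizer `c`. -/
def youngScalar (p : n.Partition) : ℂ := (exists_youngSymmetrizer_mul_self p).choose

theorem youngScalar_ne_zero (p : n.Partition) : youngScalar p ≠ 0 :=
  (exists_youngSymmetrizer_mul_self p).choose_spec.1

theorem youngSymmetrizer_mul_self (p : n.Partition) :
    youngSymmetrizer p * youngSymmetrizer p = youngScalar p • youngSymmetrizer p :=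
  (exists_youngSymmetrizer_mul_self p).choose_spec.2

theorem exists_youngSymmetrizer_mul_mul (p : n.Partition) (x : SymAlg n) :
    ∃ c : ℂ, youngSymmetrizer p * x * youngSymmetrizer p = c • youngSymmetrizer p := by
  obtain ⟨c, hc⟩ := exists_rowSum_mul_colSum p (colSum p * x * rowSum p)
  refine ⟨c, ?_⟩
  rw [← hc, youngSymmetrizer_eq]
  simp only [mul_assoc]

/-- The opposite Young symmetrizer: columns first. -/
def youngOpp (p : n.Partition) : SymAlg n := colSum p * rowSum p

theorem invMap_youngSymmetrizer (p : n.Partition) : invMap n (youngSymmetrizer p) = youngOpp p := by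
  rw [youngSymmetrizer_eq, invMap_mul, invMap_rowSum, invMap_colSum, youngOpp]

theorem coeff_invMap (x : SymAlg n) (σ : Equiv.Perm (Fin n)) :
    (invMap n x).coeff σ = x.coeff σ⁻¹ := by
  induction x using MonoidAlgebra.induction_linear with
  | zero => simp
  | add a b ha hb => rw [map_add, MonoidAlgebra.coeff_add, MonoidAlgebra.coeff_add,
      Finsupp.add_apply, Finsupp.add_apply, ha, hb]
  | single ρ c =>
    rw [invMap_single, MonoidAlgebra.coeff_single, MonoidAlgebra.coeff_single, Finsupp.single_apply,
      Finsupp.single_apply]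
    simp only [inv_eq_iff_eq_inv]

theorem youngOpp_mul_self (p : n.Partition) :
    youngOpp p * youngOpp p = youngScalar p • youngOpp p := by
  rw [← invMap_youngSymmetrizer, ← invMap_mul, youngSymmetrizer_mul_self, map_smul]

/-- The product is a multiple of the opposite symmetrizer, whose coefficient at 1 is 1. The multiple
is therefore read off at 1, where factors may be permuted cyclically, so that the two outer
symmetrizers merge. -/
theorem youngOpp_mul_permElt_mul (p : n.Partition) (σ : Equiv.Perm (Fin n)) :
    youngOpp p * permElt σ * youngOpp p
      = (youngScalar p * (youngOpp p).coeff σ⁻¹) • youngOpp p := by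
  obtain ⟨c, hc⟩ := exists_youngSymmetrizer_mul_mul p (permElt σ⁻¹)
  have h := congrArg (invMap n) hc
  rw [invMap_mul, invMap_mul, map_smul, invMap_youngSymmetrizer, permElt, invMap_single, inv_inv,
    ← mul_assoc] at h
  have h1 : (youngOpp p).coeff 1 = 1 := by
    rw [← invMap_youngSymmetrizer, coeff_invMap, inv_one, coeff_one_youngSymmetrizer]
  have h2 := congrArg (fun x : SymAlg n => x.coeff 1) h
  simp only [MonoidAlgebra.coeff_smul, Finsupp.smul_apply, h1, smul_eq_mul, mul_one] at h2
  rw [mul_assoc, coeff_one_mul_comm, mul_assoc, youngOpp_mul_self, mul_smul_comm,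
    MonoidAlgebra.coeff_smul, Finsupp.smul_apply, coeff_permElt_mul, mul_one, smul_eq_mul] at h2
  rw [h, ← h2]

end Young
/-! ### Characters of the symmetric group -/

section SymCharacter

variable {n : ℕ}

instance : Module.Finite ℂ (SymAlg n) :=
  Module.Finite.of_basis (MonoidAlgebra.basis (Equiv.Perm (Fin n)) ℂ)

instance : Invertible (Nat.card (Equiv.Perm (Fin n)) : ℂ) :=
  invertibleOfNonzero (Nat.cast_ne_zero.2 Nat.card_pos.ne')

theorem intertwining_asAlgebraHom {G V W : Type*} [Monoid G] [AddCommGroup V] [Module ℂ V]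
    [AddCommGroup W] [Module ℂ W] {ρ : Representation ℂ G V} {σ : Representation ℂ G W}
    (f : ρ.IntertwiningMap σ) (x : MonoidAlgebra ℂ G) (v : V) :
    f (ρ.asAlgebraHom x v) = σ.asAlgebraHom x (f v) := by
  induction x using MonoidAlgebra.induction_linear with
  | zero => simp
  | add a b ha hb => simp only [map_add, LinearMap.add_apply, ha, hb]
  | single g c =>
    simp only [Representation.asAlgebraHom_single, LinearMap.smul_apply, map_smul,
      f.isIntertwining]

theorem spechtRep_apply_coe (p : n.Partition) (σ : Equiv.Perm (Fin n)) (y : spechtSpace p) :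
    (spechtRep p σ y : SymAlg n) = permElt σ * y := by
  change Representation.leftRegular ℂ (Equiv.Perm (Fin n)) σ (y : SymAlg n) = _
  generalize (y : SymAlg n) = z
  induction z using MonoidAlgebra.induction_linear with
  | zero => simp
  | add a b ha hb => rw [map_add, ha, hb, mul_add]
  | single τ c => simp [MonoidAlgebra.single_mul_single]

theorem spechtRep_asAlgebraHom_coe (p : n.Partition) (x : SymAlg n) (y : spechtSpace p) :
    ((spechtRep p).asAlgebraHom x y : SymAlg n) = x * y := by
  induction x using MonoidAlgebra.induction_linear with
  | zero => simp
  | add a b ha hb => rw [map_add, LinearMap.add_apply, Submodule.coe_add, ha, hb, add_mul]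
  | single σ c =>
    rw [Representation.asAlgebraHom_single, LinearMap.smul_apply, Submodule.coe_smul,
      spechtRep_apply_coe, single_eq_smul_permElt, smul_mul_assoc]

/-- The Young symmetrizer as a generator of the Specht module. -/
def spechtGen (p : n.Partition) : spechtSpace p :=
  ⟨youngSymmetrizer p, 1, by rw [LinearMap.mulRight_apply, one_mul]⟩

theorem exists_spechtGen (p : n.Partition) (y : spechtSpace p) :
    ∃ x : SymAlg n, y = (spechtRep p).asAlgebraHom x (spechtGen p) := by
  obtain ⟨_, x, rfl⟩ := y
  exact ⟨x, Subtype.ext (by rw [spechtRep_asAlgebraHom_coe]; rfl)⟩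

theorem spechtGen_eq (p : n.Partition) : spechtGen p
    = (youngScalar p)⁻¹ • (spechtRep p).asAlgebraHom (youngSymmetrizer p) (spechtGen p) := by
  apply Subtype.ext
  rw [Submodule.coe_smul, spechtRep_asAlgebraHom_coe]
  change youngSymmetrizer p = _ • (youngSymmetrizer p * youngSymmetrizer p)
  rw [youngSymmetrizer_mul_self, smul_smul, inv_mul_cancel₀ (youngScalar_ne_zero p), one_smul]

/-- The generator `c` satisfies `c = κ⁻¹ c²`, so an intertwiner sends it to `κ⁻¹ c` times an element
of the target ideal. Homomorphisms between Specht modules are thus controlled by products `c_p x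
c_q`. -/
theorem intertwining_spechtGen {p q : n.Partition}
    (f : (spechtRep p).IntertwiningMap (spechtRep q)) :
    ∃ x : SymAlg n, (f (spechtGen p) : SymAlg n)
      = (youngScalar p)⁻¹ • (youngSymmetrizer p * x * youngSymmetrizer q) := by
  obtain ⟨x, hx⟩ := exists_spechtGen q (f (spechtGen p))
  refine ⟨x, ?_⟩
  conv_lhs => rw [spechtGen_eq, map_smul, intertwining_asAlgebraHom, hx]
  rw [Submodule.coe_smul, spechtRep_asAlgebraHom_coe, spechtRep_asAlgebraHom_coe, mul_assoc]
  rfl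

theorem intertwining_ext_spechtGen {W : Type*} [AddCommGroup W] [Module ℂ W] {p : n.Partition}
    {τ : Representation ℂ (Equiv.Perm (Fin n)) W} {f g : (spechtRep p).IntertwiningMap τ}
    (h : f (spechtGen p) = g (spechtGen p)) : f = g := by
  refine Representation.IntertwiningMap.ext (LinearMap.ext fun y => ?_)
  obtain ⟨x, rfl⟩ := exists_spechtGen p y
  change f _ = g _
  rw [intertwining_asAlgebraHom, intertwining_asAlgebraHom, h]

-- Schur's lemma read off from Young symmetrizers: `c_p x c_p` is a multiple of `c_p`, and `c_p x
-- c_q = 0` for distinct shapes.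
open scoped Classical in
theorem finrank_intertwining_specht (p q : n.Partition) :
    Module.finrank ℂ ((spechtRep p).IntertwiningMap (spechtRep q)) = if p = q then 1 else 0 := by
  split_ifs with h
  · subst h
    refine (finrank_eq_one_iff_of_nonzero' (Representation.IntertwiningMap.id (spechtRep p)) ?_).2
      fun f => ?_
    · intro h
      have h1 : spechtGen p = 0 := by
        have := congrArg (fun f => f (spechtGen p)) h
        simpa using this
      have h2 : youngSymmetrizer p = 0 := congrArg Subtype.val h1
      have h3 := coeff_one_youngSymmetrizer p
      rw [h2] at h3
      simp at h3
    · obtain ⟨x, hx⟩ := intertwining_spechtGen f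
      obtain ⟨c, hc⟩ := exists_youngSymmetrizer_mul_mul p x
      rw [hc, smul_smul] at hx
      exact ⟨(youngScalar p)⁻¹ * c, intertwining_ext_spechtGen (Subtype.ext hx.symm)⟩
  · have : Subsingleton ((spechtRep p).IntertwiningMap (spechtRep q)) := by
      refine ⟨fun f g => intertwining_ext_spechtGen (Subtype.ext ?_)⟩
      obtain ⟨x, hx⟩ := intertwining_spechtGen f
      obtain ⟨y, hy⟩ := intertwining_spechtGen g
      rw [hx, hy, youngSymmetrizer_mul_mul_of_ne h, youngSymmetrizer_mul_mul_of_ne h]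
    exact Module.finrank_zero_of_subsingleton

/-- The pairing of a function on the symmetric group with the character of a Specht module. -/
def spechtPairing (p : n.Partition) : (Equiv.Perm (Fin n) → ℂ) →ₗ[ℂ] ℂ :=
  (Nat.card (Equiv.Perm (Fin n)) : ℂ)⁻¹ •
    ∑ g, (spechtRep p).character g⁻¹ • LinearMap.proj g

theorem spechtPairing_character {W : Type*} [AddCommGroup W] [Module ℂ W] [FiniteDimensional ℂ W]
    (τ : Representation ℂ (Equiv.Perm (Fin n)) W) (p : n.Partition) :
    spechtPairing p τ.character = Module.finrank ℂ ((spechtRep p).IntertwiningMap τ) := by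
  rw [← Representation.card_inv_mul_sum_char_mul_char_eq_finrank]
  simp [spechtPairing, mul_comm]

/-- Pairing with a Specht character extracts a coefficient, by orthonormality. -/
theorem linearIndependent_spechtCharacter :
    LinearIndependent ℂ fun p : n.Partition => (spechtRep p).character := by
  classical
  rw [Fintype.linearIndependent_iff]
  intro c hc q
  have h := congrArg (spechtPairing q) hc
  simp only [map_sum, map_smul, spechtPairing_character, finrank_intertwining_specht] at h
  simpa using h

/-- The functions on the symmetric group that depend on the cycle type only. -/
def cycleTypeFun (n : ℕ) :
    ((Fintype.card (Fin n)).Partition → ℂ) →ₗ[ℂ] (Equiv.Perm (Fin n) → ℂ) :=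
  LinearMap.funLeft ℂ ℂ fun σ : Equiv.Perm (Fin n) => σ.partition

theorem character_mem_range_cycleTypeFun {W : Type*} [AddCommGroup W] [Module ℂ W]
    (τ : Representation ℂ (Equiv.Perm (Fin n)) W) :
    τ.character ∈ LinearMap.range (cycleTypeFun n) := by
  have h : Function.FactorsThrough τ.character fun σ : Equiv.Perm (Fin n) => σ.partition := by
    intro σ σ' hσ
    obtain ⟨g, rfl⟩ := isConj_iff.1 (Equiv.Perm.partition_eq_of_isConj.2 hσ)
    rw [Representation.char_conj]
  refine ⟨Function.extend (fun σ : Equiv.Perm (Fin n) => σ.partition) τ.character 0, ?_⟩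
  funext σ
  exact h.extend_apply 0 σ

/-- A dimension count replaces the completeness argument: the independent Specht characters are as
many as the partitions of `n`, and functions of the cycle type form a space of at most that
dimension. -/
theorem span_spechtCharacter : Submodule.span ℂ
    (Set.range fun p : n.Partition => (spechtRep p).character) = LinearMap.range (cycleTypeFun n) := by
  refine Submodule.eq_of_le_of_finrank_le (Submodule.span_le.2 ?_) ?_
  · rintro _ ⟨p, rfl⟩
    exact character_mem_range_cycleTypeFun _
  · rw [finrank_span_eq_card linearIndependent_spechtCharacter]
    refine (LinearMap.finrank_range_le _).trans ?_
    rw [Module.finrank_pi]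
    exact (Fintype.card_congr (Equiv.cast (by rw [Fintype.card_fin]))).le

theorem character_eq_sum_specht {W : Type*} [AddCommGroup W] [Module ℂ W] [FiniteDimensional ℂ W]
    (τ : Representation ℂ (Equiv.Perm (Fin n)) W) :
    τ.character = ∑ p : n.Partition,
      (Module.finrank ℂ ((spechtRep p).IntertwiningMap τ) : ℂ) • (spechtRep p).character := by
  classical
  have h := character_mem_range_cycleTypeFun τ
  rw [← span_spechtCharacter, Submodule.mem_span_range_iff_exists_fun] at h
  obtain ⟨c, hc⟩ := h
  rw [← hc]
  refine Finset.sum_congr rfl fun q _ => ?_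
  have h := congrArg (spechtPairing q) hc
  rw [spechtPairing_character] at h
  simp only [map_sum, map_smul, spechtPairing_character, finrank_intertwining_specht] at h
  rw [← h]
  simp

/-- Right multiplication by `κ⁻¹ c` projects the group algebra onto the left ideal of `c`. The trace
of `g` on the ideal is thus a trace on the group algebra, computed in the basis of permutations. -/
theorem spechtCharacter_eq (p : n.Partition) (g : Equiv.Perm (Fin n)) :
    (spechtRep p).character g
      = (youngScalar p)⁻¹ * ∑ h, (youngSymmetrizer p).coeff (h⁻¹ * g⁻¹ * h) := by
  classical
  let R : SymAlg n →ₗ[ℂ] spechtSpace p :=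
    (youngScalar p)⁻¹ • (LinearMap.mulRight ℂ (youngSymmetrizer p)).rangeRestrict
  have hR : R ∘ₗ (spechtSpace p).subtype = LinearMap.id := by
    refine LinearMap.ext fun y => ?_
    obtain ⟨_, x, rfl⟩ := y
    apply Subtype.ext
    change (youngScalar p)⁻¹ • (x * youngSymmetrizer p * youngSymmetrizer p)
      = x * youngSymmetrizer p
    rw [mul_assoc, youngSymmetrizer_mul_self, mul_smul_comm, smul_smul,
      inv_mul_cancel₀ (youngScalar_ne_zero p), one_smul]
  have h1 : (spechtRep p).character g = LinearMap.trace ℂ (SymAlg n)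
      ((spechtSpace p).subtype ∘ₗ (spechtRep p g ∘ₗ R)) := by
    rw [LinearMap.trace_comp_comm', LinearMap.comp_assoc, hR, LinearMap.comp_id]
    rfl
  rw [h1, LinearMap.trace_eq_matrix_trace ℂ (MonoidAlgebra.basis (Equiv.Perm (Fin n)) ℂ),
    Matrix.trace, Finset.mul_sum]
  refine Finset.sum_congr rfl fun h _ => ?_
  rw [Matrix.diag_apply, LinearMap.toMatrix_apply, MonoidAlgebra.basis_apply]
  change ((spechtRep p g (R (permElt h)) : SymAlg n)).coeff h = _
  rw [spechtRep_apply_coe]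
  change (permElt g * ((youngScalar p)⁻¹ • (permElt h * youngSymmetrizer p))).coeff h = _
  rw [mul_smul_comm, MonoidAlgebra.coeff_smul, Finsupp.smul_apply, ← mul_assoc, permElt_mul,
    coeff_permElt_mul, smul_eq_mul, mul_inv_rev]

end SymCharacter
/-! ### Weight spaces and characters -/

section Weights

/-- Joint eigenvectors with distinct eigenvalue systems split inside an invariant subspace. For `i ≠
j` some `f k` separates them; `f k - w j k` kills the summand of `j` and rescales the others by
scalars, nonzero at `i`, so induction applies to the rescaled family. -/
theorem mem_of_sum_mem_of_eigen {K M κ ι : Type*} [Field K] [AddCommGroup M] [Module K M]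
    (f : κ → Module.End K M) (A : Submodule K M) (hA : ∀ k, ∀ x ∈ A, f k x ∈ A) (w : ι → κ → K)
    (hw : Function.Injective w) (S : Finset ι) (a : ι → M)
    (ha : ∀ i ∈ S, ∀ k, f k (a i) = w i k • a i) (hs : ∑ i ∈ S, a i ∈ A) : ∀ i ∈ S, a i ∈ A := by
  classical
  induction S using Finset.induction_on generalizing a with
  | empty => simp
  | insert j S hj ih =>
    have h1 : ∀ i ∈ S, a i ∈ A := by
      intro i hi
      have hij : w i ≠ w j := fun h => hj (hw h ▸ hi)
      obtain ⟨k, hk⟩ := Function.ne_iff.1 hij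
      have h2 : (w i k - w j k) • a i ∈ A := by
        refine ih (fun i => (w i k - w j k) • a i) (fun i hi l => ?_) ?_ i hi
        · rw [map_smul, ha i (Finset.mem_insert_of_mem hi), smul_comm]
        · have h3 := A.sub_mem (hA k _ hs) (A.smul_mem (w j k) hs)
          rw [map_sum, Finset.smul_sum, ← Finset.sum_sub_distrib, Finset.sum_insert hj,
            ha j (Finset.mem_insert_self _ _), sub_self, zero_add] at h3
          convert! h3 using 1
          refine Finset.sum_congr rfl fun i hi => ?_
          rw [ha i (Finset.mem_insert_of_mem hi), sub_smul]
      exact (A.smul_mem_iff (sub_ne_zero.2 hk)).1 h2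
    intro i hi
    rcases Finset.mem_insert.1 hi with rfl | hi
    · rw [Finset.sum_insert hj] at hs
      exact (A.add_mem_iff_left (A.sum_mem h1)).1 hs
    · exact h1 i hi

variable {r : ℕ} {M : Type} [AddCommGroup M] [Module ℂ M] [LieRingModule (Gl r) M]
  [LieModule ℂ (Gl r) M]

theorem mem_of_sum_mem_of_weight (A : Submodule ℂ M)
    (hA : ∀ i : Fin r, ∀ x ∈ A, ⁅(Matrix.single i i 1 : Gl r), x⁆ ∈ A)
    (S : Finset (Fin r → ℂ)) (a : (Fin r → ℂ) → M) (ha : ∀ η ∈ S, a η ∈ weightSubspace r M η)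
    (hs : ∑ η ∈ S, a η ∈ A) : ∀ η ∈ S, a η ∈ A :=
  mem_of_sum_mem_of_eigen (fun i => LieModule.toEnd ℂ (Gl r) M (Matrix.single i i 1)) A hA id
    Function.injective_id S a ha hs

theorem finite_setOf_weightSubspace_ne_bot [FiniteDimensional ℂ M] :
    {η : Fin r → ℂ | weightSubspace r M η ≠ ⊥}.Finite := by
  have h : ∀ η : {η : Fin r → ℂ | weightSubspace r M η ≠ ⊥}, ∃ v ∈ weightSubspace r M η, v ≠ 0 :=
    fun η => (Submodule.ne_bot_iff _).1 η.2
  choose v hv hv0 using h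
  have hli : LinearIndependent ℂ v := by
    rw [linearIndependent_iff']
    intro S c hc η hη
    have := mem_of_sum_mem_of_eigen (fun i => LieModule.toEnd ℂ (Gl r) M (Matrix.single i i 1)) ⊥
      (by simp) (fun η : {η : Fin r → ℂ | weightSubspace r M η ≠ ⊥} => (η : Fin r → ℂ))
      Subtype.val_injective S (fun η => c η • v η) (fun η _ i => by
        rw [map_smul, LieModule.toEnd_apply_apply, hv η i, smul_comm])
      (by rw [hc]; exact Submodule.zero_mem _) η hη
    exact (smul_eq_zero.1 ((Submodule.mem_bot ℂ).1 this)).resolve_right (hv0 η)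
  exact hli.finite

/-- Only finitely many weights occur in finite dimension, so the `finsum` that defines the character
is a genuine sum and not the default value 0. -/
theorem coeff_ch [FiniteDimensional ℂ M] (η : Fin r → ℂ) :
    (ch r M).coeff η = Module.finrank ℂ (weightSubspace r M η) := by
  have hfin : (Function.support fun η : Fin r → ℂ => (AddMonoidAlgebra.single η
      (Module.finrank ℂ (weightSubspace r M η) : ℤ) : CharRing r)).Finite := by
    refine finite_setOf_weightSubspace_ne_bot (M := M).subset fun η hη => ?_
    intro h
    apply hη
    simp only
    rw [h, finrank_bot]
    simp
  rw [ch, finsum_eq_sum _ hfin, AddMonoidAlgebra.coeff_sum, Finsupp.finsetSum_apply]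
  simp only [AddMonoidAlgebra.coeff_single, Finsupp.single_apply]
  rw [Finset.sum_ite_eq']
  split_ifs with h
  · rfl
  · rw [Set.Finite.mem_toFinset, Function.mem_support, not_not] at h
    have := congrArg (fun x : CharRing r => x.coeff η) h
    simpa using this.symm

theorem ch_congr {M' : Type} [AddCommGroup M'] [Module ℂ M'] [LieRingModule (Gl r) M']
    [LieModule ℂ (Gl r) M'] (e : M ≃ₗ[ℂ] M') (he : ∀ (g : Gl r) (x : M), e ⁅g, x⁆ = ⁅g, e x⁆) :
    ch r M = ch r M' := by
  refine finsum_congr fun η => ?_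
  have h : (weightSubspace r M η).map e.toLinearMap = weightSubspace r M' η := by
    ext y
    rw [Submodule.mem_map_equiv]
    refine forall_congr' fun i => ?_
    rw [← e.injective.eq_iff, he, map_smul, e.apply_symm_apply]
  rw [← h, LinearEquiv.finrank_map_eq]

variable (r M) in
/-- The module is the sum of its weight subspaces. -/
def IsWeightModule : Prop := ⨆ η, weightSubspace r M η = ⊤

theorem IsWeightModule.exists_sum (h : IsWeightModule r M) (x : M) :
    ∃ (S : Finset (Fin r → ℂ)) (a : (Fin r → ℂ) → M),
      (∀ η, a η ∈ weightSubspace r M η) ∧ ∑ η ∈ S, a η = x := by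
  have hx : x ∈ ⨆ η, weightSubspace r M η := by rw [h]; trivial
  obtain ⟨f, hf, rfl⟩ := (Submodule.mem_iSup_iff_exists_finsupp _ _).1 hx
  exact ⟨f.support, f, hf, rfl⟩

/-- Taking a weight space is exact here. Only surjectivity onto the weight space of the quotient
needs an argument: the component of weight `η` of any lift is again a lift. -/
theorem finrank_weightSubspace_quotient [FiniteDimensional ℂ M] (h : IsWeightModule r M)
    (B : LieSubmodule ℂ (Gl r) M) (η : Fin r → ℂ) :
    Module.finrank ℂ (weightSubspace r (M ⧸ B) η) + Module.finrank ℂ (weightSubspace r B η)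
      = Module.finrank ℂ (weightSubspace r M η) := by
  let π : M →ₗ⁅ℂ, Gl r⁆ M ⧸ B := LieSubmodule.Quotient.mk' B
  have hπ : ∀ x, π x = 0 ↔ x ∈ B := fun x => by simp [π]
  have hmap : ∀ μ, ∀ x ∈ weightSubspace r M μ, π x ∈ weightSubspace r (M ⧸ B) μ := by
    intro μ x hx i
    rw [← LieModuleHom.map_lie, hx i, map_smul]
  let φ : weightSubspace r M η →ₗ[ℂ] weightSubspace r (M ⧸ B) η :=
    (π : M →ₗ[ℂ] M ⧸ B).restrict (hmap η)
  have hsurj : LinearMap.range φ = ⊤ := by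
    refine LinearMap.range_eq_top.2 fun y => ?_
    obtain ⟨x, hx⟩ := LieSubmodule.Quotient.surjective_mk' B (y : M ⧸ B)
    obtain ⟨S, a, ha, hax⟩ := h.exists_sum x
    -- The images of the weight components of the lift, minus `y` in weight `η`, sum to zero, so
    -- each difference vanishes. If `η` is not among the weights in `S`, then `y` itself is zero.
    have hη : π (a η) = y ∨ (η ∉ S ∧ (y : M ⧸ B) = 0) := by
      classical
      have hy : ∑ μ ∈ insert η S, ((if μ ∈ S then π (a μ) else 0)
          - if μ = η then (y : M ⧸ B) else 0) = 0 := by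
        rw [Finset.sum_sub_distrib, Finset.sum_ite_eq', if_pos (Finset.mem_insert_self _ _),
          sub_eq_zero, ← hx, ← hax]
        change _ = π _
        rw [map_sum, Finset.sum_ite_mem, Finset.inter_eq_right.2 (Finset.subset_insert _ _)]
      have h0 := mem_of_sum_mem_of_weight (⊥ : Submodule ℂ (M ⧸ B)) (by simp) (insert η S) _
        (fun μ _ => ?_) (by rw [hy]; exact Submodule.zero_mem _) η (Finset.mem_insert_self _ _)
      · rw [if_pos rfl, Submodule.mem_bot, sub_eq_zero] at h0
        split_ifs at h0 with hS
        · exact Or.inl h0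
        · exact Or.inr ⟨hS, h0.symm⟩
      · refine Submodule.sub_mem _ ?_ ?_
        · split_ifs
          · exact hmap μ _ (ha μ)
          · exact Submodule.zero_mem _
        · split_ifs with hμ
          · rw [hμ]; exact y.2
          · exact Submodule.zero_mem _
    rcases hη with hη | ⟨-, hη⟩
    · exact ⟨⟨a η, ha η⟩, Subtype.ext hη⟩
    · exact ⟨0, Subtype.ext (by rw [hη]; simp)⟩
  have hker : (LinearMap.ker φ).map (weightSubspace r M η).subtype
      = (weightSubspace r B η).map B.toSubmodule.subtype := by
    ext x
    constructor
    · rintro ⟨⟨x, hx⟩, hx0, rfl⟩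
      have hxB : x ∈ B := (hπ x).1 (congrArg Subtype.val hx0)
      exact ⟨⟨x, hxB⟩, fun i => Subtype.ext (hx i), rfl⟩
    · rintro ⟨⟨x, hxB⟩, hx, rfl⟩
      exact ⟨⟨x, fun i => congrArg Subtype.val (hx i)⟩, Subtype.ext ((hπ x).2 hxB), rfl⟩
  have h1 := LinearMap.finrank_range_add_finrank_ker φ
  rw [hsurj, finrank_top] at h1
  have h2 := Submodule.finrank_map_subtype_eq (weightSubspace r M η) (LinearMap.ker φ)
  have h3 := Submodule.finrank_map_subtype_eq B.toSubmodule (weightSubspace r B η)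
  rw [← h1, ← h2, hker]
  exact congrArg _ h3.symm

theorem ch_quotient_add [FiniteDimensional ℂ M] (h : IsWeightModule r M)
    (B : LieSubmodule ℂ (Gl r) M) : ch r (M ⧸ B) + ch r B = ch r M := by
  have : FiniteDimensional ℂ (M ⧸ B) :=
    Module.Finite.of_surjective (LieSubmodule.Quotient.mk' B : M →ₗ[ℂ] M ⧸ B)
      (LieSubmodule.Quotient.surjective_mk' B)
  have : FiniteDimensional ℂ B := inferInstanceAs (FiniteDimensional ℂ B.toSubmodule)
  ext η
  rw [AddMonoidAlgebra.coeff_add, Finsupp.add_apply, coeff_ch, coeff_ch, coeff_ch,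
    ← finrank_weightSubspace_quotient h B η, Nat.cast_add]

end Weights
/-! ### Weights of tensor powers -/

section TensorWeights

variable {r n : ℕ}

/-- The standard basis of the tensor power. -/
def tensorBasis (r n : ℕ) : Module.Basis (Fin n → Fin r) ℂ (TensorPow r n) :=
  Basis.piTensorProduct fun _ => Pi.basisFun ℂ (Fin r)

theorem tensorBasis_apply (c : Fin n → Fin r) :
    tensorBasis r n c = PiTensorProduct.tprod ℂ fun k => (Pi.single (c k) 1 : Fin r → ℂ) := by
  rw [tensorBasis, Basis.piTensorProduct_apply]
  simp

instance : FiniteDimensional ℂ (TensorPow r n) := Module.Finite.of_basis (tensorBasis r n)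

theorem lie_tensorBasis (i j : Fin r) (c : Fin n → Fin r) :
    ⁅(Matrix.single i j 1 : Gl r), tensorBasis r n c⁆
      = ∑ k, if c k = j then tensorBasis r n (Function.update c k i) else 0 := by
  rw [tensorBasis_apply, lie_tprod]
  refine Finset.sum_congr rfl fun k _ => ?_
  have h1 : ⁅(Matrix.single i j 1 : Gl r), (Pi.single (c k) 1 : Fin r → ℂ)⁆
      = if c k = j then Pi.single i 1 else 0 := by
    rw [Matrix.lie_apply]
    split_ifs with h
    · subst h
      ext l
      simp [Matrix.single, Pi.single_apply, eq_comm]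
    · ext l
      simp [Matrix.single, Ne.symm h]
  rw [h1]
  split_ifs with h
  · rw [tensorBasis_apply]
    congr 1
    funext l
    by_cases hl : l = k
    · subst hl; simp
    · simp [hl]
  · exact MultilinearMap.map_update_zero _ _ _

theorem permRep_tensorBasis (σ : Equiv.Perm (Fin n)) (c : Fin n → Fin r) :
    permRep r n σ (tensorBasis r n c) = tensorBasis r n (c ∘ σ.symm) := by
  rw [tensorBasis_apply, tensorBasis_apply]
  exact permEnd_tprod r n σ _

/-- The weight of a basis vector of the tensor power. -/
def wt (c : Fin n → Fin r) : Fin r → ℂ := fun i => ((Finset.univ.filter fun k => c k = i).card : ℂ)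

theorem wt_comp_perm (c : Fin n → Fin r) (σ : Equiv.Perm (Fin n)) : wt (c ∘ σ) = wt c := by
  funext i
  unfold wt
  congr 1
  refine Finset.card_bij (fun k _ => σ k) (by simp) (by simp) fun k hk => ⟨σ.symm k, ?_, by simp⟩
  simpa using hk

theorem tensorBasis_mem_weightSubspace (c : Fin n → Fin r) :
    tensorBasis r n c ∈ weightSubspace r (TensorPow r n) (wt c) := by
  intro i
  rw [lie_tensorBasis, wt, Finset.card_filter, Nat.cast_sum, Finset.sum_smul]
  refine Finset.sum_congr rfl fun k _ => ?_
  split_ifs with h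
  · rw [← h, Function.update_eq_self]
    simp
  · simp

open scoped Classical in
/-- The projection of the tensor power to a weight subspace. -/
def wtProj (r n : ℕ) (η : Fin r → ℂ) : Module.End ℂ (TensorPow r n) :=
  (tensorBasis r n).constr ℂ fun c => if wt c = η then tensorBasis r n c else 0

open scoped Classical in
theorem wtProj_tensorBasis (η : Fin r → ℂ) (c : Fin n → Fin r) :
    wtProj r n η (tensorBasis r n c) = if wt c = η then tensorBasis r n c else 0 :=
  (tensorBasis r n).constr_basis ℂ _ c

theorem lie_wtProj (η : Fin r → ℂ) (i : Fin r) (x : TensorPow r n) :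
    ⁅(Matrix.single i i 1 : Gl r), wtProj r n η x⁆ = η i • wtProj r n η x := by
  have h : LieModule.toEnd ℂ (Gl r) (TensorPow r n) (Matrix.single i i 1) ∘ₗ wtProj r n η
      = η i • wtProj r n η := by
    refine (tensorBasis r n).ext fun c => ?_
    rw [LinearMap.comp_apply, LinearMap.smul_apply, wtProj_tensorBasis]
    split_ifs with h
    · subst h
      exact tensorBasis_mem_weightSubspace c i
    · simp
  exact LinearMap.congr_fun h x

theorem wtProj_lie (η : Fin r → ℂ) (i : Fin r) (x : TensorPow r n) :
    wtProj r n η ⁅(Matrix.single i i 1 : Gl r), x⁆ = η i • wtProj r n η x := by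
  have h : wtProj r n η ∘ₗ LieModule.toEnd ℂ (Gl r) (TensorPow r n) (Matrix.single i i 1)
      = η i • wtProj r n η := by
    refine (tensorBasis r n).ext fun c => ?_
    rw [LinearMap.comp_apply, LinearMap.smul_apply, LieModule.toEnd_apply_apply,
      tensorBasis_mem_weightSubspace c i, map_smul, wtProj_tensorBasis]
    split_ifs with h
    · subst h; rfl
    · simp
  exact LinearMap.congr_fun h x

theorem permRep_wtProj (η : Fin r → ℂ) (σ : Equiv.Perm (Fin n)) :
    permRep r n σ ∘ₗ wtProj r n η = wtProj r n η ∘ₗ permRep r n σ := by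
  refine (tensorBasis r n).ext fun c => ?_
  rw [LinearMap.comp_apply, LinearMap.comp_apply, permRep_tensorBasis, wtProj_tensorBasis,
    wtProj_tensorBasis, wt_comp_perm]
  split_ifs
  · rw [permRep_tensorBasis]
  · rw [map_zero]

open scoped Classical in
theorem sum_wtProj (S : Finset (Fin r → ℂ)) (hS : ∀ c : Fin n → Fin r, wt c ∈ S) :
    ∑ η ∈ S, wtProj r n η = LinearMap.id := by
  refine (tensorBasis r n).ext fun c => ?_
  rw [LinearMap.sum_apply]
  simp only [wtProj_tensorBasis]
  rw [Finset.sum_ite_eq, if_pos (hS c), LinearMap.id_apply]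

variable {W : Type} [AddCommGroup W] [Module ℂ W]

theorem lie_tensorPowWith (g : Gl r) (x : TensorPowWith r n W) :
    ⁅g, x⁆ = TensorProduct.map (LieModule.toEnd ℂ (Gl r) (TensorPow r n) g)
      (LinearMap.id : TrivialLieModule ℂ (Gl r) W →ₗ[ℂ] _) x := by
  have h : LieModule.toEnd ℂ (Gl r) (TensorPowWith r n W) g
      = TensorProduct.map (LieModule.toEnd ℂ (Gl r) (TensorPow r n) g)
      (LinearMap.id : TrivialLieModule ℂ (Gl r) W →ₗ[ℂ] _) := by
    refine TensorProduct.ext' fun a b => ?_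
    rw [LieModule.toEnd_apply_apply, TensorProduct.LieModule.lie_tmul_right,
      trivial_lie_zero (Gl r) (TrivialLieModule ℂ (Gl r) W), TensorProduct.tmul_zero, add_zero]
    rfl
  exact LinearMap.congr_fun h x

/-- The weight projection on the first factor of `V_r^{⊗ n} ⊗ W`. -/
def wtProjWith (r n : ℕ) (W : Type) [AddCommGroup W] [Module ℂ W] (η : Fin r → ℂ) :
    Module.End ℂ (TensorPowWith r n W) :=
  TensorProduct.map (wtProj r n η) (LinearMap.id : TrivialLieModule ℂ (Gl r) W →ₗ[ℂ] _)

theorem lie_wtProjWith (η : Fin r → ℂ) (i : Fin r) (x : TensorPowWith r n W) :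
    ⁅(Matrix.single i i 1 : Gl r), wtProjWith r n W η x⁆ = η i • wtProjWith r n W η x := by
  rw [lie_tensorPowWith, wtProjWith, ← LinearMap.comp_apply, ← TensorProduct.map_comp]
  have : LieModule.toEnd ℂ (Gl r) (TensorPow r n) (Matrix.single i i 1) ∘ₗ wtProj r n η
      = η i • wtProj r n η := LinearMap.ext fun x => lie_wtProj η i x
  rw [this, TensorProduct.map_smul_left]
  rfl

theorem wtProjWith_lie (η : Fin r → ℂ) (i : Fin r) (x : TensorPowWith r n W) :
    wtProjWith r n W η ⁅(Matrix.single i i 1 : Gl r), x⁆ = η i • wtProjWith r n W η x := by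
  rw [lie_tensorPowWith, wtProjWith, ← LinearMap.comp_apply, ← TensorProduct.map_comp]
  have : wtProj r n η ∘ₗ LieModule.toEnd ℂ (Gl r) (TensorPow r n) (Matrix.single i i 1)
      = η i • wtProj r n η := LinearMap.ext fun x => wtProj_lie η i x
  rw [this, TensorProduct.map_smul_left]
  rfl

/-- On a vector of weight `η` the hypothesis on `P μ` gives two different scalars unless `P μ` kills
it or `μ = η`. Only one term of the resolution of `x` survives. -/
theorem proj_eq_self_of_mem_weightSubspace {M : Type} [AddCommGroup M] [Module ℂ M]
    [LieRingModule (Gl r) M] [LieModule ℂ (Gl r) M] {P : (Fin r → ℂ) → Module.End ℂ M}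
    (hP : ∀ μ i x, P μ ⁅(Matrix.single i i 1 : Gl r), x⁆ = μ i • P μ x)
    {S : Finset (Fin r → ℂ)} {η : Fin r → ℂ} (hη : η ∈ S) {x : M} (hS : ∑ μ ∈ S, P μ x = x)
    (hx : x ∈ weightSubspace r M η) : P η x = x := by
  have h0 : ∀ μ ≠ η, P μ x = 0 := by
    intro μ hμ
    obtain ⟨i, hi⟩ := Function.ne_iff.1 hμ
    have h1 := hP μ i x
    rw [hx i, map_smul, ← sub_eq_zero, ← sub_smul] at h1
    exact (smul_eq_zero.1 h1).resolve_left (sub_ne_zero.2 (Ne.symm hi))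
  rwa [Finset.sum_eq_single η (fun μ _ hμ => h0 μ hμ) (fun h => absurd hη h)] at hS

open scoped Classical in
theorem wtProj_of_mem {η : Fin r → ℂ} {x : TensorPow r n}
    (hx : x ∈ weightSubspace r (TensorPow r n) η) : wtProj r n η x = x := by
  refine proj_eq_self_of_mem_weightSubspace (P := wtProj r n) wtProj_lie
    (Finset.mem_insert_self η (Finset.univ.image (wt (r := r) (n := n)))) ?_ hx
  rw [← LinearMap.sum_apply, sum_wtProj _ (by simp), LinearMap.id_apply]

theorem wtProjWith_of_mem {η : Fin r → ℂ} {x : TensorPowWith r n W}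
    (hx : x ∈ weightSubspace r (TensorPowWith r n W) η) : wtProjWith r n W η x = x := by
  classical
  refine proj_eq_self_of_mem_weightSubspace (M := TensorPowWith r n W) (P := wtProjWith r n W)
    wtProjWith_lie (Finset.mem_insert_self η (Finset.univ.image (wt (r := r) (n := n)))) ?_ hx
  have h2 : ∑ μ ∈ insert η (Finset.univ.image (wt (r := r) (n := n))), wtProjWith r n W μ
      = LinearMap.id := by
    refine TensorProduct.ext' fun a b => ?_
    have h3 := LinearMap.congr_fun (sum_wtProj (n := n)
      (insert η (Finset.univ.image (wt (r := r) (n := n)))) (by simp)) a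
    rw [LinearMap.sum_apply] at h3 ⊢
    simp only [wtProjWith, TensorProduct.map_tmul]
    rw [← TensorProduct.sum_tmul, h3]
    rfl
  exact (LinearMap.sum_apply _ _ x).symm.trans (LinearMap.congr_fun h2 x)

theorem diagRep_wtProjWith (τ : Representation ℂ (Equiv.Perm (Fin n)) W) (η : Fin r → ℂ)
    (σ : Equiv.Perm (Fin n)) (x : TensorPowWith r n W) :
    diagRep r n τ σ (wtProjWith r n W η x) = wtProjWith r n W η (diagRep r n τ σ x) := by
  have h : diagRep r n τ σ ∘ₗ wtProjWith r n W η = wtProjWith r n W η ∘ₗ diagRep r n τ σ := by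
    refine TensorProduct.ext' fun a b => ?_
    simp only [LinearMap.comp_apply, wtProjWith, TensorProduct.map_tmul, diagRep_tmul,
      LinearMap.id_apply]
    rw [← LinearMap.comp_apply, permRep_wtProj, LinearMap.comp_apply]
    rfl
  exact LinearMap.congr_fun h x

theorem finrank_eq_trace_of_proj {V : Type*} [AddCommGroup V] [Module ℂ V] [FiniteDimensional ℂ V]
    {S : Submodule ℂ V} {f : Module.End ℂ V} (h1 : ∀ x, f x ∈ S) (h2 : ∀ x ∈ S, f x = x) :
    (Module.finrank ℂ S : ℂ) = LinearMap.trace ℂ V f :=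
  (LinearMap.IsProj.trace (⟨h1, h2⟩ : LinearMap.IsProj S f)).symm

theorem comp_sum_end {V ι : Type*} [AddCommMonoid V] [Module ℂ V] (f : Module.End ℂ V)
    (s : Finset ι) (g : ι → Module.End ℂ V) : f ∘ₗ ∑ i ∈ s, g i = ∑ i ∈ s, f ∘ₗ g i := by
  ext x
  simp

theorem trace_map_comp_sum_tprod {G V W : Type*} [Fintype G] [Monoid G] [AddCommGroup V]
    [Module ℂ V] [FiniteDimensional ℂ V] [AddCommGroup W] [Module ℂ W] [FiniteDimensional ℂ W]
    (ρ : Representation ℂ G V) (τ : Representation ℂ G W) (P : Module.End ℂ V) (c : ℂ) :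
    LinearMap.trace ℂ (V ⊗[ℂ] W) (TensorProduct.map P LinearMap.id ∘ₗ (c • ∑ g, ρ.tprod τ g))
      = c * ∑ g, LinearMap.trace ℂ V (P ∘ₗ ρ g) * τ.character g := by
  rw [LinearMap.comp_smul, map_smul, smul_eq_mul, comp_sum_end, map_sum]
  congr 1
  refine Finset.sum_congr rfl fun g _ => ?_
  rw [Representation.tprod_apply, ← TensorProduct.map_comp, LinearMap.id_comp]
  exact LinearMap.trace_tensorProduct' _ _

/-- Averaging over the group and projecting to a weight commute, and the composition is a projection
onto the subspace in question; its dimension is the trace, which factors over the tensor product. -/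
theorem finrank_weightSubspace_tensorInvariants [FiniteDimensional ℂ W]
    (τ : Representation ℂ (Equiv.Perm (Fin n)) W) (η : Fin r → ℂ) :
    (Module.finrank ℂ (weightSubspace r (tensorInvariants r n τ) η) : ℂ)
      = (n.factorial : ℂ)⁻¹ * ∑ σ, LinearMap.trace ℂ (TensorPow r n) (wtProj r n η ∘ₗ permRep r n σ)
          * τ.character σ := by
  have hfin : FiniteDimensional ℂ (TrivialLieModule ℂ (Gl r) W) :=
    inferInstanceAs (FiniteDimensional ℂ W)
  let S : Submodule ℂ (TensorPowWith r n W) := (weightSubspace r (tensorInvariants r n τ) η).map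
    (tensorInvariants r n τ).toSubmodule.subtype
  have hS : ∀ x, x ∈ S ↔ x ∈ (diagRep r n τ).invariants ∧
      x ∈ weightSubspace r (TensorPowWith r n W) η := by
    intro x
    constructor
    · rintro ⟨⟨x, hx⟩, hxη, rfl⟩
      exact ⟨hx, fun i => congrArg Subtype.val (hxη i)⟩
    · rintro ⟨h1, h2⟩
      exact ⟨⟨x, h1⟩, fun i => Subtype.ext (h2 i), rfl⟩
  let av : Module.End ℂ (TensorPowWith r n W) := (n.factorial : ℂ)⁻¹ • ∑ σ, diagRep r n τ σ
  have hinv : ∀ x, av x ∈ (diagRep r n τ).invariants := by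
    intro x σ
    change diagRep r n τ σ (((n.factorial : ℂ)⁻¹ • ∑ σ, diagRep r n τ σ) x)
      = ((n.factorial : ℂ)⁻¹ • ∑ σ, diagRep r n τ σ) x
    rw [LinearMap.smul_apply, map_smul, LinearMap.sum_apply, map_sum]
    congr 1
    refine Fintype.sum_equiv (Equiv.mulLeft σ) _ _ fun ρ => ?_
    rw [Equiv.coe_mulLeft, map_mul]
    rfl
  have hid : ∀ x ∈ (diagRep r n τ).invariants, av x = x := by
    intro x hx
    change ((n.factorial : ℂ)⁻¹ • ∑ σ, diagRep r n τ σ) x = x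
    rw [LinearMap.smul_apply, LinearMap.sum_apply, Finset.sum_congr rfl fun σ _ => hx σ,
      Finset.sum_const, Finset.card_univ, Fintype.card_perm, Fintype.card_fin, ← Nat.cast_smul_eq_nsmul ℂ,
      smul_smul, inv_mul_cancel₀ (Nat.cast_ne_zero.2 (Nat.factorial_ne_zero n)), one_smul]
  have hT : FiniteDimensional ℂ (TensorPowWith r n W) := Module.Finite.tensorProduct ..
  have h1 := finrank_eq_trace_of_proj (V := TensorPowWith r n W) (S := S)
    (f := wtProjWith r n W η ∘ₗ av)
    (fun x => (hS _).2 ⟨fun σ => (diagRep_wtProjWith τ η σ (av x)).trans (congrArg _ (hinv x σ)),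
      fun i => lie_wtProjWith η i _⟩)
    (fun x hx => (congrArg (wtProjWith r n W η) (hid x ((hS x).1 hx).1)).trans
      (wtProjWith_of_mem ((hS x).1 hx).2))
  have h2 : Module.finrank ℂ S = Module.finrank ℂ (weightSubspace r (tensorInvariants r n τ) η) :=
    Submodule.finrank_map_subtype_eq (tensorInvariants r n τ).toSubmodule
      (weightSubspace r (tensorInvariants r n τ) η)
  rw [← h2, h1]
  exact trace_map_comp_sum_tprod (W := W) (permRep r n) τ (wtProj r n η) (n.factorial : ℂ)⁻¹

end TensorWeights
/-! ### The images of Young symmetrizers on tensor powers -/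

section YoungImage

variable {r n : ℕ}

/-- The action of the group algebra of the symmetric group on the tensor power. -/
def symOp (r n : ℕ) : SymAlg n →ₐ[ℂ] Module.End ℂ (TensorPow r n) := (permRep r n).asAlgebraHom

theorem symOp_eq_sum (x : SymAlg n) : symOp r n x = ∑ σ, x.coeff σ • permRep r n σ := by
  rw [symOp, Representation.asAlgebraHom_def, MonoidAlgebra.lift_apply, Finsupp.sum_fintype]
  simp

theorem symOp_permElt (σ : Equiv.Perm (Fin n)) : symOp r n (permElt σ) = permRep r n σ :=
  Representation.asAlgebraHom_single_one _ _

theorem symOp_lie (x : SymAlg n) (g : Gl r) (t : TensorPow r n) :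
    symOp r n x ⁅g, t⁆ = ⁅g, symOp r n x t⁆ := by
  simp only [symOp_eq_sum, LinearMap.sum_apply, LinearMap.smul_apply, permRep_lie, lie_sum, lie_smul]

theorem symOp_wtProj (x : SymAlg n) (η : Fin r → ℂ) (t : TensorPow r n) :
    symOp r n x (wtProj r n η t) = wtProj r n η (symOp r n x t) := by
  simp only [symOp_eq_sum, LinearMap.sum_apply, LinearMap.smul_apply, map_sum, map_smul]
  refine Finset.sum_congr rfl fun σ _ => ?_
  rw [← LinearMap.comp_apply, permRep_wtProj, LinearMap.comp_apply]

/-- The image of the Young symmetrizer of `p` on the tensor power. -/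
def youngImage (r : ℕ) (p : n.Partition) : LieSubmodule ℂ (Gl r) (TensorPow r n) where
  __ := LinearMap.range (symOp r n (youngOpp p))
  lie_mem := by
    rintro g _ ⟨t, rfl⟩
    exact ⟨⁅g, t⁆, symOp_lie _ _ _⟩

theorem mem_youngImage {p : n.Partition} {t : TensorPow r n} :
    t ∈ youngImage r p ↔ ∃ s, symOp r n (youngOpp p) s = t := Iff.rfl

theorem symOp_youngOpp_of_mem {p : n.Partition} {t : TensorPow r n} (ht : t ∈ youngImage r p) :
    symOp r n (youngOpp p) t = youngScalar p • t := by
  obtain ⟨s, rfl⟩ := mem_youngImage.1 ht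
  rw [← Module.End.mul_apply, ← map_mul, youngOpp_mul_self, map_smul, LinearMap.smul_apply]

instance (p : n.Partition) : FiniteDimensional ℂ (youngImage r p) :=
  inferInstanceAs (FiniteDimensional ℂ (youngImage r p).toSubmodule)

/-- The opposite symmetrizer divided by `κ` is idempotent and commutes with the weight projection,
so the dimension is the trace of their product. -/
theorem finrank_weightSubspace_youngImage (p : n.Partition) (η : Fin r → ℂ) :
    (Module.finrank ℂ (weightSubspace r (youngImage r p) η) : ℂ)
      = (youngScalar p)⁻¹ * ∑ σ, (youngOpp p).coeff σ *
          LinearMap.trace ℂ (TensorPow r n) (wtProj r n η ∘ₗ permRep r n σ) := by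
  let S : Submodule ℂ (TensorPow r n) := (weightSubspace r (youngImage r p) η).map
    (youngImage r p).toSubmodule.subtype
  have hS : ∀ x, x ∈ S ↔ x ∈ youngImage r p ∧ x ∈ weightSubspace r (TensorPow r n) η := by
    intro x
    constructor
    · rintro ⟨⟨x, hx⟩, hxη, rfl⟩
      exact ⟨hx, fun i => congrArg Subtype.val (hxη i)⟩
    · rintro ⟨h1, h2⟩
      exact ⟨⟨x, h1⟩, fun i => Subtype.ext (h2 i), rfl⟩
  have h2 : Module.finrank ℂ S = Module.finrank ℂ (weightSubspace r (youngImage r p) η) :=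
    Submodule.finrank_map_subtype_eq (youngImage r p).toSubmodule
      (weightSubspace r (youngImage r p) η)
  have h1 := finrank_eq_trace_of_proj (S := S)
    (f := (youngScalar p)⁻¹ • (wtProj r n η ∘ₗ symOp r n (youngOpp p)))
    (fun x => (hS _).2 ⟨?_, fun i => ?_⟩) fun x hx => ?_
  · rw [← h2, h1, map_smul, smul_eq_mul, symOp_eq_sum, comp_sum_end, map_sum]
    congr 1
    refine Finset.sum_congr rfl fun σ _ => ?_
    rw [LinearMap.comp_smul, map_smul, smul_eq_mul]
  · rw [LinearMap.smul_apply, LinearMap.comp_apply, ← symOp_wtProj]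
    exact (youngImage r p).smul_mem _ ⟨_, rfl⟩
  · rw [LinearMap.smul_apply, LinearMap.comp_apply, lie_smul, lie_wtProj, smul_comm]
  · rw [LinearMap.smul_apply, LinearMap.comp_apply, symOp_youngOpp_of_mem ((hS x).1 hx).1, map_smul,
      wtProj_of_mem ((hS x).1 hx).2, smul_smul, inv_mul_cancel₀ (youngScalar_ne_zero p), one_smul]

theorem trace_wtProj_conj (η : Fin r → ℂ) (σ h : Equiv.Perm (Fin n)) :
    LinearMap.trace ℂ (TensorPow r n) (wtProj r n η ∘ₗ permRep r n (h * σ * h⁻¹))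
      = LinearMap.trace ℂ (TensorPow r n) (wtProj r n η ∘ₗ permRep r n σ) := by
  rw [map_mul, map_mul]
  change LinearMap.trace ℂ _ (wtProj r n η * (permRep r n h * permRep r n σ * permRep r n h⁻¹)) = _
  have h1 : wtProj r n η * permRep r n h = permRep r n h * wtProj r n η := (permRep_wtProj η h).symm
  rw [← mul_assoc, ← mul_assoc, h1, LinearMap.trace_mul_comm, ← mul_assoc, ← mul_assoc, ← map_mul,
    inv_mul_cancel, map_one, one_mul]
  rfl

/-- The Specht character is a sum over conjugates of the coefficients of the symmetrizer. The traces
are class functions, so all `n!` conjugates contribute equally and cancel the factor `1/n!`. The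
inverse in the character formula is what turns the symmetrizer into its opposite. -/
theorem sum_trace_wtProj_mul_spechtCharacter (p : n.Partition) (η : Fin r → ℂ) :
    (n.factorial : ℂ)⁻¹ * ∑ σ, LinearMap.trace ℂ (TensorPow r n) (wtProj r n η ∘ₗ permRep r n σ)
        * (spechtRep p).character σ
      = Module.finrank ℂ (weightSubspace r (youngImage r p) η) := by
  rw [finrank_weightSubspace_youngImage]
  set ψ : Equiv.Perm (Fin n) → ℂ :=
    fun σ => LinearMap.trace ℂ (TensorPow r n) (wtProj r n η ∘ₗ permRep r n σ) with hψ
  have hconj : ∀ σ h, ψ (h * σ * h⁻¹) = ψ σ := fun σ h => trace_wtProj_conj η σ h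
  change (n.factorial : ℂ)⁻¹ * ∑ σ, ψ σ * (spechtRep p).character σ
    = (youngScalar p)⁻¹ * ∑ σ, (youngOpp p).coeff σ * ψ σ
  have h1 : ∀ h : Equiv.Perm (Fin n), ∑ σ, ψ σ * (youngSymmetrizer p).coeff (h⁻¹ * σ⁻¹ * h)
      = ∑ σ, (youngOpp p).coeff σ * ψ σ := by
    intro h
    refine Fintype.sum_equiv (MulAut.conj h⁻¹).toEquiv _ _ fun σ => ?_
    have h2 : (MulAut.conj h⁻¹).toEquiv σ = h⁻¹ * σ * h⁻¹⁻¹ := rfl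
    have h4 : (h⁻¹ * σ * h⁻¹⁻¹)⁻¹ = h⁻¹ * σ⁻¹ * h := by group
    rw [h2, hconj, ← invMap_youngSymmetrizer, coeff_invMap, h4, mul_comm]
  simp only [spechtCharacter_eq, Finset.mul_sum]
  rw [Finset.sum_comm]
  have h3 : ∀ h : Equiv.Perm (Fin n), ∑ σ, (n.factorial : ℂ)⁻¹ *
      (ψ σ * ((youngScalar p)⁻¹ * (youngSymmetrizer p).coeff (h⁻¹ * σ⁻¹ * h)))
      = (n.factorial : ℂ)⁻¹ * ((youngScalar p)⁻¹ * ∑ σ, (youngOpp p).coeff σ * ψ σ) := by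
    intro h
    rw [← h1 h, Finset.mul_sum, Finset.mul_sum]
    refine Finset.sum_congr rfl fun σ _ => ?_
    ring
  simp only [Finset.mul_sum] at h3
  rw [Finset.sum_congr rfl fun h _ => h3 h, Finset.sum_const, Finset.card_univ, Fintype.card_perm,
    Fintype.card_fin, nsmul_eq_mul, Finset.mul_sum]
  refine Finset.sum_congr rfl fun σ _ => ?_
  rw [← mul_assoc, mul_inv_cancel₀ (Nat.cast_ne_zero.2 (Nat.factorial_ne_zero n)), one_mul]

/-- The trace formula is linear in the character of `τ`, which is a combination of Specht characters
with the multiplicities as coefficients. -/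
theorem ch_tensorInvariants {W : Type} [AddCommGroup W] [Module ℂ W] [FiniteDimensional ℂ W]
    (τ : Representation ℂ (Equiv.Perm (Fin n)) W) :
    ch r (tensorInvariants r n τ)
      = ∑ p : n.Partition, (Module.finrank ℂ ((spechtRep p).IntertwiningMap τ) : ℤ) •
          ch r (youngImage r p) := by
  have hfin : FiniteDimensional ℂ (TrivialLieModule ℂ (Gl r) W) :=
    inferInstanceAs (FiniteDimensional ℂ W)
  have hT : FiniteDimensional ℂ (TensorPowWith r n W) := Module.Finite.tensorProduct ..
  have hI : FiniteDimensional ℂ (tensorInvariants r n τ) :=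
    FiniteDimensional.finiteDimensional_submodule (V := TensorPowWith r n W)
      (tensorInvariants r n τ).toSubmodule
  ext η
  rw [coeff_ch, AddMonoidAlgebra.coeff_sum, Finsupp.finsetSum_apply]
  simp only [AddMonoidAlgebra.coeff_smul, Finsupp.smul_apply, coeff_ch, smul_eq_mul]
  have h : (Module.finrank ℂ (weightSubspace r (tensorInvariants r n τ) η) : ℂ)
      = ∑ p : n.Partition, (Module.finrank ℂ ((spechtRep p).IntertwiningMap τ) : ℂ) *
        Module.finrank ℂ (weightSubspace r (youngImage r p) η) := by
    rw [finrank_weightSubspace_tensorInvariants, character_eq_sum_specht τ]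
    simp only [← sum_trace_wtProj_mul_spechtCharacter, Finset.sum_apply, Pi.smul_apply, smul_eq_mul,
      Finset.mul_sum]
    rw [Finset.sum_comm]
    refine Finset.sum_congr rfl fun p _ => Finset.sum_congr rfl fun σ _ => ?_
    ring
  exact_mod_cast h

end YoungImage
/-! ### The commutant of the symmetric group and irreducibility -/

section Commutant

variable {r n : ℕ}

/-- The action of `U(gl_r)` on a `gl_r`-module. -/
def glAction (r : ℕ) (M : Type) [AddCommGroup M] [Module ℂ M] [LieRingModule (Gl r) M]
    [LieModule ℂ (Gl r) M] : UniversalEnvelopingAlgebra ℂ (Gl r) →ₐ[ℂ] Module.End ℂ M :=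
  UniversalEnvelopingAlgebra.lift ℂ (LieModule.toEnd ℂ (Gl r) M)

theorem glAction_ι {M : Type} [AddCommGroup M] [Module ℂ M] [LieRingModule (Gl r) M]
    [LieModule ℂ (Gl r) M] (g : Gl r) :
    glAction r M (UniversalEnvelopingAlgebra.ι ℂ g) = LieModule.toEnd ℂ (Gl r) M g := by
  rw [glAction, UniversalEnvelopingAlgebra.lift_ι_apply]

/-- The symmetrization of `x₁ ⊗ ⋯ ⊗ xₙ`. -/
def symMap (x : Fin n → Module.End ℂ (Fin r → ℂ)) : Module.End ℂ (TensorPow r n) :=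
  ∑ σ : Equiv.Perm (Fin n), PiTensorProduct.map fun i => x (σ i)

theorem symMap_comp_perm (x : Fin n → Module.End ℂ (Fin r → ℂ)) (τ : Equiv.Perm (Fin n)) :
    symMap (fun i => x (τ i)) = symMap x :=
  Fintype.sum_equiv (Equiv.mulLeft τ) _ _ fun _ => rfl

theorem symMap_mul_tensorEnd (x : Fin n → Module.End ℂ (Fin r → ℂ))
    (y : Module.End ℂ (Fin r → ℂ)) :
    symMap x * tensorEnd n y = ∑ l, symMap (Function.update x l (x l * y)) := by
  refine PiTensorProduct.ext (MultilinearMap.ext fun v => ?_)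
  simp only [LinearMap.compMultilinearMap_apply, Module.End.mul_apply, tensorEnd_tprod, map_sum,
    LinearMap.sum_apply, symMap, PiTensorProduct.map_tprod]
  rw [Finset.sum_comm]
  conv_rhs => rw [Finset.sum_comm]
  refine Finset.sum_congr rfl fun σ _ => Fintype.sum_equiv σ _ _ fun i => ?_
  congr 1
  funext k
  by_cases h : k = i
  · subst h; simp
  · simp [h, σ.injective.ne h]

theorem tensorEnd_mem_range (y : Module.End ℂ (Fin r → ℂ)) :
    tensorEnd n y ∈ (glAction r (TensorPow r n)).range := by
  have hy : LieModule.toEnd ℂ (Gl r) (Fin r → ℂ) (LinearMap.toMatrix' y) = y := by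
    refine LinearMap.ext fun v => ?_
    rw [LieModule.toEnd_apply_apply, Matrix.lie_apply, LinearMap.toMatrix'_mulVec]
  refine ⟨UniversalEnvelopingAlgebra.ι ℂ (LinearMap.toMatrix' y), ?_⟩
  change glAction r (TensorPow r n) _ = _
  rw [glAction_ι]
  conv_rhs => rw [← hy]
  rfl

theorem mem_of_add_smul_mem {A : Type*} [Semiring A] [Algebra ℂ A] (S : Subalgebra ℂ A) {a b : A}
    {c : ℂ} (hc : c ≠ 0) (ha : a ∈ S) (h : a + c • b ∈ S) : b ∈ S := by
  have h1 : b = c⁻¹ • ((-1 : ℂ) • a + (a + c • b)) := by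
    have h2 : (-1 : ℂ) • a + a = 0 := by
      conv_lhs => rw [← one_smul ℂ a, smul_smul, ← add_smul]
      simp
    rw [← add_assoc, h2, zero_add, smul_smul, inv_mul_cancel₀ hc, one_smul]
  rw [h1]
  exact S.smul_mem (S.add_mem (S.smul_mem ha _) h) _

/-- Induction on the set of positions where the entry is not the identity. Multiplying the
symmetrization with one such entry deleted by the derivation of that entry gives copies of the
desired operator plus symmetrizations with fewer nontrivial entries. -/
theorem symMap_mem_range (x : Fin n → Module.End ℂ (Fin r → ℂ)) :
    symMap x ∈ (glAction r (TensorPow r n)).range := by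
  suffices ∀ (s : Finset (Fin n)) (x : Fin n → Module.End ℂ (Fin r → ℂ)),
      (∀ i ∉ s, x i = 1) → symMap x ∈ (glAction r (TensorPow r n)).range from
    this Finset.univ x (by simp)
  clear x
  intro s
  induction s using Finset.induction_on with
  | empty =>
    intro x hx
    have : symMap x = (n.factorial : ℂ) • 1 := by
      have h1 : ∀ σ : Equiv.Perm (Fin n), PiTensorProduct.map (R := ℂ) (fun i => x (σ i)) = 1 := by
        intro σ
        simp only [hx _ (Finset.notMem_empty _)]
        exact PiTensorProduct.map_one
      rw [symMap, Finset.sum_congr rfl fun σ _ => h1 σ, Finset.sum_const, Finset.card_univ,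
        Fintype.card_perm, Fintype.card_fin, Nat.cast_smul_eq_nsmul]
    rw [this]
    exact Subalgebra.smul_mem _ (Subalgebra.one_mem _) _
  | insert j s hj ih =>
    intro x hx
    set x' := Function.update x j 1 with hx'
    have hx1 : ∀ i ∉ s, x' i = 1 := by
      intro i hi
      by_cases hij : i = j
      · subst hij; simp [hx']
      · rw [hx', Function.update_of_ne hij, hx i (by simp [hij, hi])]
    have h1 := symMap_mul_tensorEnd x' (x j)
    -- At a position outside `s` the deleted entry is inserted into an identity slot, which gives
    -- `x` up to the swap of `l` and `j`.
    have h2 : ∀ l ∉ s, symMap (Function.update x' l (x' l * x j)) = symMap x := by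
      intro l hl
      rw [← symMap_comp_perm x (Equiv.swap l j)]
      congr 1
      funext i
      rw [hx1 l hl, one_mul]
      by_cases hil : i = l
      · subst hil; simp
      · rw [Function.update_of_ne hil]
        by_cases hij : i = j
        · subst hij
          rw [Equiv.swap_apply_right, hx1 i hj, hx l]
          simp [hl, Ne.symm hil]
        · rw [Equiv.swap_apply_of_ne_of_ne hil hij, hx', Function.update_of_ne hij]
    have h3 : ∀ l ∈ s, symMap (Function.update x' l (x' l * x j))
        ∈ (glAction r (TensorPow r n)).range := by
      intro l hl
      refine ih _ fun i hi => ?_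
      rw [Function.update_of_ne (fun h : i = l => hi (by rw [h]; exact hl)), hx1 i hi]
    rw [← Finset.sum_add_sum_compl s, Finset.sum_congr (s₁ := sᶜ) rfl
      fun l hl => h2 l (Finset.mem_compl.1 hl), Finset.sum_const, ← Nat.cast_smul_eq_nsmul ℂ] at h1
    -- The number of copies of the desired operator is nonzero, since `j` itself lies outside `s`.
    have h5 : ((sᶜ.card : ℕ) : ℂ) ≠ 0 :=
      Nat.cast_ne_zero.2 (Finset.card_pos.2 ⟨j, Finset.mem_compl.2 hj⟩).ne'
    refine mem_of_add_smul_mem _ h5 (Subalgebra.sum_mem _ h3) ?_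
    rw [← h1]
    exact Subalgebra.mul_mem _ (ih x' hx1) (tensorEnd_mem_range _)

theorem permRep_comp_map (σ : Equiv.Perm (Fin n)) (x : Fin n → Module.End ℂ (Fin r → ℂ)) :
    permRep r n σ * PiTensorProduct.map x * permRep r n σ⁻¹
      = PiTensorProduct.map fun i => x (σ⁻¹ i) := by
  refine PiTensorProduct.ext (MultilinearMap.ext fun v => ?_)
  simp only [LinearMap.compMultilinearMap_apply, Module.End.mul_apply]
  change permEnd r n σ (PiTensorProduct.map x (permEnd r n σ⁻¹ _)) = _
  rw [permEnd_tprod, PiTensorProduct.map_tprod, permEnd_tprod]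
  rw [PiTensorProduct.map_tprod]
  congr 1
  funext i
  change x (σ.symm i) (v (σ⁻¹.symm (σ.symm i))) = _
  congr 2
  exact σ.apply_symm_apply i

/-- The matrix units with respect to the tensor basis are tensor products of matrix units. -/
theorem exists_sum_map (b : Module.End ℂ (TensorPow r n)) :
    b ∈ Submodule.span ℂ (Set.range fun x : Fin n → Module.End ℂ (Fin r → ℂ) =>
      PiTensorProduct.map (R := ℂ) x) := by
  have hE : ∀ c d : Fin n → Fin r, ∀ c', PiTensorProduct.map (R := ℂ)
      (fun i => Matrix.toLin' (Matrix.single (d i) (c i) (1 : ℂ))) (tensorBasis r n c')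
      = if c' = c then tensorBasis r n d else 0 := by
    intro c d c'
    rw [tensorBasis_apply, PiTensorProduct.map_tprod]
    split_ifs with h
    · subst h
      rw [tensorBasis_apply]
      congr 1
      funext i
      ext l
      simp [Matrix.single, Pi.single_apply, eq_comm]
    · obtain ⟨i, hi⟩ := Function.ne_iff.1 h
      refine MultilinearMap.map_coord_zero _ i ?_
      ext l
      simp [Matrix.single, Ne.symm hi]
  have hb : b = ∑ c, ∑ d, (tensorBasis r n).repr (b (tensorBasis r n c)) d •
      PiTensorProduct.map (R := ℂ)
        (fun i => Matrix.toLin' (Matrix.single (d i) (c i) (1 : ℂ))) := by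
    refine (tensorBasis r n).ext fun c' => ?_
    simp only [LinearMap.sum_apply, LinearMap.smul_apply, hE]
    rw [Finset.sum_eq_single c']
    · simp only [if_true]
      exact ((tensorBasis r n).sum_repr _).symm
    · intro c _ hc
      simp [Ne.symm hc]
    · simp
  rw [hb]
  exact Submodule.sum_mem _ fun c _ => Submodule.sum_mem _ fun d _ =>
    Submodule.smul_mem _ _ (Submodule.subset_span ⟨_, rfl⟩)

/-- Operators on the tensor power that commute with permutations come from `U(gl_r)`. -/
theorem mem_range_glAction_of_commute {b : Module.End ℂ (TensorPow r n)}
    (hb : ∀ σ, b * permRep r n σ = permRep r n σ * b) :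
    b ∈ (glAction r (TensorPow r n)).range := by
  -- The sum of conjugates of a pure tensor of operators is its symmetrization, so sums of
  -- conjugates always lie in the range. For the commuting operator `b` this sum is `n! b`.
  have h1 : ∀ a : Module.End ℂ (TensorPow r n),
      ∑ σ, permRep r n σ * a * permRep r n σ⁻¹ ∈ (glAction r (TensorPow r n)).range := by
    intro a
    induction exists_sum_map a using Submodule.span_induction with
    | mem a ha =>
      obtain ⟨x, rfl⟩ := ha
      simp only [permRep_comp_map]
      convert! symMap_mem_range x using 1
      exact Fintype.sum_equiv (Equiv.inv _) _ _ fun σ => rfl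
    | zero => simp
    | add a c _ _ ha hc =>
      simp only [mul_add, add_mul, Finset.sum_add_distrib]
      exact Subalgebra.add_mem _ ha hc
    | smul c a _ ha =>
      simp only [mul_smul_comm, smul_mul_assoc, ← Finset.smul_sum]
      exact Subalgebra.smul_mem _ ha c
  have h2 := h1 b
  simp only [← hb, mul_assoc, ← map_mul, mul_inv_cancel, map_one, mul_one, Finset.sum_const,
    Finset.card_univ, Fintype.card_perm, Fintype.card_fin] at h2
  rw [← Nat.cast_smul_eq_nsmul ℂ] at h2
  have h3 := Subalgebra.smul_mem _ h2 ((n.factorial : ℂ)⁻¹)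
  rwa [smul_smul, inv_mul_cancel₀ (Nat.cast_ne_zero.2 (Nat.factorial_ne_zero n)), one_smul] at h3

/-- The Young symmetrizer image is irreducible over `U(gl_r)`. -/
theorem exists_glAction_youngImage {p : n.Partition} {m m' : TensorPow r n}
    (hm : m ∈ youngImage r p) (hm' : m' ∈ youngImage r p) (h0 : m ≠ 0) :
    ∃ u, glAction r (TensorPow r n) u m = m' := by
  obtain ⟨φ, hφ⟩ : ∃ φ : Module.Dual ℂ (TensorPow r n), φ m ≠ 0 := by
    by_contra! h
    exact h0 ((Module.forall_dual_apply_eq_zero_iff ℂ m).1 h)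
  -- The sum of the conjugates of the rank one operator `x ↦ φ x • m'`. It commutes with
  -- permutations, hence comes from `U(gl_r)`, and it maps `m` to a nonzero multiple of `m'`.
  let b : Module.End ℂ (TensorPow r n) :=
    ∑ σ, (φ ∘ₗ permRep r n σ⁻¹).smulRight (permRep r n σ m')
  have hb : ∀ x, b x = ∑ σ, φ (permRep r n σ⁻¹ x) • permRep r n σ m' := by
    intro x
    simp [b, LinearMap.sum_apply]
  have hcomm : ∀ σ, b * permRep r n σ = permRep r n σ * b := by
    intro σ
    refine LinearMap.ext fun x => ?_
    rw [Module.End.mul_apply, Module.End.mul_apply, hb, hb, map_sum]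
    refine Fintype.sum_equiv (Equiv.mulLeft σ⁻¹) _ _ fun ρ => ?_
    rw [map_smul, ← Module.End.mul_apply, ← Module.End.mul_apply, ← map_mul, ← map_mul]
    simp
  have hcomm' : ∀ y x, b (symOp r n y x) = symOp r n y (b x) := by
    intro y x
    simp only [symOp_eq_sum, LinearMap.sum_apply, LinearMap.smul_apply, map_sum, map_smul]
    refine Finset.sum_congr rfl fun σ _ => ?_
    rw [← Module.End.mul_apply, hcomm, Module.End.mul_apply]
  have hm1 := symOp_youngOpp_of_mem hm
  have hm2 := symOp_youngOpp_of_mem hm'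
  have hκ := youngScalar_ne_zero p
  -- With `o` the opposite symmetrizer, `o m = κ m` and `o m' = κ m'`. Moving `o` through `b`
  -- produces the vectors `o σ m'`, which are multiples of `m'` by the coefficients of `o` at `σ⁻¹`;
  -- these coefficients reassemble `o` acting on `m`.
  have h1 : youngScalar p • b m = (youngScalar p * youngScalar p * φ m) • m' := by
    rw [← map_smul, ← hm1, hcomm', hb, map_sum]
    have h2 : ∀ σ, symOp r n (youngOpp p) (permRep r n σ m')
        = (youngScalar p * (youngOpp p).coeff σ⁻¹) • m' := by
      intro σ
      have h3 : m' = (youngScalar p)⁻¹ • symOp r n (youngOpp p) m' := by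
        rw [hm2, smul_smul, inv_mul_cancel₀ hκ, one_smul]
      conv_lhs => rw [h3]
      rw [map_smul, map_smul, ← symOp_permElt, ← Module.End.mul_apply, ← Module.End.mul_apply,
        ← map_mul, ← map_mul, youngOpp_mul_permElt_mul, map_smul, LinearMap.smul_apply, hm2,
        smul_smul, smul_smul]
      congr 1
      field_simp
    simp only [map_smul, h2, smul_smul, ← Finset.sum_smul]
    congr 1
    have h4 : φ (symOp r n (youngOpp p) m) = youngScalar p * φ m := by
      rw [hm1, map_smul, smul_eq_mul]
    rw [mul_assoc, ← h4, symOp_eq_sum, LinearMap.sum_apply, map_sum, Finset.mul_sum]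
    refine Fintype.sum_equiv (Equiv.inv _) _ _ fun σ => ?_
    rw [LinearMap.smul_apply, map_smul, smul_eq_mul, Equiv.inv_apply]
    ring
  obtain ⟨u, hu⟩ := mem_range_glAction_of_commute hcomm
  refine ⟨(youngScalar p * φ m)⁻¹ • u, ?_⟩
  change glAction r (TensorPow r n) u = b at hu
  have h2 : b m = (youngScalar p * φ m) • m' := by
    have := congrArg (fun x => (youngScalar p)⁻¹ • x) h1
    simpa only [smul_smul, inv_mul_cancel₀ hκ, one_smul, ← mul_assoc, one_mul] using this
  rw [map_smul, LinearMap.smul_apply, hu, h2, smul_smul,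
    inv_mul_cancel₀ (mul_ne_zero hκ hφ), one_smul]

end Commutant
/-! ### Highest weight vectors -/

section HighestWeightVector

variable {r n : ℕ}

/-- The swap of two equal entries in one column fixes the basis tensor but changes the sign of the
column sum. -/
theorem symOp_colSum_tensorBasis_eq_zero (p : n.Partition) {d : Fin n → Fin r} {x y : Fin n}
    (hxy : x ≠ y) (hc : colOf p x = colOf p y) (hd : d x = d y) :
    symOp r n (colSum p) (tensorBasis r n d) = 0 := by
  have hs : ∀ k, colOf p (Equiv.swap x y k) = colOf p k := by
    intro k
    rcases eq_or_ne k x with rfl | hx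
    · simp [hc]
    · rcases eq_or_ne k y with rfl | hy
      · simp [hc]
      · rw [Equiv.swap_apply_of_ne_of_ne hx hy]
  have hfix : permRep r n (Equiv.swap x y) (tensorBasis r n d) = tensorBasis r n d := by
    rw [permRep_tensorBasis]
    congr 1
    funext k
    rw [Function.comp_apply, Equiv.symm_swap]
    rcases eq_or_ne k x with rfl | hx
    · simp [hd]
    · rcases eq_or_ne k y with rfl | hy
      · simp [hd]
      · rw [Equiv.swap_apply_of_ne_of_ne hx hy]
  have h1 : symOp r n (colSum p) (tensorBasis r n d)
      = (-1 : ℂ) • symOp r n (colSum p) (tensorBasis r n d) := by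
    conv_lhs => rw [← hfix, ← symOp_permElt, ← Module.End.mul_apply, ← map_mul,
      colSum_mul_permElt p hs, Equiv.Perm.sign_swap hxy, map_smul, LinearMap.smul_apply]
    rw [Units.val_neg, Units.val_one, Int.cast_neg, Int.cast_one]
  have h2 : ∀ v : TensorPow r n, v = (-1 : ℂ) • v → v = 0 := by
    intro v hv
    have h3 : (2 : ℂ) • v = ((1 : ℂ) + -1) • v := by
      rw [add_smul, one_smul, ← hv, two_smul]
    rw [add_neg_cancel, zero_smul] at h3
    exact (smul_eq_zero.1 h3).resolve_left two_ne_zero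
  exact h2 _ h1

theorem rowOf_lt (p : n.Partition) (hp : part p r = 0) (k : Fin n) : rowOf p k < r := by
  by_contra h
  have h1 := part_antitone p (not_lt.1 h)
  rw [hp] at h1
  exact absurd (colOf_lt_part p k) (by omega)

/-- The filling of the tableau by row numbers. -/
def rowFilling (p : n.Partition) (hp : part p r = 0) : Fin n → Fin r :=
  fun k => ⟨rowOf p k, rowOf_lt p hp k⟩

/-- The highest weight vector in the image of the Young symmetrizer. -/
def highestVec (p : n.Partition) (hp : part p r = 0) : TensorPow r n :=
  symOp r n (colSum p) (tensorBasis r n (rowFilling p hp))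

theorem wt_rowFilling (p : n.Partition) (hp : part p r = 0) :
    wt (rowFilling p hp) = (partWeight r p).1 := by
  funext i
  change (_ : ℂ) = (part p i : ℂ)
  rw [← card_rowOf_eq]
  simp only [wt, rowFilling, Fin.ext_iff]

theorem highestVec_mem_weightSubspace (p : n.Partition) (hp : part p r = 0) :
    highestVec p hp ∈ weightSubspace r (TensorPow r n) (partWeight r p).1 := by
  intro i
  rw [highestVec, ← symOp_lie, tensorBasis_mem_weightSubspace, map_smul, wt_rowFilling]

/-- Each term changes one entry `j` to `i`. The box of the same column in row `i` already has entry
`i`, so the column sum kills the term. -/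
theorem lie_highestVec (p : n.Partition) (hp : part p r = 0) {i j : Fin r} (hij : i < j) :
    ⁅(Matrix.single i j 1 : Gl r), highestVec p hp⁆ = 0 := by
  rw [highestVec, ← symOp_lie, lie_tensorBasis, map_sum]
  refine Finset.sum_eq_zero fun k _ => ?_
  split_ifs with h
  · have h1 : rowOf p k = j := congrArg Fin.val h
    obtain ⟨z, hz1, hz2⟩ := exists_rowOf_le p k i (by rw [h1]; exact hij.le)
    have hzk : z ≠ k := by
      rintro rfl
      rw [h1] at hz1
      exact hij.ne' (Fin.ext hz1)
    refine symOp_colSum_tensorBasis_eq_zero p hzk hz2 ?_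
    rw [Function.update_self, Function.update_of_ne hzk]
    exact Fin.ext hz1
  · rw [map_zero]

/-- A column permutation that fixes the row filling also preserves rows, hence is the identity. This
proves that the highest weight vector is nonzero. -/
theorem repr_highestVec (p : n.Partition) (hp : part p r = 0) :
    (tensorBasis r n).repr (highestVec p hp) (rowFilling p hp) = 1 := by
  rw [highestVec, colSum, map_sum, LinearMap.sum_apply, map_sum, Finsupp.finsetSum_apply,
    Finset.sum_eq_single 1]
  · rw [Equiv.Perm.sign_one, Units.val_one, Int.cast_one, symOp_permElt, map_one]
    simp
  · intro σ hσ hσ1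
    rw [single_eq_smul_permElt, map_smul, LinearMap.smul_apply, symOp_permElt, permRep_tensorBasis,
      map_smul, Finsupp.smul_apply, Module.Basis.repr_self, Finsupp.single_apply, if_neg, smul_zero]
    intro h
    apply hσ1
    simp only [Finset.mem_filter, Finset.mem_univ, true_and] at hσ
    ext k : 1
    refine eq_of_rowOf_colOf p ?_ (hσ k)
    have := congrArg Fin.val (congrFun h (σ k))
    simpa [rowFilling] using this.symm
  · simp

theorem highestVec_ne_zero (p : n.Partition) (hp : part p r = 0) : highestVec p hp ≠ 0 := by
  intro h
  have := repr_highestVec p hp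
  rw [h] at this
  simp at this

/-- The row filling is fixed by row permutations, so the row sum only multiplies it by a nonzero
number. -/
theorem highestVec_mem_youngImage (p : n.Partition) (hp : part p r = 0) :
    highestVec p hp ∈ youngImage r p := by
  have h1 : symOp r n (rowSum p) (tensorBasis r n (rowFilling p hp))
      = ((Finset.univ.filter fun σ : Equiv.Perm (Fin n) => ∀ k, rowOf p (σ k) = rowOf p k).card : ℂ)
        • tensorBasis r n (rowFilling p hp) := by
    rw [rowSum, map_sum, LinearMap.sum_apply, Nat.cast_smul_eq_nsmul, ← Finset.sum_const]
    refine Finset.sum_congr rfl fun σ hσ => ?_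
    rw [symOp_permElt, permRep_tensorBasis]
    congr 1
    funext k
    simp only [Finset.mem_filter, Finset.mem_univ, true_and] at hσ
    have := hσ (σ.symm k)
    rw [Equiv.apply_symm_apply] at this
    exact Fin.ext this.symm
  have h2 : ((Finset.univ.filter fun σ : Equiv.Perm (Fin n) =>
      ∀ k, rowOf p (σ k) = rowOf p k).card : ℂ) ≠ 0 :=
    Nat.cast_ne_zero.2 (Finset.card_pos.2 ⟨1, by simp⟩).ne'
  refine ((youngImage r p).toSubmodule.smul_mem_iff h2).1 ⟨tensorBasis r n (rowFilling p hp), ?_⟩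
  rw [youngOpp, map_mul, Module.End.mul_apply, h1, map_smul, highestVec]

/-- The first column has more than `r` boxes, since `part` counts from 0. Two of them carry the same
one of `r` letters, so the column sum kills every basis tensor. -/
theorem youngImage_eq_bot (p : n.Partition) (hp : part p r ≠ 0) : youngImage r p = ⊥ := by
  have h0 : symOp r n (colSum p) = 0 := by
    refine (tensorBasis r n).ext fun d => ?_
    have hz : ∀ i : Fin (r + 1), ∃ z, rowOf p z = i ∧ colOf p z = 0 := fun i =>
      exists_rowOf_colOf p ((Nat.pos_of_ne_zero hp).trans_le
        (part_antitone p (Nat.lt_succ_iff.1 i.2)))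
    choose z hz1 hz2 using hz
    obtain ⟨i, j, hij, hd⟩ := Fintype.exists_ne_map_eq_of_card_lt (fun i => d (z i)) (by simp)
    refine symOp_colSum_tensorBasis_eq_zero p (x := z i) (y := z j) (fun h => hij ?_)
      (by rw [hz2, hz2]) hd
    exact Fin.ext (by rw [← hz1 i, ← hz1 j, h])
  rw [eq_bot_iff]
  rintro t ht
  obtain ⟨s, rfl⟩ := mem_youngImage.1 ht
  rw [youngOpp, map_mul, h0, zero_mul]
  exact Submodule.zero_mem _

end HighestWeightVector
/-! ### Irreducible highest weight modules -/

section IrrHighestWeight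

/-- By the universal property the inclusion of `L` lifts to a map into `T`, and its composition with
`T ⊆ U` is the identity. -/
theorem mem_subalgebra_of_ι_mem {L : Type*} [LieRing L] [LieAlgebra ℂ L]
    (T : Subalgebra ℂ (UniversalEnvelopingAlgebra ℂ L))
    (h : ∀ g : L, UniversalEnvelopingAlgebra.ι ℂ g ∈ T) (u : UniversalEnvelopingAlgebra ℂ L) :
    u ∈ T := by
  let f : L →ₗ⁅ℂ⁆ T :=
    { toFun := fun g => ⟨UniversalEnvelopingAlgebra.ι ℂ g, h g⟩
      map_add' := fun a b => Subtype.ext (map_add _ a b)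
      map_smul' := fun c a => Subtype.ext (map_smul _ c a)
      map_lie' := fun {a b} => Subtype.ext (by
        change UniversalEnvelopingAlgebra.ι ℂ ⁅a, b⁆ = _
        rw [LieHom.map_lie]
        rfl) }
  have h1 : T.val.comp (UniversalEnvelopingAlgebra.lift ℂ f) = AlgHom.id ℂ _ := by
    refine UniversalEnvelopingAlgebra.hom_ext ℂ (LieHom.ext fun g => ?_)
    change T.val (UniversalEnvelopingAlgebra.lift ℂ f (UniversalEnvelopingAlgebra.ι ℂ g)) = _
    rw [UniversalEnvelopingAlgebra.lift_ι_apply]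
    rfl
  have h2 := AlgHom.congr_fun h1 u
  rw [AlgHom.id_apply] at h2
  rw [← h2]
  exact Subtype.coe_prop _

variable {r : ℕ}

/-- The enveloping algebra of `gl_r`. -/
abbrev UGl (r : ℕ) : Type := UniversalEnvelopingAlgebra ℂ (Gl r)

/-- The matrix unit `E_ij` in `U(gl_r)`. -/
def unitElt (i j : Fin r) : UGl r := UniversalEnvelopingAlgebra.ι ℂ (Matrix.single i j 1 : Gl r)

/-- A product of matrix units. -/
def unitProd (l : List (Fin r × Fin r)) : UGl r := (l.map fun p => unitElt p.1 p.2).prod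

/-- The span of the products of lower triangular matrix units. -/
def lowerSpan (r : ℕ) : Submodule ℂ (UGl r) :=
  Submodule.span ℂ {u | ∃ l : List (Fin r × Fin r), (∀ p ∈ l, p.2 < p.1) ∧ u = unitProd l}

variable (w : Fin r → ℂ)

theorem unitElt_mem_vermaIdeal {i j : Fin r} (h : i < j) : unitElt i j ∈ vermaIdeal r w :=
  Submodule.subset_span (Or.inl ⟨i, j, h, rfl⟩)

theorem unitElt_sub_mem_vermaIdeal (i : Fin r) :
    unitElt i i - algebraMap ℂ _ (w i) ∈ vermaIdeal r w :=
  Submodule.subset_span (Or.inr ⟨i, rfl⟩)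

/-- The lower triangular products together with the Verma ideal. -/
def lowerSup : Submodule ℂ (UGl r) := lowerSpan r ⊔ (vermaIdeal r w).restrictScalars ℂ

theorem mem_lowerSup_of_mem {u : UGl r} (h : u ∈ vermaIdeal r w) : u ∈ lowerSup w :=
  Submodule.mem_sup_right h

theorem unitProd_mem_lowerSup {l : List (Fin r × Fin r)} (hl : ∀ p ∈ l, p.2 < p.1) :
    unitProd l ∈ lowerSup w :=
  Submodule.mem_sup_left (Submodule.subset_span ⟨l, hl, rfl⟩)

theorem lowerSup_induction {P : UGl r → Prop}
    (hl : ∀ l : List (Fin r × Fin r), (∀ p ∈ l, p.2 < p.1) → P (unitProd l))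
    (hI : ∀ u ∈ vermaIdeal r w, P u) (hadd : ∀ a b, P a → P b → P (a + b))
    (hsmul : ∀ (c : ℂ) a, P a → P (c • a)) {u : UGl r} (hu : u ∈ lowerSup w) : P u := by
  obtain ⟨a, ha, b, hb, rfl⟩ := Submodule.mem_sup.1 hu
  refine hadd _ _ ?_ (hI b hb)
  clear hu
  induction ha using Submodule.span_induction with
  | mem x hx =>
    obtain ⟨l, hl', rfl⟩ := hx
    exact hl l hl'
  | zero => exact hI 0 (Submodule.zero_mem _)
  | add x y _ _ hx hy => exact hadd _ _ hx hy
  | smul c x _ hx => exact hsmul c x hx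

theorem lower_mul_mem_lowerSup {i j : Fin r} (h : j < i) {u : UGl r} (hu : u ∈ lowerSup w) :
    unitElt i j * u ∈ lowerSup w := by
  refine lowerSup_induction w (P := fun u => unitElt i j * u ∈ lowerSup w) (fun l hl => ?_)
    (fun u hu => mem_lowerSup_of_mem w (Submodule.smul_mem _ (unitElt i j) hu))
    (fun a b ha hb => ?_) (fun c a ha => ?_) hu
  · have : unitElt i j * unitProd l = unitProd ((i, j) :: l) := by simp [unitProd]
    rw [this]
    refine unitProd_mem_lowerSup w fun p hp => ?_
    rcases List.mem_cons.1 hp with rfl | hp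
    · exact h
    · exact hl p hp
  · rw [mul_add]; exact Submodule.add_mem _ ha hb
  · rw [mul_smul_comm]; exact Submodule.smul_mem _ c ha

theorem ι_eq_sum_unitElt (g : Gl r) :
    (UniversalEnvelopingAlgebra.ι ℂ g : UGl r) = ∑ i, ∑ j, g i j • unitElt i j := by
  conv_lhs => rw [Matrix.matrix_eq_sum_single g]
  simp only [map_sum]
  refine Finset.sum_congr rfl fun i _ => Finset.sum_congr rfl fun j _ => ?_
  rw [unitElt, ← map_smul, Matrix.smul_single, smul_eq_mul, mul_one]

/-- The spanning half of the triangular decomposition: `g` is commuted to the right through the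
lower triangular factors until the Verma ideal absorbs it or turns it into a scalar. The induction
is over all `g`, since commutators produce new matrices. -/
theorem ι_mul_unitProd_mem_lowerSup (l : List (Fin r × Fin r)) (hl : ∀ p ∈ l, p.2 < p.1)
    (g : Gl r) : UniversalEnvelopingAlgebra.ι ℂ g * unitProd l ∈ lowerSup w := by
  induction l generalizing g with
  | nil =>
    have h1 : (1 : UGl r) ∈ lowerSup w := unitProd_mem_lowerSup w (l := []) (by simp)
    have h2 : (UniversalEnvelopingAlgebra.ι ℂ g : UGl r) * unitProd [] = ∑ i, ∑ j, g i j • unitElt i j := by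
      rw [← ι_eq_sum_unitElt]; simp [unitProd]
    rw [h2]
    refine Submodule.sum_mem _ fun i _ => Submodule.sum_mem _ fun j _ => Submodule.smul_mem _ _ ?_
    rcases lt_trichotomy i j with h | rfl | h
    · exact mem_lowerSup_of_mem w (unitElt_mem_vermaIdeal w h)
    · have h3 := mem_lowerSup_of_mem w (unitElt_sub_mem_vermaIdeal w i)
      have h4 := Submodule.add_mem _ h3 (Submodule.smul_mem _ (w i) h1)
      rwa [← Algebra.algebraMap_eq_smul_one, sub_add_cancel] at h4
    · have := lower_mul_mem_lowerSup w h h1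
      rwa [mul_one] at this
  | cons p l ih =>
    have hl' : ∀ q ∈ l, q.2 < q.1 := fun q hq => hl q (List.mem_cons_of_mem _ hq)
    have h1 : (UniversalEnvelopingAlgebra.ι ℂ g : UGl r) * unitProd (p :: l)
        = UniversalEnvelopingAlgebra.ι ℂ ⁅g, (Matrix.single p.1 p.2 1 : Gl r)⁆ * unitProd l
          + unitElt p.1 p.2 * (UniversalEnvelopingAlgebra.ι ℂ g * unitProd l) := by
      rw [LieHom.map_lie, LieRing.of_associative_ring_bracket]
      simp only [unitProd, unitElt, List.map_cons, List.prod_cons]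
      noncomm_ring
    rw [h1]
    exact Submodule.add_mem _ (ih hl' _)
      (lower_mul_mem_lowerSup w (hl p List.mem_cons_self) (ih hl' g))

/-- The elements whose left multiplication preserves `lowerSup` form a subalgebra that contains the
Lie algebra, hence everything; apply this to 1. -/
theorem mem_lowerSup (u : UGl r) : u ∈ lowerSup w := by
  let T : Subalgebra ℂ (UGl r) :=
    { carrier := {u | ∀ a ∈ lowerSup w, u * a ∈ lowerSup w}
      mul_mem' := fun {x y} hx hy a ha => by rw [mul_assoc]; exact hx _ (hy _ ha)
      add_mem' := fun {x y} hx hy a ha => by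
        rw [add_mul]; exact Submodule.add_mem _ (hx _ ha) (hy _ ha)
      algebraMap_mem' := fun c a ha => by
        rw [← Algebra.smul_def]; exact Submodule.smul_mem _ c ha }
  have h1 : (1 : UGl r) ∈ lowerSup w := unitProd_mem_lowerSup w (l := []) (by simp)
  have hT : u ∈ T := by
    refine mem_subalgebra_of_ι_mem T (fun g a ha => ?_) u
    refine lowerSup_induction w (P := fun a => UniversalEnvelopingAlgebra.ι ℂ g * a ∈ lowerSup w)
      (fun l hl => ι_mul_unitProd_mem_lowerSup w l hl g)
      (fun u hu => mem_lowerSup_of_mem w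
        (Submodule.smul_mem _ (UniversalEnvelopingAlgebra.ι ℂ g : UGl r) hu))
      (fun a b ha hb => ?_) (fun c a ha => ?_) ha
    · rw [mul_add]; exact Submodule.add_mem _ ha hb
    · rw [mul_smul_comm]; exact Submodule.smul_mem _ c ha
  have := hT 1 h1
  rwa [mul_one] at this

/-- The diagonal matrix that grades `U(gl_r)` by height. -/
def heightMat (r : ℕ) : Gl r := Matrix.diagonal fun i => -((i : ℕ) : ℂ)

/-- The image of `heightMat` in `U(gl_r)`. -/
def heightElt (r : ℕ) : UGl r := UniversalEnvelopingAlgebra.ι ℂ (heightMat r)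

/-- The value of `heightMat` at a weight. -/
def heightVal : ℂ := ∑ i : Fin r, -((i : ℕ) : ℂ) * w i

theorem heightElt_sub_mem : heightElt r - algebraMap ℂ _ (heightVal w) ∈ vermaIdeal r w := by
  have h : heightElt r - algebraMap ℂ (UGl r) (heightVal w)
      = ∑ i : Fin r, algebraMap ℂ (UGl r) (-((i : ℕ) : ℂ)) * (unitElt i i - algebraMap ℂ _ (w i)) := by
    rw [heightElt, ι_eq_sum_unitElt, heightVal, map_sum (algebraMap ℂ (UGl r)), ← Finset.sum_sub_distrib]
    refine Finset.sum_congr rfl fun i _ => ?_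
    rw [Finset.sum_eq_single i, mul_sub, ← map_mul, Algebra.smul_def, heightMat,
      Matrix.diagonal_apply_eq]
    · intro j _ hj
      rw [heightMat, Matrix.diagonal_apply_ne' _ hj, zero_smul]
    · simp
  rw [h]
  exact Submodule.sum_mem _ fun i _ => Submodule.smul_mem _ (algebraMap ℂ (UGl r) (-((i : ℕ) : ℂ)))
    (unitElt_sub_mem_vermaIdeal w i)

/-- The height of a product of matrix units. -/
def unitHeight (l : List (Fin r × Fin r)) : ℂ := (l.map fun p => ((p.1 : ℕ) : ℂ) - ((p.2 : ℕ) : ℂ)).sum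

/-- Modulo the Verma ideal a product of matrix units is an eigenvector of the height element:
commuting past `E_ij` changes the eigenvalue by `-(i - j)`. -/
theorem heightElt_sub_mul_unitProd (l : List (Fin r × Fin r)) :
    (heightElt r - algebraMap ℂ _ (heightVal w - unitHeight l)) * unitProd l ∈ vermaIdeal r w := by
  induction l with
  | nil => simpa [unitHeight, unitProd] using heightElt_sub_mem w
  | cons p l ih =>
    have hbr : heightElt r * unitElt p.1 p.2 = unitElt p.1 p.2 * heightElt r
        - algebraMap ℂ (UGl r) (((p.1 : ℕ) : ℂ) - ((p.2 : ℕ) : ℂ)) * unitElt p.1 p.2 := by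
      have h1 : ⁅heightMat r, (Matrix.single p.1 p.2 1 : Gl r)⁆
          = (-(((p.1 : ℕ) : ℂ) - ((p.2 : ℕ) : ℂ))) • (Matrix.single p.1 p.2 1 : Gl r) := by
        rw [LieRing.of_associative_ring_bracket, heightMat]
        ext a b
        simp only [Matrix.sub_apply, Matrix.diagonal_mul, Matrix.mul_diagonal, Matrix.single_apply,
          Matrix.smul_apply, smul_eq_mul]
        split_ifs with h
        · rw [← h.1, ← h.2]; ring
        · ring
      have h2 := congrArg (UniversalEnvelopingAlgebra.ι ℂ) h1
      rw [LieHom.map_lie, LieRing.of_associative_ring_bracket, map_smul] at h2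
      change heightElt r * unitElt p.1 p.2 - unitElt p.1 p.2 * heightElt r = _ • unitElt p.1 p.2 at h2
      rw [neg_smul, sub_eq_iff_eq_add] at h2
      rw [h2, Algebra.smul_def]
      abel
    have h3 : (heightElt r - algebraMap ℂ (UGl r) (heightVal w - unitHeight (p :: l))) * unitProd (p :: l)
        = unitElt p.1 p.2 *
          ((heightElt r - algebraMap ℂ (UGl r) (heightVal w - unitHeight l)) * unitProd l) := by
      have h4 : unitProd (p :: l) = unitElt p.1 p.2 * unitProd l := by simp [unitProd]
      have h5 : heightVal w - unitHeight (p :: l)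
          = heightVal w - unitHeight l - (((p.1 : ℕ) : ℂ) - ((p.2 : ℕ) : ℂ)) := by
        simp [unitHeight]; ring
      rw [h4, h5, map_sub (algebraMap ℂ (UGl r)) (heightVal w - unitHeight l), ← mul_assoc, sub_mul,
        hbr, sub_mul (algebraMap ℂ (UGl r) _), Algebra.commutes (heightVal w - unitHeight l)]
      noncomm_ring
    rw [h3]
    exact Submodule.smul_mem _ (unitElt p.1 p.2) ih

theorem aeval_heightElt_sub_mem (q : Polynomial ℂ) :
    Polynomial.aeval (heightElt r) q - algebraMap ℂ _ (q.eval (heightVal w)) ∈ vermaIdeal r w := by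
  obtain ⟨s, hs⟩ := Polynomial.X_sub_C_dvd_sub_C_eval (a := heightVal w) (p := q)
  have h := congrArg (Polynomial.aeval (heightElt r)) hs
  rw [mul_comm, map_mul, map_sub, map_sub, Polynomial.aeval_C, Polynomial.aeval_C,
    Polynomial.aeval_X] at h
  rw [h]
  exact Submodule.smul_mem _ _ (heightElt_sub_mem w)

/-- A polynomial in the height element isolates the highest weight component of `u` modulo the Verma
ideal. This replaces the weight decomposition of the Verma module. -/
theorem exists_aeval_mul_sub_mem (u : UGl r) : ∃ q : Polynomial ℂ, q.eval (heightVal w) ≠ 0 ∧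
    ∃ a : ℂ, Polynomial.aeval (heightElt r) q * u - algebraMap ℂ _ a ∈ vermaIdeal r w := by
  refine lowerSup_induction w (P := fun u => ∃ q : Polynomial ℂ, q.eval (heightVal w) ≠ 0 ∧
    ∃ a : ℂ, Polynomial.aeval (heightElt r) q * u - algebraMap ℂ _ a ∈ vermaIdeal r w)
    (fun l hl => ?_) (fun u hu => ⟨1, by simp, 0, by simpa using hu⟩) ?_ ?_ (mem_lowerSup w u)
  · rcases eq_or_ne l [] with rfl | hne
    · exact ⟨1, by simp, 1, by simp [unitProd]⟩
    -- This polynomial kills the given product. Its value at the highest weight is the height of the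
    -- product, a positive integer because every factor is strictly lower triangular.
    · refine ⟨Polynomial.X - Polynomial.C (heightVal w - unitHeight l), ?_, 0, ?_⟩
      · have h1 : unitHeight l = (((l.map fun p => (p.1 : ℕ) - (p.2 : ℕ)).sum : ℕ) : ℂ) := by
          rw [unitHeight, Nat.cast_list_sum, List.map_map]
          congr 1
          refine List.map_congr_left fun p hp => ?_
          rw [Function.comp_apply, Nat.cast_sub (hl p hp).le]
        have h2 : 0 < (l.map fun p => (p.1 : ℕ) - (p.2 : ℕ)).sum := by
          obtain ⟨p, l', rfl⟩ := List.exists_cons_of_ne_nil hne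
          have := hl p List.mem_cons_self
          rw [List.map_cons, List.sum_cons]
          have h3 : (p.2 : ℕ) < p.1 := this
          omega
        rw [Polynomial.eval_sub, Polynomial.eval_X, Polynomial.eval_C, sub_sub_cancel, h1]
        exact Nat.cast_ne_zero.2 h2.ne'
      · rw [map_zero, sub_zero, map_sub, Polynomial.aeval_X, Polynomial.aeval_C]
        exact heightElt_sub_mul_unitProd w l
  · rintro x y ⟨q, hq, a, ha⟩ ⟨q', hq', a', ha'⟩
    -- Each polynomial isolates the component of its own summand and acts on the scalar left by the
    -- other through its value at the highest weight.
    refine ⟨q * q', by simp [hq, hq'], q'.eval (heightVal w) * a + q.eval (heightVal w) * a', ?_⟩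
    have h1 := Submodule.smul_mem _ (Polynomial.aeval (heightElt r) q') ha
    have h2 := Submodule.smul_mem _ (Polynomial.aeval (heightElt r) q) ha'
    have h3 := Submodule.smul_mem _ (algebraMap ℂ (UGl r) a) (aeval_heightElt_sub_mem w q')
    have h4 := Submodule.smul_mem _ (algebraMap ℂ (UGl r) a') (aeval_heightElt_sub_mem w q)
    have h5 := Submodule.add_mem _ (Submodule.add_mem _ h1 h2) (Submodule.add_mem _ h3 h4)
    have hc : Polynomial.aeval (heightElt r) q' * Polynomial.aeval (heightElt r) q
        = Polynomial.aeval (heightElt r) q * Polynomial.aeval (heightElt r) q' := by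
      rw [← map_mul, ← map_mul, mul_comm]
    convert! h5 using 1
    simp only [smul_eq_mul, map_mul, map_add, mul_sub, mul_add]
    rw [Algebra.commutes a, Algebra.commutes a', Algebra.commutes a, Algebra.commutes a', ← mul_assoc,
      ← mul_assoc, hc]
    abel
  · rintro c x ⟨q, hq, a, ha⟩
    refine ⟨q, hq, c * a, ?_⟩
    have h1 := Submodule.smul_mem _ (algebraMap ℂ (UGl r) c) ha
    rw [smul_eq_mul, mul_sub, ← map_mul, ← Algebra.smul_def] at h1
    rwa [mul_smul_comm]

variable {w} {M : Type} [AddCommGroup M] [Module ℂ M] [LieRingModule (Gl r) M]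
  [LieModule ℂ (Gl r) M]

/-- The annihilator of a vector in `U(gl_r)`. -/
def glAnn (v : M) : Submodule (UGl r) (UGl r) where
  carrier := {u | glAction r M u v = 0}
  zero_mem' := by simp
  add_mem' := fun {a b} ha hb => by
    change glAction r M (a + b) v = 0
    rw [map_add, LinearMap.add_apply, ha, hb, add_zero]
  smul_mem' := fun c a ha => by
    change glAction r M (c * a) v = 0
    rw [map_mul, Module.End.mul_apply, ha, map_zero]

theorem mem_glAnn {v : M} {u : UGl r} : u ∈ glAnn v ↔ glAction r M u v = 0 := Iff.rfl

theorem vermaIdeal_le_glAnn {v : M} (hw : v ∈ weightSubspace r M w)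
    (hup : ∀ i j : Fin r, i < j → ⁅(Matrix.single i j 1 : Gl r), v⁆ = 0) :
    vermaIdeal r w ≤ glAnn v := by
  refine Submodule.span_le.2 ?_
  rintro _ (⟨i, j, hij, rfl⟩ | ⟨i, rfl⟩)
  · change glAction r M _ v = 0
    rw [glAction_ι, LieModule.toEnd_apply_apply, hup i j hij]
  · change glAction r M _ v = 0
    rw [map_sub, LinearMap.sub_apply, glAction_ι, LieModule.toEnd_apply_apply, hw i, AlgHom.commutes,
      Module.algebraMap_end_apply, sub_self]

/-- The annihilator of `v` is a proper left ideal containing the Verma ideal. Every other such ideal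
lies inside it: an element that does not annihilate `v` could be multiplied, by irreducibility, to
one that fixes `v`, and isolating its highest weight component would put a nonzero scalar into the
ideal. -/
theorem maxVermaIdeal_eq_glAnn {v : M} (hv : v ≠ 0) (hw : v ∈ weightSubspace r M w)
    (hup : ∀ i j : Fin r, i < j → ⁅(Matrix.single i j 1 : Gl r), v⁆ = 0)
    (hirr : ∀ m : M, m ≠ 0 → ∀ m', ∃ u, glAction r M u m = m') :
    maxVermaIdeal r w = glAnn v := by
  have hle := vermaIdeal_le_glAnn hw hup
  refine le_antisymm (sSup_le ?_) (le_sSup ⟨hle, fun h => hv ?_⟩)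
  · rintro J ⟨hJ, hJt⟩ u hu
    by_contra hu0
    obtain ⟨u', hu'⟩ := hirr _ hu0 v
    have hx : u' * u ∈ J := Submodule.smul_mem _ u' hu
    have hxv : glAction r M (u' * u) v = v := by rw [map_mul, Module.End.mul_apply, hu']
    obtain ⟨q, hq, a, ha⟩ := exists_aeval_mul_sub_mem w (u' * u)
    -- As `J` is proper, this scalar must be 0. Then `q` of the height element annihilates `v`,
    -- although it acts there by the nonzero value of `q` at the highest weight.
    have h1 : algebraMap ℂ (UGl r) a ∈ J := by
      have := Submodule.sub_mem _ (Submodule.smul_mem _ (Polynomial.aeval (heightElt r) q) hx) (hJ ha)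
      rwa [smul_eq_mul, sub_sub_cancel] at this
    have ha0 : a = 0 := by
      by_contra ha0
      apply hJt
      rw [Submodule.eq_top_iff']
      intro y
      have h2 := Submodule.smul_mem _ (y * algebraMap ℂ (UGl r) a⁻¹) h1
      rwa [smul_eq_mul, mul_assoc, ← map_mul, inv_mul_cancel₀ ha0, map_one, mul_one] at h2
    rw [ha0, map_zero, sub_zero] at ha
    have h3 := mem_glAnn.1 (hle ha)
    have h4 := mem_glAnn.1 (hle (aeval_heightElt_sub_mem w q))
    rw [map_mul, Module.End.mul_apply, hxv] at h3
    rw [map_sub, LinearMap.sub_apply, h3, zero_sub, neg_eq_zero, AlgHom.commutes,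
      Module.algebraMap_end_apply] at h4
    exact hv ((smul_eq_zero.1 h4).resolve_left hq)
  · have h1 : (1 : UGl r) ∈ glAnn v := by rw [h]; trivial
    have h2 := mem_glAnn.1 h1
    rwa [map_one, Module.End.one_apply] at h2

/-- The map `u ↦ u v` is onto by irreducibility, and its kernel is the maximal ideal, so it descends
to an isomorphism from `IrrGl`. -/
theorem ch_irrGl {v : M} (hv : v ≠ 0) (hw : v ∈ weightSubspace r M w)
    (hup : ∀ i j : Fin r, i < j → ⁅(Matrix.single i j 1 : Gl r), v⁆ = 0)
    (hirr : ∀ m : M, m ≠ 0 → ∀ m', ∃ u, glAction r M u m = m') :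
    ch r (IrrGl r w) = ch r M := by
  have hmax := maxVermaIdeal_eq_glAnn hv hw hup hirr
  let _ : Module (UGl r) M := Module.compHom M (glAction r M).toRingHom
  have hsm : ∀ (u : UGl r) (m : M), u • m = glAction r M u m := fun _ _ => rfl
  let φ : UGl r →ₗ[UGl r] M := LinearMap.toSpanSingleton (UGl r) M v
  have hφ : ∀ u, φ u = glAction r M u v := fun _ => rfl
  have hle : maxVermaIdeal r w ≤ LinearMap.ker φ := by rw [hmax]; exact fun u hu => hu
  let f : (UGl r ⧸ maxVermaIdeal r w) →ₗ[UGl r] M := (maxVermaIdeal r w).liftQ φ hle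
  have hfm : ∀ u, f (Submodule.Quotient.mk u) = glAction r M u v := fun u =>
    (Submodule.liftQ_apply _ _ _).trans (hφ u)
  have hbij : Function.Bijective f := by
    constructor
    · rw [injective_iff_map_eq_zero]
      intro y hy
      obtain ⟨u, rfl⟩ := Submodule.Quotient.mk_surjective _ y
      rw [hfm] at hy
      rw [Submodule.Quotient.mk_eq_zero, hmax]
      exact hy
    · intro m
      obtain ⟨u, hu⟩ := hirr v hv m
      exact ⟨Submodule.Quotient.mk u, by rw [hfm, hu]⟩
  let e : IrrGl r w ≃ₗ[ℂ] M := LinearEquiv.ofBijective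
    ({ toFun := f
       map_add' := map_add f
       map_smul' := fun c y => by
        obtain ⟨u, rfl⟩ := Submodule.Quotient.mk_surjective _ y
        change f (Submodule.Quotient.mk (c • u)) = c • f (Submodule.Quotient.mk u)
        rw [hfm, hfm, map_smul, LinearMap.smul_apply] } : IrrGl r w →ₗ[ℂ] M) hbij
  refine ch_congr e fun g y => ?_
  obtain ⟨u, rfl⟩ := Submodule.Quotient.mk_surjective _ y
  change f (Submodule.Quotient.mk ((UniversalEnvelopingAlgebra.ι ℂ g : UGl r) * u))
    = ⁅g, f (Submodule.Quotient.mk u)⁆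
  rw [hfm, hfm, map_mul, Module.End.mul_apply, glAction_ι]
  rfl

end IrrHighestWeight

/-! ### Images of Young symmetrizers and the Frobenius map -/

section Frobenius

variable {r n : ℕ}

theorem glAction_youngImage_coe {p : n.Partition} (u : UGl r) (m : youngImage r p) :
    (glAction r (youngImage r p) u m : TensorPow r n) = glAction r (TensorPow r n) u m := by
  let T : Subalgebra ℂ (UGl r) :=
    { carrier := {u | ∀ m : youngImage r p,
        (glAction r (youngImage r p) u m : TensorPow r n) = glAction r (TensorPow r n) u m}
      mul_mem' := fun {x y} hx hy m => by
        rw [map_mul, map_mul, Module.End.mul_apply, Module.End.mul_apply, hx, hy]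
      add_mem' := fun {x y} hx hy m => by
        rw [map_add, map_add, LinearMap.add_apply, LinearMap.add_apply, LieSubmodule.coe_add, hx, hy]
      algebraMap_mem' := fun c m => by
        rw [AlgHom.commutes, AlgHom.commutes]
        rfl }
  refine mem_subalgebra_of_ι_mem T (fun g m => ?_) u m
  rw [glAction_ι, glAction_ι]
  rfl

theorem ch_irrGl_partWeight (p : n.Partition) (hp : part p r = 0) :
    ch r (IrrGl r (partWeight r p).1) = ch r (youngImage r p) := by
  refine ch_irrGl (v := (⟨highestVec p hp, highestVec_mem_youngImage p hp⟩ : youngImage r p))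
    (fun h => highestVec_ne_zero p hp (congrArg Subtype.val h))
    (fun i => Subtype.ext (highestVec_mem_weightSubspace p hp i))
    (fun i j hij => Subtype.ext (lie_highestVec p hp hij)) fun m hm m' => ?_
  obtain ⟨u, hu⟩ := exists_glAction_youngImage m.2 m'.2 fun h => hm (Subtype.ext h)
  exact ⟨u, Subtype.ext (by rw [glAction_youngImage_coe, hu])⟩

theorem ch_youngImage (p : n.Partition) : ch r (youngImage r p)
    = grothendieckCh r (if part p r = 0 then Finsupp.single (partWeight r p) 1 else 0) := by
  split_ifs with hp
  · rw [grothendieckCh, Finsupp.linearCombination_single, one_smul, ch_irrGl_partWeight p hp]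
  · rw [map_zero]
    ext η
    have h : Subsingleton (youngImage r p) := by
      rw [youngImage_eq_bot p hp]
      infer_instance
    rw [coeff_ch, Module.finrank_zero_of_subsingleton]
    simp

/-- The character of `(V_r^{⊗ n} ⊗ W)^{Σ_n}` through the Frobenius map. -/
theorem ch_tensorInvariants_eq_frobenius {W : Type} [AddCommGroup W] [Module ℂ W]
    [FiniteDimensional ℂ W] (τ : Representation ℂ (Equiv.Perm (Fin n)) W) :
    ch r (tensorInvariants r n τ) = grothendieckCh r (frobeniusMap n r (symClass τ)) := by
  rw [ch_tensorInvariants, frobeniusMap, Finsupp.linearCombination_apply,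
    Finsupp.sum_fintype _ _ (by simp), map_sum]
  refine Finset.sum_congr rfl fun p _ => ?_
  rw [ch_youngImage, map_smul]
  rfl

end Frobenius
/-! ### Parking functions and dominated sets of boxes -/

section Parking

theorem expPartition_succ (b : ℕ) (η : ℕ → ℕ) :
    expPartition (b + 1) η = List.replicate (η (b + 1)) (b + 1) ++ expPartition b η := by
  simp [expPartition, List.range_succ]

theorem length_expPartition (b : ℕ) (η : ℕ → ℕ) :
    (expPartition b η).length = ∑ i ∈ Finset.Icc 1 b, η i := by
  induction b with
  | zero => simp [expPartition]
  | succ b ih =>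
    rw [expPartition_succ, List.length_append, List.length_replicate, ih,
      Finset.sum_Icc_succ_top (by omega), add_comm]

theorem sum_expPartition (b : ℕ) (η : ℕ → ℕ) :
    (expPartition b η).sum = ∑ i ∈ Finset.Icc 1 b, i * η i := by
  induction b with
  | zero => simp [expPartition]
  | succ b ih =>
    rw [expPartition_succ, List.sum_append, List.sum_replicate, ih,
      Finset.sum_Icc_succ_top (by omega), add_comm, smul_eq_mul, mul_comm]

/-- Read from the end, the list is increasing and constant on the block of each `j`. Within a block
the condition is strongest at the last `s`, which is the sum of the `η i` with `i ≤ j`. The list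
counts from 0, so `ρ_{k-s+1}` is its entry at `k - s`. -/
theorem expPartition_condition_iff (b : ℕ) (η : ℕ → ℕ) {c : ℕ → ℕ} (hc : Monotone c) :
    (∀ s, 1 ≤ s → s ≤ (expPartition b η).length →
        s ≤ c ((expPartition b η).getD ((expPartition b η).length - s) 0)) ↔
      ∀ j ≤ b, ∑ i ∈ Finset.Icc 1 j, η i ≤ c j := by
  induction b with
  | zero =>
    simp only [expPartition]
    constructor
    · intro _ j hj
      obtain rfl : j = 0 := by omega
      simp
    · intro _ s h1 h2
      simp at h2
      omega
  | succ b ih =>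
    have hlow : ∀ s, s ≤ (expPartition b η).length →
        (expPartition (b + 1) η).getD ((expPartition (b + 1) η).length - s) 0
          = (expPartition b η).getD ((expPartition b η).length - s) 0 := by
      intro s hs
      rw [expPartition_succ, List.getD_append_right _ _ _ _ (by simp; omega)]
      congr 1
      simp
      omega
    have hhigh : ∀ s, (expPartition b η).length < s → s ≤ (expPartition (b + 1) η).length →
        (expPartition (b + 1) η).getD ((expPartition (b + 1) η).length - s) 0 = b + 1 := by
      intro s h1 h2
      rw [expPartition_succ] at h2 ⊢
      rw [List.length_append, List.length_replicate] at h2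
      rw [List.getD_append _ _ _ _ (by simp; omega), List.getD_replicate _ (by simp; omega)]
    have hlen : (expPartition (b + 1) η).length = (expPartition b η).length + η (b + 1) := by
      rw [expPartition_succ, List.length_append, List.length_replicate, add_comm]
    have hsum : ∑ i ∈ Finset.Icc 1 (b + 1), η i = (expPartition b η).length + η (b + 1) := by
      rw [Finset.sum_Icc_succ_top (by omega), length_expPartition]
    constructor
    · intro h j hj
      have hb := ih.1 fun s h1 h2 => by
        have := h s h1 (by omega)
        rwa [hlow s h2] at this
      rcases Nat.lt_or_eq_of_le hj with hj | rfl
      · exact hb j (by omega)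
      · rw [hsum]
        -- An empty top block imposes no condition of its own; monotonicity of `c` carries over the
        -- bound at `b`.
        rcases Nat.eq_zero_or_pos (η (b + 1)) with h0 | h0
        · rw [h0, add_zero, length_expPartition]
          exact (hb b le_rfl).trans (hc (Nat.le_succ b))
        · have := h _ (by omega) hlen.ge
          rwa [hhigh _ (by omega) hlen.ge] at this
    · intro h s h1 h2
      by_cases hs : s ≤ (expPartition b η).length
      · rw [hlow s hs]
        exact ih.2 (fun j hj => h j (by omega)) s h1 hs
      · rw [hhigh s (by omega) h2]
        exact h2.trans (by rw [hlen, ← hsum]; exact h _ le_rfl)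

variable {r : ℕ} (ξ : Fin r → ℕ)

theorem sum_transposePart (s : ℕ) :
    ∑ i ∈ Finset.Icc 1 s, transposePart ξ i = ∑ j, min (ξ j) s := by
  simp only [transposePart, Finset.card_filter]
  rw [Finset.sum_comm]
  refine Finset.sum_congr rfl fun j _ => ?_
  rw [← Finset.card_filter]
  have : (Finset.Icc 1 s).filter (fun i => i ≤ ξ j) = Finset.Icc 1 (min (ξ j) s) := by
    ext i
    simp only [Finset.mem_filter, Finset.mem_Icc, le_min_iff]
    tauto
  rw [this, Nat.card_Icc, Nat.add_sub_cancel]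

theorem sum_min_of_le {s : ℕ} (hs : ∑ j, ξ j ≤ s) : ∑ j, min (ξ j) s = ∑ j, ξ j :=
  Finset.sum_congr rfl fun j _ => min_eq_left
    ((Finset.single_le_sum (f := ξ) (fun _ _ => Nat.zero_le _) (Finset.mem_univ j)).trans hs)

/-- `e` has at least as many entries in each of the first rows as the cyclic vector. -/
def Dominated {n : ℕ} (p : Fin n → ℕ) : Prop :=
  ∀ s, ∑ j, min (ξ j) s ≤ (Finset.univ.filter fun k => p k ≤ s).card

/-- The partial sums of the transposed partition count the boxes of the cyclic vector in the first
`s` rows. For `s` beyond `n` both conditions hold trivially, because the values of `f` are at most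
`n`. -/
theorem isParking_rhoPartition_iff (f : Fin (∑ j, ξ j) → Finset.Icc 1 (∑ j, ξ j)) :
    IsParking _ (rhoPartition ξ) f ↔ Dominated ξ fun k => (f k : ℕ) := by
  have hmono : Monotone fun s => (Finset.univ.filter fun k => (f k : ℕ) ≤ s).card := fun s t hst =>
    Finset.card_le_card fun k => by
      simp only [Finset.mem_filter]
      exact fun h => ⟨h.1, h.2.trans hst⟩
  have h := expPartition_condition_iff (∑ j, ξ j) (transposePart ξ) hmono
  refine h.trans ⟨fun h s => ?_, fun h s _ => ?_⟩
  · rcases le_or_gt s (∑ j, ξ j) with hs | hs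
    · rw [← sum_transposePart]
      exact h s hs
    · rw [sum_min_of_le ξ hs.le]
      have : (Finset.univ.filter fun k => (f k : ℕ) ≤ s) = Finset.univ :=
        Finset.filter_true_of_mem fun k _ => (Finset.mem_Icc.1 (f k).2).2.trans hs.le
      rw [this, Finset.card_univ, Fintype.card_fin]
  · rw [sum_transposePart]
    exact h s

/-- At `s = n` the required count is all of `n`. This gives the upper bound on the values of a
parking function, and finiteness of the set of dominated monomials. -/
theorem Dominated.le {p : Fin (∑ j, ξ j) → ℕ} (h : Dominated ξ p) (k : Fin (∑ j, ξ j)) :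
    p k ≤ ∑ j, ξ j := by
  have h1 := h (∑ j, ξ j)
  rw [sum_min_of_le ξ le_rfl] at h1
  have h2 : (Finset.univ.filter fun k => p k ≤ ∑ j, ξ j) = Finset.univ :=
    Finset.eq_univ_of_card _ (le_antisymm (Finset.card_le_univ _) (by simpa using h1))
  have h3 : k ∈ Finset.univ.filter fun k => p k ≤ ∑ j, ξ j := by rw [h2]; simp
  exact (Finset.mem_filter.1 h3).2

theorem Dominated.mono {n : ℕ} {p q : Fin n → ℕ} (h : Dominated ξ p) (hq : ∀ k, q k ≤ p k) :
    Dominated ξ q := fun s => (h s).trans (Finset.card_le_card fun k => by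
      simp only [Finset.mem_filter]
      exact fun h => ⟨h.1, (hq k).trans h.2⟩)

theorem parkingDeg_rhoPartition (f : Fin (∑ j, ξ j) → Finset.Icc 1 (∑ j, ξ j)) :
    parkingDeg (rhoPartition ξ) f
      = ∑ i ∈ Finset.Icc 1 (∑ j, ξ j), (i : ℤ) * transposePart ξ i - ∑ k, ((f k : ℕ) : ℤ) := by
  rw [parkingDeg, rhoPartition, sum_expPartition]
  push_cast
  rfl

/-- The boxes that occur in the cyclic vector, indexed by column and position. -/
def columnBox (x : (j : Fin r) × Fin (ξ j)) : ℕ+ × Fin r :=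
  (⟨ξ x.1 - x.2, Nat.sub_pos_of_lt x.2.2⟩, x.1)

theorem columnBox_injective : Function.Injective (columnBox ξ) := by
  rintro ⟨a, i⟩ ⟨b, j⟩ h
  obtain rfl : a = b := congrArg Prod.snd h
  have h3 : ξ a - (i : ℕ) = ξ a - (j : ℕ) := congrArg (fun x : ℕ+ × Fin r => (x.1 : ℕ)) h
  have h4 : i = j := by ext; omega
  rw [h4]

/-- The boxes that occur in the cyclic vector. -/
def cyclicEnum (k : Fin (∑ j, ξ j)) : ℕ+ × Fin r := columnBox ξ (finSigmaFinEquiv.symm k)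

theorem cyclicEnum_injective : Function.Injective (cyclicEnum ξ) :=
  (columnBox_injective ξ).comp finSigmaFinEquiv.symm.injective

theorem card_cyclicEnum (s : ℕ) :
    (Finset.univ.filter fun k => ((cyclicEnum ξ k).1 : ℕ) ≤ s).card = ∑ j, min (ξ j) s := by
  rw [Finset.card_filter, ← Equiv.sum_comp finSigmaFinEquiv]
  simp only [cyclicEnum, Equiv.symm_apply_apply]
  rw [Fintype.sum_sigma]
  refine Finset.sum_congr rfl fun j _ => ?_
  change ∑ i : Fin (ξ j), (if ξ j - (i : ℕ) ≤ s then 1 else 0) = _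
  rw [Fin.sum_univ_eq_sum_range (fun i => if ξ j - i ≤ s then 1 else 0), ← Finset.card_filter]
  have : (Finset.range (ξ j)).filter (fun i => ξ j - i ≤ s) = Finset.Ico (ξ j - s) (ξ j) := by
    ext i
    simp only [Finset.mem_filter, Finset.mem_range, Finset.mem_Ico]
    omega
  rw [this, Nat.card_Ico]
  omega

theorem dominated_cyclicEnum : Dominated ξ fun k => ((cyclicEnum ξ k).1 : ℕ) :=
  fun s => (card_cyclicEnum ξ s).ge

theorem cyclicVec_eq (N : ℤ) : cyclicVec ξ N = monomialVec N (cyclicEnum ξ) := by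
  unfold cyclicVec monomialVec
  congr 1
  funext k
  have h : N - (ξ (finSigmaFinEquiv.symm k).1 : ℤ) + ((finSigmaFinEquiv.symm k).2 : ℕ)
      = N - (((cyclicEnum ξ k).1 : ℕ) : ℤ) := by
    change _ = N - ((ξ (finSigmaFinEquiv.symm k).1 - (finSigmaFinEquiv.symm k).2 : ℕ) : ℤ)
    rw [Nat.cast_sub (finSigmaFinEquiv.symm k).2.2.le]
    ring
  exact congrArg (fun i => uVec N i (finSigmaFinEquiv.symm k).1) h

end Parking

/-! ### The exchange step for dominated sets -/

section Exchange

variable {α : Type*} [DecidableEq α] (h : α → ℕ)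

theorem card_filter_sdiff_le {H₀ H : Finset α} {s : ℕ} :
    (H₀.filter (h · ≤ s)).card ≤ (H.filter (h · ≤ s)).card ↔
      ((H₀ \ H).filter (h · ≤ s)).card ≤ ((H \ H₀).filter (h · ≤ s)).card := by
  have h1 : ∀ A B : Finset α, (A.filter (h · ≤ s)).card
      = ((A \ B).filter (h · ≤ s)).card + ((A ∩ B).filter (h · ≤ s)).card := by
    intro A B
    rw [← Finset.card_union_of_disjoint, ← Finset.filter_union, Finset.sdiff_union_inter]
    exact Finset.disjoint_filter_filter (Finset.disjoint_sdiff_inter A B)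
  rw [h1 H₀ H, h1 H H₀, Finset.inter_comm H H₀]
  exact Nat.add_le_add_iff_right

/-- The exchange step between a finite set and a set that dominates it. -/
theorem exists_exchange {H₀ H : Finset α}
    (hdom : ∀ s, (H₀.filter (h · ≤ s)).card ≤ (H.filter (h · ≤ s)).card)
    (hne : (H₀ \ H).Nonempty) :
    ∃ x ∈ H₀ \ H, ∃ y ∈ H \ H₀, h y ≤ h x ∧
      ∀ s, ((insert y (H₀.erase x)).filter (h · ≤ s)).card ≤ (H.filter (h · ≤ s)).card := by
  -- Take `x` lowest among the elements to be removed. Domination at the height of `x` then provides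
  -- an element of `H \ H₀` that is no higher.
  obtain ⟨x, hx, hmin⟩ := Finset.exists_min_image (H₀ \ H) h hne
  have h1 := (card_filter_sdiff_le h).1 (hdom (h x))
  have h2 : 0 < ((H₀ \ H).filter (h · ≤ h x)).card :=
    Finset.card_pos.2 ⟨x, Finset.mem_filter.2 ⟨hx, le_rfl⟩⟩
  obtain ⟨y, hy⟩ := Finset.card_pos.1 (h2.trans_le h1)
  obtain ⟨hy, hyx⟩ := Finset.mem_filter.1 hy
  refine ⟨x, hx, y, hy, hyx, fun s => ?_⟩
  obtain ⟨hx0, hxH⟩ := Finset.mem_sdiff.1 hx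
  obtain ⟨hyH, hy0⟩ := Finset.mem_sdiff.1 hy
  by_cases hs : h x ≤ s
  · refine le_trans (le_of_eq ?_) (hdom s)
    rw [Finset.filter_insert, if_pos (hyx.trans hs), Finset.filter_erase,
      Finset.card_insert_of_notMem, Finset.card_erase_of_mem, Nat.sub_add_cancel]
    · exact Finset.card_pos.2 ⟨x, Finset.mem_filter.2 ⟨hx0, hs⟩⟩
    · exact Finset.mem_filter.2 ⟨hx0, hs⟩
    · simp [hy0]
  -- Below the height of `x` the exchanged set has no elements outside `H`, by minimality of `x`.
  · refine (card_filter_sdiff_le h).2 ?_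
    rw [Finset.card_eq_zero.2]
    · exact Nat.zero_le _
    · refine Finset.filter_eq_empty_iff.2 fun z hz hzs => ?_
      obtain ⟨hz1, hz2⟩ := Finset.mem_sdiff.1 hz
      rcases Finset.mem_insert.1 hz1 with rfl | hz1
      · exact hz2 hyH
      · have := hmin z (Finset.mem_sdiff.2 ⟨Finset.mem_of_mem_erase hz1, hz2⟩)
        omega

end Exchange
/-! ### The action of `𝒢_r` on monomials -/

section Monomials

variable {r n : ℕ} {N : ℤ}

/-- The class of `x^i` in `ℂ[x, x⁻¹] / x^N ℂ[x]`. -/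
def powClass (N i : ℤ) : LQuot N := Submodule.Quotient.mk (LaurentPolynomial.T i)

theorem powClass_eq_zero {i : ℤ} (h : N ≤ i) : powClass N i = 0 :=
  (Submodule.Quotient.mk_eq_zero (xPow N)).2 (Submodule.subset_span ⟨i, h, rfl⟩)

theorem uVec_eq_single (i : ℤ) (j : Fin r) :
    uVec N i j = (Pi.single (M := fun _ => LQuot N) j (powClass N i) : VN r N) := rfl

theorem uVec_eq_zero {i : ℤ} (h : N ≤ i) (j : Fin r) : uVec N i j = 0 := by
  rw [uVec_eq_single, powClass_eq_zero h]
  exact Pi.single_zero j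

theorem algAction_genX (i : ℤ) : algAction N genX (powClass N i) = powClass N (i + 1) := by
  have h : algAction N genX = quotX N := by
    rw [algAction, genX, RingQuot.liftAlgHom_mkAlgHom_apply, FreeAlgebra.lift_ι_apply]
    rfl
  rw [h, powClass, powClass, ← opX_T]
  rfl

theorem algAction_genY (i : ℤ) : algAction N genY (powClass N i) = (i : ℂ) • powClass N i := by
  have h : algAction N genY = quotY N := by
    rw [algAction, genY, RingQuot.liftAlgHom_mkAlgHom_apply, FreeAlgebra.lift_ι_apply]
    rfl
  have h2 : quotY N (powClass N i) = Submodule.Quotient.mk (opY (LaurentPolynomial.T i)) := rfl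
  rw [h, h2, opY_T]
  rfl

theorem algAction_genX_pow (i : ℤ) (d : ℕ) :
    algAction N (genX ^ d) (powClass N i) = powClass N (i + d) := by
  induction d with
  | zero => simp
  | succ d ih =>
    rw [pow_succ', map_mul, Module.End.mul_apply, ih, algAction_genX]
    congr 1
    push_cast
    ring

theorem algAction_aeval_genY (i : ℤ) (q : Polynomial ℂ) :
    algAction N (Polynomial.aeval genY q) (powClass N i) = q.eval (i : ℂ) • powClass N i := by
  induction q using Polynomial.induction_on' with
  | add p q hp hq =>
    rw [map_add, map_add, LinearMap.add_apply, hp, hq, Polynomial.eval_add, add_smul]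
  | monomial k c =>
    have h : ∀ k : ℕ, algAction N (genY ^ k) (powClass N i) = (i : ℂ) ^ k • powClass N i := by
      intro k
      induction k with
      | zero => simp
      | succ k ih =>
        rw [pow_succ, map_mul, Module.End.mul_apply, algAction_genY, map_smul, ih, smul_smul,
          ← pow_succ']
    rw [Polynomial.aeval_monomial, map_mul, AlgHom.commutes, Module.End.mul_apply,
      Module.algebraMap_end_apply, h, Polynomial.eval_monomial, smul_smul]

theorem apply_mem_of_mem_span {M M' : Type*} [AddCommGroup M] [Module ℂ M] [AddCommGroup M']
    [Module ℂ M'] {s : Set M} {p : Submodule ℂ M'} (f : M →ₗ[ℂ] M') (h : ∀ x ∈ s, f x ∈ p) {x : M}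
    (hx : x ∈ Submodule.span ℂ s) : f x ∈ p :=
  (Submodule.span_le (p := p.comap f)).2 h hx

/-- The span of the classes of `x^k` with `k ≥ i`. -/
def upperSpan (N i : ℤ) : Submodule ℂ (LQuot N) :=
  Submodule.span ℂ {q | ∃ k : ℤ, i ≤ k ∧ q = powClass N k}

/-- The generator `𝒳` raises exponents and `𝒴` preserves them. -/
theorem algAction_mem_upperSpan (a : XYAlg) {i : ℤ} {q : LQuot N} (hq : q ∈ upperSpan N i) :
    algAction N a q ∈ upperSpan N i := by
  obtain ⟨b, rfl⟩ := RingQuot.mkAlgHom_surjective ℂ XYRel a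
  have hgen : ∀ f : Module.End ℂ (LQuot N),
      (∀ k, i ≤ k → f (powClass N k) ∈ upperSpan N i) → ∀ q ∈ upperSpan N i, f q ∈ upperSpan N i := by
    intro f hf q hq
    refine apply_mem_of_mem_span f ?_ hq
    rintro _ ⟨k, hk, rfl⟩
    exact hf k hk
  induction b using FreeAlgebra.induction generalizing q with
  | grade0 c =>
    rw [AlgHom.commutes, AlgHom.commutes]
    exact Submodule.smul_mem _ c hq
  | grade1 x =>
    refine hgen _ (fun k hk => ?_) q hq
    fin_cases x
    · change algAction N genX _ ∈ _
      rw [algAction_genX]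
      exact Submodule.subset_span ⟨k + 1, by omega, rfl⟩
    · change algAction N genY _ ∈ _
      rw [algAction_genY]
      exact Submodule.smul_mem _ _ (Submodule.subset_span ⟨k, hk, rfl⟩)
  | mul a b ha hb =>
    rw [map_mul, map_mul, Module.End.mul_apply]
    exact ha (hb hq)
  | add a b ha hb =>
    rw [map_add, map_add, LinearMap.add_apply]
    exact Submodule.add_mem _ (ha hq) (hb hq)

theorem lie_uVec_apply (g : GXY r) (i : ℤ) (j l : Fin r) :
    (⁅g, uVec N i j⁆ : VN r N) l = algAction N (g l j) (powClass N i) := by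
  change ∑ k, algAction N (g l k) (uVec N i j k) = _
  rw [Finset.sum_eq_single j]
  · rw [uVec_same]; rfl
  · intro k _ hk
    rw [uVec_of_ne N i hk, map_zero]
  · simp

theorem VN_eq_sum_single (v : VN r N) :
    v = ∑ l, (Pi.single (M := fun _ => LQuot N) l (v l) : VN r N) :=
  (Finset.univ_sum_single (M := fun _ : Fin r => LQuot N) v).symm

theorem lie_uVec_mem (g : GXY r) (i : ℤ) (j : Fin r) :
    ⁅g, uVec N i j⁆ ∈ Submodule.span ℂ {v : VN r N | ∃ k : ℤ, ∃ l, i ≤ k ∧ v = uVec N k l} := by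
  rw [VN_eq_sum_single ⁅g, uVec N i j⁆]
  refine Submodule.sum_mem _ fun l _ => ?_
  rw [lie_uVec_apply]
  have h1 : algAction N (g l j) (powClass N i) ∈ upperSpan N i :=
    algAction_mem_upperSpan _ (Submodule.subset_span ⟨i, le_rfl, rfl⟩)
  let f : LQuot N →ₗ[ℂ] VN r N := LinearMap.single ℂ (fun _ : Fin r => LQuot N) l
  refine apply_mem_of_mem_span f ?_ h1
  rintro _ ⟨k, hk, rfl⟩
  exact Submodule.subset_span ⟨k, l, hk, rfl⟩

theorem monomialVec_update (e : Fin n → ℕ+ × Fin r) (k : Fin n) (p : ℕ+) (l : Fin r) :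
    exteriorPower.ιMulti ℂ n (Function.update (fun k => uVec N (N - ((e k).1 : ℕ)) (e k).2) k
      (uVec N (N - (p : ℕ)) l)) = monomialVec N (Function.update e k (p, l)) := by
  unfold monomialVec
  congr 1
  funext k'
  by_cases h : k' = k
  · subst h; simp
  · simp [h]

theorem lie_monomialVec (g : GXY r) (e : Fin n → ℕ+ × Fin r) :
    ⁅g, monomialVec N e⁆ = ∑ k, exteriorPower.ιMulti ℂ n
      (Function.update (fun k => uVec N (N - ((e k).1 : ℕ)) (e k).2) k
        ⁅g, uVec N (N - ((e k).1 : ℕ)) (e k).2⁆) := lie_ιMulti _ _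

theorem monomialVec_eq_zero {e : Fin n → ℕ+ × Fin r} (h : ¬ Function.Injective e) :
    monomialVec N e = 0 := by
  rw [Function.Injective] at h
  push Not at h
  obtain ⟨a, b, hab, hne⟩ := h
  exact AlternatingMap.map_eq_zero_of_eq _ _ (by rw [hab]) hne

theorem monomialVec_comp_perm (e : Fin n → ℕ+ × Fin r) (σ : Equiv.Perm (Fin n)) :
    monomialVec N (e ∘ σ) = ((Equiv.Perm.sign σ : ℤ) : ℂ) • monomialVec N e := by
  have h := AlternatingMap.map_perm (exteriorPower.ιMulti ℂ n)
    (fun k => uVec N (N - ((e k).1 : ℕ)) (e k).2) σ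
  rw [Units.smul_def, ← Int.cast_smul_eq_zsmul ℂ] at h
  exact h

/-- The span of the monomials whose positions are dominated. -/
def dominatedSpan (ξ : Fin r → ℕ) (n : ℕ) (N : ℤ) : Submodule ℂ (WedgeVN r n N) :=
  Submodule.span ℂ {w | ∃ e : Fin n → ℕ+ × Fin r,
    Dominated ξ (fun k => ((e k).1 : ℕ)) ∧ w = monomialVec N e}

/-- The action replaces one factor at a time by factors of no smaller exponent. The row number `N`
minus the exponent does not grow, and lowering entries preserves domination. -/
theorem lie_mem_dominatedSpan (ξ : Fin r → ℕ) (g : GXY r) {w : WedgeVN r n N}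
    (hw : w ∈ dominatedSpan ξ n N) : ⁅g, w⁆ ∈ dominatedSpan ξ n N := by
  induction hw using Submodule.span_induction with
  | mem w hw =>
    obtain ⟨e, he, rfl⟩ := hw
    rw [lie_monomialVec]
    refine Submodule.sum_mem _ fun k _ => ?_
    let f : VN r N →ₗ[ℂ] WedgeVN r n N := (exteriorPower.ιMulti ℂ n).toMultilinearMap.toLinearMap
      (fun k => uVec N (N - ((e k).1 : ℕ)) (e k).2) k
    refine apply_mem_of_mem_span f ?_ (lie_uVec_mem g (N - ((e k).1 : ℕ)) (e k).2)
    rintro _ ⟨i, l, hi, rfl⟩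
    -- Exponents from `N` on give zero in the quotient; a smaller exponent corresponds to a positive
    -- row number.
    rcases le_or_gt N i with h | h
    · rw [uVec_eq_zero h, map_zero]
      exact Submodule.zero_mem _
    · obtain ⟨p, rfl⟩ : ∃ p : ℕ+, i = N - (p : ℕ) := by
        refine ⟨⟨(N - i).toNat, by omega⟩, ?_⟩
        change i = N - ((N - i).toNat : ℤ)
        omega
      refine Submodule.subset_span ⟨Function.update e k (p, l), he.mono ξ ?_, monomialVec_update _ _ _ _⟩
      intro k'
      by_cases h' : k' = k
      · subst h'
        rw [Function.update_self]
        dsimp only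
        omega
      · rw [Function.update_of_ne h']
  | zero => rw [lie_zero]; exact Submodule.zero_mem _
  | add a b _ _ ha hb => rw [lie_add]; exact Submodule.add_mem _ ha hb
  | smul c a _ ha => rw [lie_smul]; exact Submodule.smul_mem _ c ha

/-- A single box of a monomial is moved by an element of `𝒢_r`. -/
theorem exists_lie_monomialVec (e : Fin n → ℕ+ × Fin r) (he : Function.Injective e) (k : Fin n)
    (p : ℕ+ × Fin r) (hp : p.1 ≤ (e k).1) :
    ∃ (d : ℕ) (g : GXY r) (c : ℂ), InLieFil r d g ∧ c ≠ 0 ∧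
      ⁅g, monomialVec N e⁆ = c • monomialVec N (Function.update e k p) := by
  -- As a polynomial in `𝒴` this kills all rows that occur in the monomial except the row of the box
  -- `k`. The product is over distinct rows, so its value at the row of `k` is nonzero.
  let q : Polynomial ℂ := ∏ i ∈ (Finset.univ.image fun k => (e k).1).erase (e k).1,
    (Polynomial.X - Polynomial.C (((N - (i : ℕ) : ℤ)) : ℂ))
  have hq0 : ∀ k', (e k').1 ≠ (e k).1 → q.eval (((N - ((e k').1 : ℕ) : ℤ)) : ℂ) = 0 := by
    intro k' h
    rw [Polynomial.eval_prod]
    exact Finset.prod_eq_zero (Finset.mem_erase.2 ⟨h, Finset.mem_image_of_mem _ (Finset.mem_univ k')⟩)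
      (by simp)
  have hq1 : q.eval (((N - ((e k).1 : ℕ) : ℤ)) : ℂ) ≠ 0 := by
    rw [Polynomial.eval_prod, Finset.prod_ne_zero_iff]
    intro i hi
    rw [Polynomial.eval_sub, Polynomial.eval_X, Polynomial.eval_C, sub_ne_zero]
    intro h
    have h2 := Int.cast_injective h
    exact Finset.ne_of_mem_erase hi (PNat.coe_injective (by omega))
  -- The power of `𝒳` shifts the selected row to the row of `p`; the subtraction is not truncated
  -- because of `hp`.
  let x : XYAlg := genX ^ ((e k).1 - p.1 : ℕ) * Polynomial.aeval genY q
  have hx : ∀ i : ℤ, algAction N x (powClass N i)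
      = q.eval (i : ℂ) • powClass N (i + ((e k).1 - p.1 : ℕ)) := by
    intro i
    rw [map_mul, Module.End.mul_apply, algAction_aeval_genY, map_smul, algAction_genX_pow]
  refine ⟨q.natDegree, Matrix.single p.2 (e k).2 x, q.eval (((N - ((e k).1 : ℕ) : ℤ)) : ℂ), ?_, hq1,
    ?_⟩
  · intro i j
    rw [Matrix.single_apply]
    split_ifs
    · change genX ^ _ * Polynomial.aeval genY q ∈ _
      rw [Polynomial.aeval_eq_sum_range, Finset.mul_sum]
      refine Submodule.sum_mem _ fun j hj => ?_
      rw [mul_smul_comm]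
      exact Submodule.smul_mem _ _
        (Submodule.subset_span ⟨_, j, Nat.lt_succ_iff.1 (Finset.mem_range.1 hj), rfl⟩)
    · exact Submodule.zero_mem _
  · have hlie : ∀ k', ⁅(Matrix.single p.2 (e k).2 x : GXY r), uVec N (N - ((e k').1 : ℕ)) (e k').2⁆
        = if k' = k then q.eval (((N - ((e k).1 : ℕ) : ℤ)) : ℂ) • uVec N (N - (p.1 : ℕ)) p.2
          else 0 := by
      intro k'
      funext l
      rw [lie_uVec_apply, Matrix.single_apply]
      by_cases hk : k' = k
      · subst hk
        rw [if_pos rfl]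
        change _ = q.eval (((N - ((e k').1 : ℕ) : ℤ)) : ℂ) • uVec N (N - (p.1 : ℕ)) p.2 l
        by_cases hl : p.2 = l
        · subst hl
          rw [if_pos ⟨rfl, rfl⟩, hx, uVec_same]
          congr 2
          have : (p.1 : ℕ) ≤ (e k').1 := hp
          omega
        · rw [if_neg (fun h => hl h.1), uVec_of_ne _ _ (Ne.symm hl), map_zero, LinearMap.zero_apply,
            smul_zero]
      -- A box in another column is killed by the matrix unit. A box in the same column lies in
      -- another row by injectivity of `e`, and `q` kills it.
      · rw [if_neg hk]
        change _ = (0 : LQuot N)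
        split_ifs with h
        · rw [hx, hq0, zero_smul]
          exact fun h' => hk (he (Prod.ext h' h.2.symm))
        · rw [map_zero, LinearMap.zero_apply]
    rw [lie_monomialVec, Finset.sum_eq_single k]
    · rw [hlie, if_pos rfl, AlternatingMap.map_update_smul, monomialVec_update]
    · intro k' _ hk'
      rw [hlie, if_neg hk', AlternatingMap.map_update_zero]
    · simp

end Monomials
/-! ### The filtration and the monomials in `𝒱(ξ, N)` -/

section Reach

variable {r : ℕ} {ξ : Fin r → ℕ} {N : ℤ}

theorem mem_weylFil {m : ℤ} {w : WedgeVN r (∑ j, ξ j) N} : w ∈ weylFil ξ N m ↔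
    ∃ u ∈ envFil r m, envAction r (∑ j, ξ j) N u (cyclicVec ξ N) = w := Iff.rfl

theorem weylFil_mono {m m' : ℤ} (h : m ≤ m') : weylFil ξ N m ≤ weylFil ξ N m' := by
  rintro _ ⟨u, hu, rfl⟩
  refine ⟨u, Submodule.span_mono ?_ hu, rfl⟩
  rintro _ ⟨l, hl, hm, rfl⟩
  exact ⟨l, hl, hm.trans h, rfl⟩

theorem weylFil_of_neg {m : ℤ} (h : m < 0) : weylFil ξ N m = ⊥ := by
  rw [eq_bot_iff]
  rintro _ ⟨u, hu, rfl⟩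
  have h0 : envFil r m = ⊥ := by
    rw [envFil, Submodule.span_eq_bot]
    rintro _ ⟨l, _, hm, rfl⟩
    have : (0 : ℤ) ≤ ((l.map Prod.fst).sum : ℤ) := Nat.cast_nonneg _
    omega
  rw [SetLike.mem_coe, h0, Submodule.mem_bot] at hu
  rw [hu, map_zero]
  exact Submodule.zero_mem _

theorem ι_mul_mem_envFil {d : ℕ} {m : ℤ} {g : GXY r} (hg : InLieFil r d g)
    {u : UniversalEnvelopingAlgebra ℂ (GXY r)} (hu : u ∈ envFil r m) :
    UniversalEnvelopingAlgebra.ι ℂ g * u ∈ envFil r (d + m) := by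
  refine apply_mem_of_mem_span (LinearMap.mulLeft ℂ (UniversalEnvelopingAlgebra.ι ℂ g)) ?_ hu
  rintro _ ⟨l, hl, hm, rfl⟩
  refine Submodule.subset_span ⟨(d, g) :: l, ?_, ?_, ?_⟩
  · rintro p hp
    rcases List.mem_cons.1 hp with rfl | hp
    · exact hg
    · exact hl p hp
  · simpa using hm
  · simp

theorem lie_mem_weylFil {d : ℕ} {m : ℤ} {g : GXY r} (hg : InLieFil r d g)
    {w : WedgeVN r (∑ j, ξ j) N} (hw : w ∈ weylFil ξ N m) : ⁅g, w⁆ ∈ weylFil ξ N (d + m) := by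
  obtain ⟨u, hu, rfl⟩ := mem_weylFil.1 hw
  exact mem_weylFil.2 ⟨_, ι_mul_mem_envFil hg hu, envAction_ι_mul _ _ _⟩

theorem weylFil_le_deformedWeyl (m : ℤ) :
    (weylFil ξ N m).toSubmodule ≤ (deformedWeyl ξ N).toSubmodule := by
  rintro _ ⟨u, hu, rfl⟩
  have h := mem_subalgebra_of_ι_mem
    (T := { carrier := {u | ∀ w ∈ deformedWeyl ξ N, envAction r (∑ j, ξ j) N u w ∈ deformedWeyl ξ N}
            mul_mem' := fun {x y} hx hy w hw => by
              rw [map_mul, Module.End.mul_apply]; exact hx _ (hy _ hw)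
            add_mem' := fun {x y} hx hy w hw => by
              rw [map_add, LinearMap.add_apply]; exact add_mem (hx _ hw) (hy _ hw)
            algebraMap_mem' := fun c w hw => by
              rw [AlgHom.commutes, Module.algebraMap_end_apply]
              exact Submodule.smul_mem (deformedWeyl ξ N).toSubmodule c hw })
    (fun g w hw => by
      rw [envAction, UniversalEnvelopingAlgebra.lift_ι_apply]
      exact (deformedWeyl ξ N).lie_mem hw) u
  exact h _ (LieSubmodule.subset_lieSpan (Set.mem_singleton _))

theorem cyclicVec_mem_weylFil : cyclicVec ξ N ∈ weylFil ξ N 0 :=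
  mem_weylFil.2 ⟨1, Submodule.subset_span ⟨[], by simp, by simp, by simp⟩, by simp⟩

/-- Induction on the number of boxes of `e₀` that are not boxes of `e`. Each exchange is realized by
one Lie algebra element; it adds a box of `e` and raises the filtration degree by a finite amount.
-/
theorem monomialVec_mem_weylFil_of_dominated (e₀ e : Fin (∑ j, ξ j) → ℕ+ × Fin r)
    (h₀ : Function.Injective e₀)
    (hdom : ∀ s, ((Finset.univ.image e₀).filter (fun p => (p.1 : ℕ) ≤ s)).card
      ≤ ((Finset.univ.image e).filter (fun p => (p.1 : ℕ) ≤ s)).card)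
    (hm : ∃ m, monomialVec N e₀ ∈ weylFil ξ N m) : ∃ m, monomialVec N e ∈ weylFil ξ N m := by
  induction hc : (Finset.univ.image e₀ \ Finset.univ.image e).card generalizing e₀ with
  | zero =>
    -- With no box left to exchange, the two enumerations differ by a permutation, so the monomials
    -- agree up to sign.
    have hsub : Finset.univ.image e₀ ⊆ Finset.univ.image e := by
      rwa [← Finset.sdiff_eq_empty_iff_subset, ← Finset.card_eq_zero]
    have hex : ∀ k, ∃ l, e l = e₀ k := fun k => by
      simpa using hsub (Finset.mem_image_of_mem e₀ (Finset.mem_univ k))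
    choose σ hσ using hex
    have hinj : Function.Injective σ := fun a b hab => h₀ (by rw [← hσ, ← hσ, hab])
    let τ := Equiv.ofBijective σ (Finite.injective_iff_bijective.1 hinj)
    have h1 : e = e₀ ∘ τ.symm := by
      funext k
      rw [Function.comp_apply, ← hσ]
      exact congrArg e (τ.apply_symm_apply k).symm
    obtain ⟨m, hm⟩ := hm
    refine ⟨m, ?_⟩
    rw [h1, monomialVec_comp_perm]
    exact Submodule.smul_mem (weylFil ξ N m).toSubmodule _ hm
  | succ c ih =>
    obtain ⟨x, hx, y, hy, hyx, hd⟩ := exists_exchange (fun p : ℕ+ × Fin r => (p.1 : ℕ)) hdom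
      (Finset.card_pos.1 (by omega))
    obtain ⟨hx0, hxe⟩ := Finset.mem_sdiff.1 hx
    obtain ⟨hye, hy0⟩ := Finset.mem_sdiff.1 hy
    obtain ⟨k, -, rfl⟩ := Finset.mem_image.1 hx0
    have hy0' : ∀ l, e₀ l ≠ y := fun l h => hy0 (h ▸ Finset.mem_image_of_mem _ (Finset.mem_univ l))
    have himg : Finset.univ.image (Function.update e₀ k y)
        = insert y ((Finset.univ.image e₀).erase (e₀ k)) := by
      ext z
      simp only [Finset.mem_image, Finset.mem_univ, true_and, Finset.mem_insert, Finset.mem_erase]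
      constructor
      · rintro ⟨l, rfl⟩
        by_cases hl : l = k
        · subst hl; left; simp
        · right
          rw [Function.update_of_ne hl]
          exact ⟨fun h => hl (h₀ h), l, rfl⟩
      · rintro (rfl | ⟨hz, l, rfl⟩)
        · exact ⟨k, by simp⟩
        · exact ⟨l, Function.update_of_ne (fun h => hz (by rw [h])) _ _⟩
    obtain ⟨d, g, a, hg, ha, hga⟩ := exists_lie_monomialVec (N := N) e₀ h₀ k y hyx
    refine ih (Function.update e₀ k y) (fun a b hab => ?_) ?_ ?_ ?_
    · by_cases h1 : a = k <;> by_cases h2 : b = k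
      · rw [h1, h2]
      · rw [h1, Function.update_self, Function.update_of_ne h2] at hab
        exact absurd hab.symm (hy0' b)
      · rw [h2, Function.update_self, Function.update_of_ne h1] at hab
        exact absurd hab (hy0' a)
      · rw [Function.update_of_ne h1, Function.update_of_ne h2] at hab
        exact h₀ hab
    · rw [himg]; exact hd
    · obtain ⟨m, hm⟩ := hm
      refine ⟨d + m, ?_⟩
      have h1 := Submodule.smul_mem (weylFil ξ N (d + m)).toSubmodule a⁻¹ (lie_mem_weylFil hg hm)
      rwa [hga, smul_smul, inv_mul_cancel₀ ha, one_smul] at h1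
    · rw [himg, Finset.insert_sdiff_of_mem _ hye, Finset.erase_sdiff_comm, Finset.card_erase_of_mem hx,
        hc, Nat.add_sub_cancel]

theorem card_image_filter {n s : ℕ} {e : Fin n → ℕ+ × Fin r} (he : Function.Injective e) :
    ((Finset.univ.image e).filter (fun p => (p.1 : ℕ) ≤ s)).card
      = (Finset.univ.filter fun k => ((e k).1 : ℕ) ≤ s).card := by
  rw [Finset.filter_image, Finset.card_image_of_injective _ he]

theorem exists_mem_weylFil {e : Fin (∑ j, ξ j) → ℕ+ × Fin r}
    (h : Dominated ξ fun k => ((e k).1 : ℕ)) : ∃ m, monomialVec N e ∈ weylFil ξ N m := by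
  by_cases he : Function.Injective e
  · refine monomialVec_mem_weylFil_of_dominated (cyclicEnum ξ) e (cyclicEnum_injective ξ)
      (fun s => ?_) ⟨0, by rw [← cyclicVec_eq]; exact cyclicVec_mem_weylFil⟩
    rw [card_image_filter he, card_image_filter (cyclicEnum_injective ξ), card_cyclicEnum]
    exact h s
  · exact ⟨0, by rw [monomialVec_eq_zero he]; exact zero_mem _⟩

/-- The dominated span is a submodule that contains the cyclic vector, and every dominated monomial
is reached from the cyclic vector. -/
theorem deformedWeyl_toSubmodule :
    (deformedWeyl ξ N).toSubmodule = dominatedSpan ξ (∑ j, ξ j) N := by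
  refine le_antisymm ?_ (Submodule.span_le.2 ?_)
  · let S : LieSubmodule ℂ (GXY r) (WedgeVN r (∑ j, ξ j) N) :=
      { dominatedSpan ξ (∑ j, ξ j) N with lie_mem := fun {g w} hw => lie_mem_dominatedSpan ξ g hw }
    have h : deformedWeyl ξ N ≤ S := by
      refine LieSubmodule.lieSpan_le.2 (Set.singleton_subset_iff.2 ?_)
      exact Submodule.subset_span ⟨_, dominated_cyclicEnum ξ, cyclicVec_eq ξ N⟩
    exact h
  · rintro _ ⟨e, he, rfl⟩
    obtain ⟨m, hm⟩ := exists_mem_weylFil (N := N) he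
    exact weylFil_le_deformedWeyl m hm

theorem finite_dominated : {e : Fin (∑ j, ξ j) → ℕ+ × Fin r |
    Dominated ξ fun k => ((e k).1 : ℕ)}.Finite := by
  refine (Set.Finite.pi' (t := fun _ => {p : ℕ+ × Fin r | (p.1 : ℕ) ≤ ∑ j, ξ j}) fun _ => ?_).subset
    fun e he k => Dominated.le ξ he k
  refine Set.Finite.of_finite_image (f := fun p : ℕ+ × Fin r => ((p.1 : ℕ), p.2))
    (((Set.finite_Iic (∑ j, ξ j)).prod Set.finite_univ).subset ?_) ?_
  · rintro _ ⟨p, hp, rfl⟩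
    exact ⟨hp, trivial⟩
  · rintro p - q - h
    obtain ⟨h1, h2⟩ := Prod.mk.inj h
    exact Prod.ext (PNat.coe_injective h1) h2

/-- Finitely many dominated monomials span the module, so one filtration step contains all of them.
-/
theorem exists_deformedWeyl_le_weylFil :
    ∃ J : ℕ, (deformedWeyl ξ N).toSubmodule ≤ (weylFil ξ N J).toSubmodule := by
  choose! f hf using fun (e : Fin (∑ j, ξ j) → ℕ+ × Fin r)
    (h : Dominated ξ fun k => ((e k).1 : ℕ)) => exists_mem_weylFil (N := N) h
  obtain ⟨J, hJ⟩ := (finite_dominated (ξ := ξ)).image (fun e => (f e).toNat) |>.bddAbove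
  refine ⟨J, ?_⟩
  rw [deformedWeyl_toSubmodule]
  refine Submodule.span_le.2 ?_
  rintro _ ⟨e, he, rfl⟩
  have h1 : (f e).toNat ≤ J := hJ ⟨e, he, rfl⟩
  exact weylFil_mono (by omega) (hf e he)

instance : FiniteDimensional ℂ (deformedWeyl ξ N).toSubmodule := by
  rw [deformedWeyl_toSubmodule, dominatedSpan]
  refine FiniteDimensional.span_of_finite ℂ (((finite_dominated (ξ := ξ)).image
    (monomialVec N)).subset ?_)
  rintro _ ⟨e, he, rfl⟩
  exact ⟨e, he, rfl⟩

end Reach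
/-! ### The graded components of `𝒱(ξ, N)` -/

section Grading

variable {r n : ℕ} {ξ : Fin r → ℕ} {N : ℤ}

theorem scalar_genY_lie_uVec (i : ℤ) (j : Fin r) :
    ⁅(Matrix.diagonal fun _ => genY : GXY r), uVec N i j⁆ = (i : ℂ) • uVec N i j := by
  funext l
  rw [lie_uVec_apply, Matrix.diagonal_apply]
  change _ = (i : ℂ) • uVec N i j l
  split_ifs with h
  · subst h
    rw [algAction_genY, uVec_same]
    rfl
  · rw [uVec_of_ne N i h, map_zero, LinearMap.zero_apply, smul_zero]

theorem scalar_genY_lie_monomialVec (e : Fin n → ℕ+ × Fin r) :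
    ⁅(Matrix.diagonal fun _ => genY : GXY r), monomialVec N e⁆
      = (((n * N - ∑ k, (((e k).1 : ℕ) : ℤ) : ℤ)) : ℂ) • monomialVec N e := by
  rw [lie_monomialVec]
  have h : ∀ k, exteriorPower.ιMulti ℂ n
      (Function.update (fun k => uVec N (N - ((e k).1 : ℕ)) (e k).2) k
        ⁅(Matrix.diagonal fun _ => genY : GXY r), uVec N (N - ((e k).1 : ℕ)) (e k).2⁆)
      = ((N - ((e k).1 : ℕ) : ℤ) : ℂ) • monomialVec N e := by
    intro k
    rw [scalar_genY_lie_uVec, AlternatingMap.map_update_smul, monomialVec_update, Prod.mk.eta,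
      Function.update_eq_self]
  rw [Finset.sum_congr rfl fun k _ => h k, ← Finset.sum_smul, ← Int.cast_sum,
    Finset.sum_sub_distrib]
  simp

/-- The span of the monomials of degree `m` whose positions are dominated. -/
def gradedSpan (ξ : Fin r → ℕ) (N m : ℤ) : Submodule ℂ (WedgeVN r (∑ j, ξ j) N) :=
  Submodule.span ℂ {w | ∃ e : Fin (∑ j, ξ j) → ℕ+ × Fin r,
    Dominated ξ (fun k => ((e k).1 : ℕ)) ∧ monomialDeg ξ e = m ∧ w = monomialVec N e}

/-- The scalar matrix `𝒴` multiplies a monomial by its total exponent, which is its degree up to a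
constant. Hence pieces of different degrees have different eigenvalues. -/
theorem exists_eigenvalue_wedgeGrade (ξ : Fin r → ℕ) (N : ℤ) : ∃ K : ℤ, ∀ m,
    ∀ w ∈ wedgeGrade ξ N m,
      ⁅(Matrix.diagonal fun _ => genY : GXY r), w⁆ = ((K + m : ℤ) : ℂ) • w := by
  refine ⟨(∑ j, ξ j : ℕ) * N - ∑ i ∈ Finset.Icc 1 (∑ j, ξ j), (i : ℤ) * transposePart ξ i,
    fun m w hw => ?_⟩
  change w ∈ Submodule.span ℂ _ at hw
  induction hw using Submodule.span_induction with
  | mem w hw =>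
    obtain ⟨e, rfl, rfl⟩ := hw
    rw [scalar_genY_lie_monomialVec, monomialDeg]
    congr 2
    ring
  | zero => rw [lie_zero, smul_zero]
  | add a b _ _ ha hb => rw [lie_add, ha, hb, smul_add]
  | smul c a _ ha => rw [lie_smul, ha, smul_comm]

theorem gradedSpan_le_wedgeGrade (m : ℤ) : gradedSpan ξ N m ≤ (wedgeGrade ξ N m).toSubmodule := by
  refine Submodule.span_mono ?_
  rintro _ ⟨e, -, h, rfl⟩
  exact ⟨e, h, rfl⟩

theorem eq_zero_of_smul_eq_smul {K M : Type*} [Field K] [AddCommGroup M] [Module K M] {a b : K}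
    {x : M} (h : a • x = b • x) (hab : a ≠ b) : x = 0 := by
  rw [← sub_eq_zero, ← sub_smul] at h
  exact (smul_eq_zero.1 h).resolve_left (sub_ne_zero.2 hab)

/-- An element of the module is a sum of homogeneous combinations of dominated monomials. If it also
has degree `m`, the eigenvalues of `𝒴` force the components of other degrees to vanish. -/
theorem weylGrade_toSubmodule (m : ℤ) : (weylGrade ξ N m).toSubmodule = gradedSpan ξ N m := by
  refine le_antisymm ?_ (le_inf ?_ (gradedSpan_le_wedgeGrade m))
  · rintro w ⟨h1, h2⟩
    rw [SetLike.mem_coe, deformedWeyl_toSubmodule] at h1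
    have h3 : w ∈ ⨆ i, gradedSpan ξ N i := by
      refine Submodule.span_le.2 ?_ h1
      rintro _ ⟨e, he, rfl⟩
      exact Submodule.mem_iSup_of_mem (monomialDeg ξ e) (Submodule.subset_span ⟨e, he, rfl, rfl⟩)
    obtain ⟨f, hf, rfl⟩ := (Submodule.mem_iSup_iff_exists_finsupp _ _).1 h3
    obtain ⟨K, hK⟩ := exists_eigenvalue_wedgeGrade ξ N
    let D : Module.End ℂ (WedgeVN r (∑ j, ξ j) N) :=
      LieModule.toEnd ℂ (GXY r) _ (Matrix.diagonal fun _ => genY)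
    -- Each component lies in degree `m` as well as in its own degree; when these differ, the two
    -- eigenvalues of `D` make it zero.
    have h4 := mem_of_sum_mem_of_eigen (fun _ : Unit => D) (wedgeGrade ξ N m).toSubmodule
      (fun _ x hx => by
        change ⁅(Matrix.diagonal fun _ => genY : GXY r), x⁆ ∈ _
        rw [hK m x hx]
        exact Submodule.smul_mem _ _ hx)
      (fun (i : ℤ) _ => ((K + i : ℤ) : ℂ))
      (fun i j hij => by simpa using congrFun hij ())
      f.support f (fun i _ _ => hK i _ (gradedSpan_le_wedgeGrade i (hf i))) h2
    refine Submodule.sum_mem _ fun i hi => ?_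
    by_cases him : i = m
    · rw [← him]; exact hf i
    · have h5 := hK i _ (gradedSpan_le_wedgeGrade i (hf i))
      rw [hK m _ (h4 i hi)] at h5
      have hne : ((K + m : ℤ) : ℂ) ≠ ((K + i : ℤ) : ℂ) := fun h => by
        have := Int.cast_injective h
        omega
      have h6 := eq_zero_of_smul_eq_smul (M := WedgeVN r (∑ j, ξ j) N) h5 hne
      change f i ∈ _
      rw [h6]
      exact Submodule.zero_mem _
  · rw [deformedWeyl_toSubmodule]
    refine Submodule.span_mono ?_
    rintro _ ⟨e, he, -, rfl⟩
    exact ⟨e, he, rfl⟩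

theorem weylGrade_le_deformedWeyl (m : ℤ) :
    (weylGrade ξ N m).toSubmodule ≤ (deformedWeyl ξ N).toSubmodule := inf_le_left

instance (i j : ℤ) : FiniteDimensional ℂ (weylFilGrade ξ N i j) :=
  Submodule.finiteDimensional_of_le
    (inf_le_left.trans (weylGrade_le_deformedWeyl i) :
      (weylFilGrade ξ N i j).toSubmodule ≤ (deformedWeyl ξ N).toSubmodule)

theorem finite_weylGrade_ne_bot : {m | weylGrade ξ N m ≠ ⊥}.Finite := by
  refine ((finite_dominated (ξ := ξ)).image (monomialDeg ξ)).subset fun m hm => ?_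
  by_contra h
  refine hm ((LieSubmodule.toSubmodule_eq_bot _).1 ?_)
  rw [weylGrade_toSubmodule, gradedSpan, Submodule.span_eq_bot]
  rintro _ ⟨e, he, hem, rfl⟩
  exact absurd ⟨e, he, hem⟩ h

theorem monomialVec_mem_weightSubspace (e : Fin n → ℕ+ × Fin r) :
    monomialVec N e ∈ weightSubspace r (WedgeVN r n N) (wt fun k => (e k).2) := by
  intro i
  rw [const_lie_monomialVec, wt, Finset.card_filter, Nat.cast_sum, Finset.sum_smul]
  refine Finset.sum_congr rfl fun k _ => ?_
  rw [Finset.sum_eq_single i]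
  · rw [Matrix.single_apply]
    by_cases h : (e k).2 = i
    · rw [if_pos h, if_pos ⟨rfl, h.symm⟩, one_smul, ← h, Prod.mk.eta, Function.update_eq_self]
      simp
    · rw [if_neg h, if_neg fun h' => h h'.2.symm, zero_smul]
      simp
  · intro l _ hl
    rw [Matrix.single_apply_of_row_ne (Ne.symm hl), zero_smul]
  · simp

/-- A submodule is stable under the diagonal matrices, so it contains the weight components of its
elements, which lie a priori only in `M`. -/
theorem isWeightModule_of_le_iSup {M : Type} [AddCommGroup M] [Module ℂ M]
    [LieRingModule (Gl r) M] [LieModule ℂ (Gl r) M] (A : LieSubmodule ℂ (Gl r) M)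
    (h : A.toSubmodule ≤ ⨆ η, weightSubspace r M η) : IsWeightModule r A := by
  refine top_unique fun x _ => ?_
  obtain ⟨f, hf, hx⟩ := (Submodule.mem_iSup_iff_exists_finsupp _ _).1 (h x.2)
  have hA := mem_of_sum_mem_of_weight A.toSubmodule (fun i x hx => A.lie_mem hx) f.support f
    (fun η _ => hf η) (by change f.sum (fun _ xi => xi) ∈ _; rw [hx]; exact x.2)
  have hx' : x = ∑ η ∈ f.support.attach, (⟨f η, hA η η.2⟩ : A) := by
    apply Subtype.ext
    rw [← hx, Finsupp.sum, ← Finset.sum_attach]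
    exact (map_sum A.toSubmodule.subtype (fun η : f.support => (⟨f η, hA η η.2⟩ : A)) _).symm
  rw [hx']
  refine Submodule.sum_mem _ fun η _ => Submodule.mem_iSup_of_mem η.1 fun i => Subtype.ext (hf η i)

theorem isWeightModule_weylFilGrade (i j : ℤ) : IsWeightModule r (weylFilGrade ξ N i j) := by
  refine isWeightModule_of_le_iSup _ ?_
  have h : (weylGrade ξ N i).toSubmodule
      ≤ ⨆ η, weightSubspace r (WedgeVN r (∑ j, ξ j) N) η := by
    rw [weylGrade_toSubmodule]
    refine Submodule.span_le.2 ?_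
    rintro _ ⟨e, -, -, rfl⟩
    exact Submodule.mem_iSup_of_mem _ (monomialVec_mem_weightSubspace e)
  exact le_trans inf_le_left h

/-! ### The character of the associated graded module -/

theorem ch_quotient_comap_add {M : Type} [AddCommGroup M] [Module ℂ M] [LieRingModule (Gl r) M]
    [LieModule ℂ (Gl r) M] {A B : LieSubmodule ℂ (Gl r) M} [FiniteDimensional ℂ A]
    (h : IsWeightModule r A) (hle : B ≤ A) : ch r (A ⧸ B.comap A.incl) + ch r B = ch r A := by
  rw [← ch_quotient_add h (B.comap A.incl)]
  congr 1
  let e : B ≃ₗ[ℂ] B.comap A.incl :=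
    { toFun := fun x => ⟨⟨x.1, hle x.2⟩, x.2⟩
      invFun := fun x => ⟨x.1.1, x.2⟩
      map_add' := fun _ _ => rfl
      map_smul' := fun _ _ => rfl
      left_inv := fun _ => rfl
      right_inv := fun _ => rfl }
  exact ch_congr e fun _ _ => rfl

theorem ch_degenerateWeyl (i j : ℤ) : ch r (DegenerateWeyl ξ N i j)
    = ch r (weylFilGrade ξ N i j) - ch r (weylFilGrade ξ N i (j - 1)) :=
  eq_sub_of_add_eq (ch_quotient_comap_add (isWeightModule_weylFilGrade i j)
    (inf_le_inf le_rfl (weylFil_mono (by omega))))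

theorem ch_of_subsingleton {M : Type} [AddCommGroup M] [Module ℂ M] [LieRingModule (Gl r) M]
    [LieModule ℂ (Gl r) M] [Subsingleton M] : ch r M = 0 := by
  ext η
  rw [coeff_ch, Module.finrank_zero_of_subsingleton]
  simp

theorem ch_bot_of_eq {M : Type} [AddCommGroup M] [Module ℂ M] [LieRingModule (Gl r) M]
    [LieModule ℂ (Gl r) M] {A : LieSubmodule ℂ (Gl r) M} (h : A = ⊥) : ch r A = 0 := by
  subst h
  exact ch_of_subsingleton

/-- The sum telescopes; at `J = 0` the right side is the filtration in degree -1, which is zero. -/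
theorem sum_ch_degenerateWeyl (i : ℤ) (J : ℕ) :
    ∑ j ∈ Finset.range J, ch r (DegenerateWeyl ξ N i j) = ch r (weylFilGrade ξ N i (J - 1)) := by
  induction J with
  | zero =>
    rw [Finset.sum_range_zero, ch_bot_of_eq]
    rw [weylFilGrade, weylFil_of_neg (by simp), inf_bot_eq]
  | succ J ih =>
    have h : ((J + 1 : ℕ) : ℤ) - 1 = J := by push_cast; ring
    rw [Finset.sum_range_succ, ih, ch_degenerateWeyl, add_sub_cancel, h]

theorem exists_weylFilGrade_eq (ξ : Fin r → ℕ) (N : ℤ) :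
    ∃ J : ℕ, ∀ i j : ℤ, (J : ℤ) ≤ j → weylFilGrade ξ N i j = weylGrade ξ N i := by
  obtain ⟨J, hJ⟩ := exists_deformedWeyl_le_weylFil (ξ := ξ) (N := N)
  refine ⟨J, fun i j hj => inf_eq_left.2 fun w hw => weylFil_mono hj ?_⟩
  exact hJ (weylGrade_le_deformedWeyl i hw)

/-- Both infinite sums have finite support: finitely many degrees occur, and the filtration is
stationary from `J` on. Setting `y = 1` then sums the successive quotients to the whole graded
component. -/
theorem chX_eq_finsum (ξ : Fin r → ℕ) (N : ℤ) : chX ξ N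
    = ∑ᶠ m : ℤ, LaurentPolynomial.C (ch r (weylGrade ξ N m)) * LaurentPolynomial.T m := by
  obtain ⟨J, hJ⟩ := exists_weylFilGrade_eq ξ N
  have hfin := finite_weylGrade_ne_bot (ξ := ξ) (N := N)
  let S : Finset ℤ := hfin.toFinset
  have hS : ∀ m ∉ S, weylGrade ξ N m = ⊥ := fun m hm => by
    simpa [S] using hm
  -- The range has `J + 1` terms because the quotient in degree `J` may still be nonzero and the
  -- telescoped sum must end at degree `J`.
  rw [chX, chXY, finsum_eq_sum_of_support_subset (s := S ×ˢ Finset.range (J + 1)),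
    finsum_eq_sum_of_support_subset (s := S), Finset.sum_product, Polynomial.eval_finsetSum]
  · refine Finset.sum_congr rfl fun m _ => ?_
    rw [Polynomial.eval_finsetSum]
    simp only [Polynomial.eval_monomial, one_pow, mul_one]
    rw [← Finset.sum_mul, ← map_sum, sum_ch_degenerateWeyl, hJ]
    push_cast
    omega
  · intro m hm
    by_contra h
    exact hm (by simp only; rw [ch_bot_of_eq (hS m h), map_zero, zero_mul])
  · rintro ⟨m, j⟩ hm
    by_contra h
    apply hm
    simp only
    have h0 : ch r (DegenerateWeyl ξ N m j) = 0 := by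
      rw [ch_degenerateWeyl]
      by_cases hmS : m ∈ S
      · have hj : J + 1 ≤ j := by
          by_contra hj
          exact h (by simp [hmS]; omega)
        rw [hJ _ _ (by omega), hJ _ _ (by omega), sub_self]
      · rw [ch_bot_of_eq, ch_bot_of_eq, sub_self]
        · rw [weylFilGrade, hS m hmS, bot_inf_eq]
        · rw [weylFilGrade, hS m hmS, bot_inf_eq]
    rw [h0, map_zero, zero_mul, map_zero]

end Grading
/-! ### The comparison of tensor invariants with exterior powers -/

section Compare

variable {r n : ℕ} {N : ℤ}

/-- The coefficient of `x^{N-i}`. -/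
def coeffFun (N : ℤ) (i : ℕ+) : LQuot N →ₗ[ℂ] ℂ :=
  (xPow N).liftQ (Finsupp.lapply (N - (i : ℕ)) ∘ₗ (AddMonoidAlgebra.coeffLinearEquiv ℂ).toLinearMap)
    (Submodule.span_le.2 (by
      rintro _ ⟨m, hm, rfl⟩
      change (Finsupp.single m (1 : ℂ)) (N - (i : ℕ)) = 0
      have := i.pos
      exact Finsupp.single_eq_of_ne (by omega)))

theorem coeffFun_powClass (i j : ℕ+) :
    coeffFun N i (powClass N (N - (j : ℕ))) = if i = j then 1 else 0 := by
  change (Finsupp.single (N - ((j : ℕ) : ℤ)) (1 : ℂ)) (N - (i : ℕ)) = _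
  rw [Finsupp.single_apply]
  refine if_congr ⟨fun h => PNat.coe_injective (by omega), fun h => by rw [h]⟩ rfl rfl

/-- The coordinate functional of the vector `u_j^{N-i}`. -/
def boxCoord (N : ℤ) (p : ℕ+ × Fin r) : VN r N →ₗ[ℂ] ℂ :=
  coeffFun N p.1 ∘ₗ LinearMap.proj (R := ℂ) (φ := fun _ : Fin r => LQuot N) p.2

/-- The embedding `u ↦ u ⊗ x^{N-i}`. -/
def boxEmbed (r : ℕ) (N : ℤ) (i : ℕ+) : (Fin r → ℂ) →ₗ[ℂ] VN r N where
  toFun u := fun j => u j • powClass N (N - (i : ℕ))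
  map_add' u v := funext fun j => add_smul (u j) (v j) _
  map_smul' c u := funext fun j => mul_smul c (u j) _

theorem boxEmbed_apply (i : ℕ+) (u : Fin r → ℂ) (j : Fin r) :
    boxEmbed r N i u j = u j • powClass N (N - (i : ℕ)) := rfl

theorem boxEmbed_single (i : ℕ+) (j : Fin r) :
    boxEmbed r N i (Pi.single j 1) = uVec N (N - (i : ℕ)) j := by
  funext k
  rw [boxEmbed_apply]
  by_cases h : k = j
  · subst h
    rw [Pi.single_eq_same, one_smul, uVec_same]
    rfl
  · rw [Pi.single_eq_of_ne h, zero_smul, uVec_of_ne _ _ h]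

theorem boxCoord_boxEmbed (p : ℕ+ × Fin r) (i : ℕ+) (u : Fin r → ℂ) :
    boxCoord N p (boxEmbed r N i u) = if p.1 = i then u p.2 else 0 := by
  change coeffFun N p.1 (u p.2 • powClass N (N - (i : ℕ))) = _
  rw [map_smul, coeffFun_powClass, smul_eq_mul, mul_ite, mul_one, mul_zero]

theorem lie_boxEmbed (g : Gl r) (i : ℕ+) (u : Fin r → ℂ) :
    boxEmbed r N i ⁅g, u⁆ = ⁅g, boxEmbed r N i u⁆ := by
  funext l
  rw [boxEmbed_apply, Matrix.lie_apply]
  change (∑ k, g l k * u k) • powClass N (N - (i : ℕ))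
    = ∑ k, algAction N (algebraMap ℂ XYAlg (g l k)) (u k • powClass N (N - (i : ℕ)))
  rw [Finset.sum_smul]
  refine Finset.sum_congr rfl fun k _ => ?_
  rw [AlgHom.commutes, Module.algebraMap_end_apply, smul_smul]

/-- The map `⊗ u_k ↦ ⋀ u_k ⊗ x^{N-p_k}`. -/
def wedgeMap (r : ℕ) (N : ℤ) (p : Fin n → ℕ+) : TensorPow r n →ₗ[ℂ] WedgeVN r n N :=
  PiTensorProduct.lift ((exteriorPower.ιMulti ℂ n).toMultilinearMap.compLinearMap
    fun k => boxEmbed r N (p k))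

theorem wedgeMap_tprod (p : Fin n → ℕ+) (v : Fin n → Fin r → ℂ) :
    wedgeMap r N p (PiTensorProduct.tprod ℂ v)
      = exteriorPower.ιMulti ℂ n fun k => boxEmbed r N (p k) (v k) := by
  rw [wedgeMap, PiTensorProduct.lift.tprod]
  rfl

theorem wedgeMap_tensorBasis (p : Fin n → ℕ+) (c : Fin n → Fin r) :
    wedgeMap r N p (tensorBasis r n c) = monomialVec N fun k => (p k, c k) := by
  rw [tensorBasis_apply, wedgeMap_tprod]
  simp only [boxEmbed_single]
  rfl

theorem wedgeMap_lie (p : Fin n → ℕ+) (g : Gl r) (t : TensorPow r n) :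
    wedgeMap r N p ⁅g, t⁆ = ⁅g, wedgeMap r N p t⁆ := by
  have h : wedgeMap r N p ∘ₗ LieModule.toEnd ℂ (Gl r) (TensorPow r n) g
      = LieModule.toEnd ℂ (Gl r) (WedgeVN r n N) g ∘ₗ wedgeMap r N p := by
    refine PiTensorProduct.ext (MultilinearMap.ext fun v => ?_)
    simp only [LinearMap.compMultilinearMap_apply, LinearMap.comp_apply,
      LieModule.toEnd_apply_apply, wedgeMap_tprod, lie_tprod, map_sum, lie_ιMulti]
    refine Finset.sum_congr rfl fun k _ => ?_
    congr 1
    funext l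
    by_cases hl : l = k
    · subst hl
      rw [Function.update_self, Function.update_self, lie_boxEmbed]
    · simp [hl]
  exact LinearMap.congr_fun h t

/-- Permuting vectors and positions together reorders the factors of one wedge product. The
resulting sign is the one that the sign representation cancels. -/
theorem wedgeMap_perm (p : Fin n → ℕ+) (σ : Equiv.Perm (Fin n)) (t : TensorPow r n) :
    wedgeMap r N (p ∘ σ.symm) (permRep r n σ t)
      = ((Equiv.Perm.sign σ : ℤ) : ℂ) • wedgeMap r N p t := by
  have h : wedgeMap r N (p ∘ σ.symm) ∘ₗ permEnd r n σ
      = ((Equiv.Perm.sign σ : ℤ) : ℂ) • wedgeMap r N p := by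
    refine PiTensorProduct.ext (MultilinearMap.ext fun v => ?_)
    simp only [LinearMap.compMultilinearMap_apply, LinearMap.comp_apply, permEnd_tprod,
      wedgeMap_tprod, LinearMap.smul_apply]
    have h1 := AlternatingMap.map_perm (exteriorPower.ιMulti ℂ n)
      (fun k => boxEmbed r N (p k) (v k)) σ.symm
    rw [Units.smul_def, ← Int.cast_smul_eq_zsmul ℂ, Equiv.Perm.sign_symm] at h1
    exact h1
  exact LinearMap.congr_fun h t

/-- The determinant functional that is dual to the monomial enumerated by `e`. -/
def detFun (N : ℤ) (e : Fin n → ℕ+ × Fin r) : WedgeVN r n N →ₗ[ℂ] ℂ :=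
  exteriorPower.alternatingMapLinearEquiv
    (Matrix.detRowAlternating.compLinearMap (LinearMap.pi fun a => boxCoord N (e a)))

theorem detFun_ιMulti (e : Fin n → ℕ+ × Fin r) (v : Fin n → VN r N) :
    detFun N e (exteriorPower.ιMulti ℂ n v)
      = Matrix.det (Matrix.of fun k a => boxCoord N (e a) (v k)) := by
  rw [detFun, exteriorPower.alternatingMapLinearEquiv_apply_ιMulti]
  rfl

/-- In the expansion of the determinant on a pure tensor, a permutation contributes only if it
carries the positions `p'` to `p`; its product is then a coordinate of the permuted tensor. -/
theorem detFun_wedgeMap (p p' : Fin n → ℕ+) (c : Fin n → Fin r) (t : TensorPow r n) :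
    detFun N (fun k => (p k, c k)) (wedgeMap r N p' t)
      = ∑ σ : Equiv.Perm (Fin n), ((Equiv.Perm.sign σ : ℤ) : ℂ) *
        if p' ∘ σ.symm = p then (tensorBasis r n).repr (permRep r n σ t) c else 0 := by
  induction t using PiTensorProduct.induction_on with
  | smul_tprod a v =>
    have hb : ∀ v : Fin n → Fin r → ℂ,
        (tensorBasis r n).repr (PiTensorProduct.tprod ℂ v) c = ∏ k, v k (c k) := by
      intro v
      rw [tensorBasis, Basis.piTensorProduct_repr_tprod_apply]
      simp
    have hp : ∀ σ, permRep r n σ (PiTensorProduct.tprod ℂ v)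
        = PiTensorProduct.tprod ℂ fun i => v (σ.symm i) := fun σ => permEnd_tprod r n σ v
    simp only [map_smul, wedgeMap_tprod, detFun_ιMulti, Matrix.det_apply', smul_eq_mul,
      Finset.mul_sum, hp, hb, Finsupp.smul_apply]
    -- The determinant expansion permutes rows by `σ`, whereas `permRep` moves tensor factors by the
    -- inverse.
    rw [← Equiv.sum_comp (Equiv.inv (Equiv.Perm (Fin n)))]
    refine Finset.sum_congr rfl fun σ _ => ?_
    simp only [Equiv.inv_apply, Equiv.Perm.sign_inv, Matrix.of_apply, boxCoord_boxEmbed]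
    split_ifs with h
    · rw [← mul_assoc, mul_comm a, mul_assoc]
      congr 2
      refine Finset.prod_congr rfl fun k _ => ?_
      exact if_pos (congrFun h k).symm
    · obtain ⟨k, hk⟩ := Function.ne_iff.1 h
      rw [Finset.prod_eq_zero (Finset.mem_univ k) (if_neg fun h' => hk h'.symm), mul_zero, mul_zero]
  | add x y hx hy =>
    simp only [map_add, hx, hy, Finsupp.add_apply]
    rw [← Finset.sum_add_distrib]
    refine Finset.sum_congr rfl fun σ _ => ?_
    split_ifs
    · rw [mul_add]
    · simp

end Compare
-- Invariants of a signed permutation representation as a span of monomials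
section CompareWith

variable {r n : ℕ} {W X : Type} [AddCommGroup W] [Module ℂ W]
  (b : Module.Basis X ℂ (TrivialLieModule ℂ (Gl r) W)) (pos : X → Fin n → ℕ+) (N : ℤ)

/-- The map `(⊗ u_k) ⊗ b_x ↦ ⋀ u_k ⊗ x^{N-pos x k}`. -/
def compareMap : TensorPowWith r n W →ₗ[ℂ] WedgeVN r n N :=
  TensorProduct.lift (b.constr ℂ fun x => wedgeMap r N (pos x)).flip

theorem compareMap_tmul_basis (t : TensorPow r n) (x : X) :
    compareMap b pos N (t ⊗ₜ[ℂ] b x) = wedgeMap r N (pos x) t := by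
  rw [compareMap, TensorProduct.lift.tmul, LinearMap.flip_apply, Module.Basis.constr_basis]

/-- The basis of `V_r^{⊗ n} ⊗ W` given by a basis of `W`. -/
def tensorWithBasis : Module.Basis ((Fin n → Fin r) × X) ℂ (TensorPowWith r n W) :=
  (tensorBasis r n).tensorProduct b

theorem tensorWithBasis_apply (c : Fin n → Fin r) (x : X) :
    tensorWithBasis b (c, x) = tensorBasis r n c ⊗ₜ[ℂ] b x :=
  Module.Basis.tensorProduct_apply _ _ _ _

theorem compareMap_tensorWithBasis (c : Fin n → Fin r) (x : X) :
    compareMap b pos N (tensorWithBasis b (c, x)) = monomialVec N fun k => (pos x k, c k) := by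
  rw [tensorWithBasis_apply, compareMap_tmul_basis, wedgeMap_tensorBasis]

theorem range_compareMap : LinearMap.range (compareMap b pos N)
    = Submodule.span ℂ {w | ∃ (c : Fin n → Fin r) (x : X),
        w = monomialVec N fun k => (pos x k, c k)} := by
  rw [LinearMap.range_eq_map, ← (tensorWithBasis b).span_eq, Submodule.map_span, ← Set.range_comp]
  congr 1
  ext w
  constructor
  · rintro ⟨⟨c, x⟩, rfl⟩
    exact ⟨c, x, compareMap_tensorWithBasis b pos N c x⟩
  · rintro ⟨c, x, rfl⟩
    exact ⟨(c, x), compareMap_tensorWithBasis b pos N c x⟩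

theorem compareMap_lie (g : Gl r) (y : TensorPowWith r n W) :
    compareMap b pos N ⁅g, y⁆ = ⁅g, compareMap b pos N y⁆ := by
  have h : compareMap b pos N ∘ₗ LieModule.toEnd ℂ (Gl r) (TensorPowWith r n W) g
      = LieModule.toEnd ℂ (Gl r) (WedgeVN r n N) g ∘ₗ compareMap b pos N := by
    refine (tensorWithBasis b).ext fun p => ?_
    obtain ⟨c, x⟩ := p
    rw [LinearMap.comp_apply, LinearMap.comp_apply, LieModule.toEnd_apply_apply,
      LieModule.toEnd_apply_apply, tensorWithBasis_apply, TensorProduct.LieModule.lie_tmul_right,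
      trivial_lie_zero (Gl r) (TrivialLieModule ℂ (Gl r) W), TensorProduct.tmul_zero, add_zero,
      compareMap_tmul_basis, compareMap_tmul_basis, wedgeMap_lie]
  exact LinearMap.congr_fun h y

variable [MulAction (Equiv.Perm (Fin n)) X] {τ : Representation ℂ (Equiv.Perm (Fin n)) W}
  (hτ : ∀ (σ : Equiv.Perm (Fin n)) (x : X), (τ σ (b x) : TrivialLieModule ℂ (Gl r) W)
    = ((Equiv.Perm.sign σ : ℤ) : ℂ) • b (σ • x))
  (hpos : ∀ (σ : Equiv.Perm (Fin n)) (x : X), pos (σ • x) = pos x ∘ σ.symm)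

include hτ

theorem diagRep_tmul_basis (σ : Equiv.Perm (Fin n)) (t : TensorPow r n) (x : X) :
    diagRep r n τ σ (t ⊗ₜ[ℂ] b x)
      = ((Equiv.Perm.sign σ : ℤ) : ℂ) • (permRep r n σ t ⊗ₜ[ℂ] b (σ • x)) :=
  (congrArg (fun w : TrivialLieModule ℂ (Gl r) W => permRep r n σ t ⊗ₜ[ℂ] w) (hτ σ x)).trans
    (TensorProduct.tmul_smul _ _ _)

include hpos

/-- The sign from the representation and the sign from the wedge product multiply to 1. -/
theorem compareMap_diagRep (σ : Equiv.Perm (Fin n)) (y : TensorPowWith r n W) :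
    compareMap b pos N (diagRep r n τ σ y) = compareMap b pos N y := by
  have h : compareMap b pos N ∘ₗ diagRep r n τ σ = compareMap b pos N := by
    refine (tensorWithBasis b).ext fun p => ?_
    obtain ⟨c, x⟩ := p
    rw [LinearMap.comp_apply, tensorWithBasis_apply, diagRep_tmul_basis b hτ, map_smul,
      compareMap_tmul_basis, compareMap_tmul_basis, hpos, wedgeMap_perm, smul_smul, ← Int.cast_mul,
      ← Units.val_mul, Int.units_mul_self, Units.val_one, Int.cast_one, one_smul]
  exact LinearMap.congr_fun h y

/-- The determinant functional sees only permutations matching the positions. As positions determine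
the index, these are exactly the ones that carry the given basis index to `x`. -/
theorem detFun_compareMap (hinj : Function.Injective pos) (c : Fin n → Fin r) (x : X)
    (y : TensorPowWith r n W) :
    detFun N (fun k => (pos x k, c k)) (compareMap b pos N y)
      = ∑ σ : Equiv.Perm (Fin n), (tensorWithBasis b).repr (diagRep r n τ σ y) (c, x) := by
  classical
  have h : detFun N (fun k => (pos x k, c k)) ∘ₗ compareMap b pos N
      = ∑ σ : Equiv.Perm (Fin n), (tensorWithBasis b).coord (c, x) ∘ₗ diagRep r n τ σ := by
    refine (tensorWithBasis b).ext fun p => ?_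
    obtain ⟨c', x'⟩ := p
    rw [LinearMap.comp_apply, LinearMap.sum_apply, tensorWithBasis_apply, compareMap_tmul_basis,
      detFun_wedgeMap]
    refine Finset.sum_congr rfl fun σ _ => ?_
    rw [LinearMap.comp_apply, diagRep_tmul_basis b hτ, map_smul, smul_eq_mul, Module.Basis.coord_apply,
      tensorWithBasis, Module.Basis.tensorProduct_repr_tmul_apply, Module.Basis.repr_self,
      Finsupp.single_apply, ← hpos]
    by_cases hx : σ • x' = x
    · rw [if_pos (congrArg pos hx), if_pos hx, one_smul]
    · rw [if_neg fun h => hx (hinj h), if_neg hx, zero_smul]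
  have h2 := LinearMap.congr_fun h y
  rw [LinearMap.sum_apply] at h2
  exact h2

/-- On an invariant vector all terms of the sum in `detFun_compareMap` agree, so the image
determines each coordinate up to the nonzero factor `n!`. Linear independence of monomials is not
needed separately. -/
theorem compareMap_injOn (hinj : Function.Injective pos) {y : TensorPowWith r n W}
    (hy : y ∈ tensorInvariants r n τ) (h0 : compareMap b pos N y = 0) : y = 0 := by
  apply (tensorWithBasis b).repr.injective
  rw [map_zero]
  ext ⟨c, x⟩
  have h1 := detFun_compareMap b pos N hτ hpos hinj c x y
  have h2 : ∀ σ, diagRep r n τ σ y = y := hy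
  rw [h0, map_zero] at h1
  simp only [h2, Finset.sum_const, nsmul_eq_mul] at h1
  exact (mul_eq_zero.1 h1.symm).resolve_left
    (Nat.cast_ne_zero.2 (Finset.card_ne_zero.2 ⟨1, Finset.mem_univ _⟩))

/-- Averaging over the group yields an invariant vector and leaves the image unchanged. -/
theorem exists_invariant_compareMap_eq (y : TensorPowWith r n W) :
    ∃ z ∈ tensorInvariants r n τ, compareMap b pos N z = compareMap b pos N y := by
  have hcard : (Fintype.card (Equiv.Perm (Fin n)) : ℂ) ≠ 0 := Nat.cast_ne_zero.2 Fintype.card_ne_zero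
  refine ⟨(Fintype.card (Equiv.Perm (Fin n)) : ℂ)⁻¹ • ∑ σ, diagRep r n τ σ y, fun σ => ?_, ?_⟩
  · rw [map_smul, map_sum]
    congr 1
    refine Fintype.sum_equiv (Equiv.mulLeft σ) _ _ fun σ' => ?_
    rw [Equiv.coe_mulLeft, map_mul]
    rfl
  · rw [map_smul, map_sum, Finset.sum_congr rfl fun σ _ => compareMap_diagRep b pos N hτ hpos σ y,
      Finset.sum_const, ← Nat.cast_smul_eq_nsmul ℂ, smul_smul, Finset.card_univ,
      inv_mul_cancel₀ hcard, one_smul]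

theorem ch_tensorInvariants_eq_of_basis (hinj : Function.Injective pos)
    {A : LieSubmodule ℂ (Gl r) (WedgeVN r n N)}
    (hA : A.toSubmodule = Submodule.span ℂ {w | ∃ (c : Fin n → Fin r) (x : X),
        w = monomialVec N fun k => (pos x k, c k)}) :
    ch r (tensorInvariants r n τ) = ch r A := by
  rw [← range_compareMap b] at hA
  have hmem : ∀ y, compareMap b pos N y ∈ A := fun y => by
    change compareMap b pos N y ∈ A.toSubmodule
    rw [hA]
    exact ⟨y, rfl⟩
  let f : tensorInvariants r n τ →ₗ[ℂ] A :=
    { toFun := fun y => ⟨compareMap b pos N y.1, hmem _⟩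
      map_add' := fun y z => Subtype.ext (map_add (compareMap b pos N) y.1 z.1)
      map_smul' := fun c y => Subtype.ext (map_smul (compareMap b pos N) c y.1) }
  have hf : Function.Bijective f := by
    constructor
    · rw [injective_iff_map_eq_zero]
      intro y hy
      exact Subtype.ext (compareMap_injOn b pos N hτ hpos hinj y.2 (congrArg Subtype.val hy))
    · rintro ⟨w, hw⟩
      have hw' : w ∈ A.toSubmodule := hw
      rw [hA] at hw'
      obtain ⟨y, rfl⟩ := hw'
      obtain ⟨z, hz, hzy⟩ := exists_invariant_compareMap_eq b pos N hτ hpos y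
      exact ⟨⟨z, hz⟩, Subtype.ext hzy⟩
  exact ch_congr (LinearEquiv.ofBijective f hf) fun g y =>
    Subtype.ext (compareMap_lie b pos N g y.1)

end CompareWith

/-! ### Parking functions as position sequences of dominated monomials -/

section ParkingInvariants

variable {r : ℕ} (ξ : Fin r → ℕ) (N : ℤ)

instance (n : ℕ) (ρ : List ℕ) (m : ℤ) : Finite (PF n ρ m) := Subtype.finite

/-- The basis of `ℂPF ⊗ Sign` given by the parking functions. -/
def parkingBasis (r n : ℕ) (ρ : List ℕ) (m : ℤ) :
    Module.Basis (PF n ρ m) ℂ (TrivialLieModule ℂ (Gl r) (MonoidAlgebra ℂ (PF n ρ m) ⊗[ℂ] ℂ)) :=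
  ((Module.Basis.ofRepr (MonoidAlgebra.coeffLinearEquiv ℂ)).map (TensorProduct.rid ℂ _).symm :
    Module.Basis (PF n ρ m) ℂ (MonoidAlgebra ℂ (PF n ρ m) ⊗[ℂ] ℂ))

theorem parkingBasis_apply (r n : ℕ) (ρ : List ℕ) (m : ℤ) (f : PF n ρ m) :
    parkingBasis r n ρ m f = MonoidAlgebra.single f (1 : ℂ) ⊗ₜ[ℂ] (1 : ℂ) := rfl

theorem parkingSignRep_parkingBasis {n : ℕ} {ρ : List ℕ} {m : ℤ} (σ : Equiv.Perm (Fin n))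
    (f : PF n ρ m) : (parkingSignRep n ρ m σ (parkingBasis r n ρ m f) :
      TrivialLieModule ℂ (Gl r) (MonoidAlgebra ℂ (PF n ρ m) ⊗[ℂ] ℂ))
        = ((Equiv.Perm.sign σ : ℤ) : ℂ) • parkingBasis r n ρ m (σ • f) := by
  rw [parkingBasis_apply, parkingBasis_apply]
  change parkingRep n ρ m σ (MonoidAlgebra.single f 1) ⊗ₜ[ℂ] (signRep n σ 1) = _ • (_ ⊗ₜ[ℂ] _)
  have h1 : parkingRep n ρ m σ (MonoidAlgebra.single f 1) = MonoidAlgebra.single (σ • f) 1 :=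
    Representation.ofMulAction_single σ f 1
  have h2 : signRep n σ 1 = ((Equiv.Perm.sign σ : ℤ) : ℂ) • (1 : ℂ) := rfl
  rw [h1, h2, TensorProduct.tmul_smul]
  rfl

instance (n : ℕ) (ρ : List ℕ) (m : ℤ) :
    FiniteDimensional ℂ (MonoidAlgebra ℂ (PF n ρ m) ⊗[ℂ] ℂ) :=
  -- The choice of 0 is immaterial: `parkingBasis` carries the rank only as a label on the trivial
  -- module structure.
  Module.Finite.of_basis (parkingBasis 0 n ρ m)

/-- The values of a parking function. -/
def parkingPos {n : ℕ} {ρ : List ℕ} {m : ℤ} (f : PF n ρ m) (k : Fin n) : ℕ+ :=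
  ⟨(f.1 k : ℕ), (Finset.mem_Icc.1 (f.1 k).2).1⟩

theorem parkingPos_injective {n : ℕ} {ρ : List ℕ} {m : ℤ} :
    Function.Injective (parkingPos (n := n) (ρ := ρ) (m := m)) := fun _ _ h =>
  Subtype.ext (funext fun k => Subtype.ext (congrArg PNat.val (congrFun h k)))

/-- A dominated enumeration of boxes is a parking function, its first coordinates, together with an
arbitrary choice of columns, and the two degrees agree. Repeated boxes are allowed on both sides and
give the zero monomial. -/
theorem weylGrade_toSubmodule_parking (m : ℤ) : (weylGrade ξ N m).toSubmodule
    = Submodule.span ℂ {w | ∃ (c : Fin (∑ j, ξ j) → Fin r) (f : PF _ (rhoPartition ξ) m),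
        w = monomialVec N fun k => (parkingPos f k, c k)} := by
  rw [weylGrade_toSubmodule, gradedSpan]
  congr 1
  ext w
  constructor
  · rintro ⟨e, he, rfl, rfl⟩
    let f : Fin (∑ j, ξ j) → Finset.Icc 1 (∑ j, ξ j) := fun k =>
      ⟨((e k).1 : ℕ), Finset.mem_Icc.2 ⟨(e k).1.pos, Dominated.le ξ he k⟩⟩
    exact ⟨fun k => (e k).2,
      ⟨f, (isParking_rhoPartition_iff ξ f).2 he, parkingDeg_rhoPartition ξ f⟩, rfl⟩
  · rintro ⟨c, f, rfl⟩
    refine ⟨fun k => (parkingPos f k, c k), (isParking_rhoPartition_iff ξ f.1).1 f.2.1, ?_, rfl⟩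
    exact (parkingDeg_rhoPartition ξ f.1).symm.trans f.2.2

/-- The graded components of `𝒱(ξ, N)` in terms of parking functions. -/
theorem ch_weylGrade (m : ℤ) : ch r (weylGrade ξ N m)
    = ch r (tensorInvariants r (∑ j, ξ j) (parkingSignRep (∑ j, ξ j) (rhoPartition ξ) m)) :=
  (ch_tensorInvariants_eq_of_basis (parkingBasis r _ _ m) parkingPos N parkingSignRep_parkingBasis
    (fun _ _ => rfl) parkingPos_injective (weylGrade_toSubmodule_parking ξ N m)).symm

end ParkingInvariants

end

end ParkingWeyl

/-! ### The two character formulas -/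

theorem mainTheorem6 (r : ℕ) (ξ : Fin r → ℕ) (hξ : Antitone ξ) (N : ℤ) :
    ParkingWeyl.chX ξ N =
        ∑ᶠ m : ℤ, LaurentPolynomial.C (ParkingWeyl.ch r
            (ParkingWeyl.tensorInvariants r (∑ j, ξ j)
              (ParkingWeyl.parkingSignRep (∑ j, ξ j) (ParkingWeyl.rhoPartition ξ) m))) *
          LaurentPolynomial.T m ∧
      ParkingWeyl.chX ξ N =
        ∑ᶠ m : ℤ, LaurentPolynomial.C (ParkingWeyl.grothendieckCh r
            (ParkingWeyl.frobeniusMap (∑ j, ξ j) r (ParkingWeyl.symClass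
              (ParkingWeyl.parkingSignRep (∑ j, ξ j) (ParkingWeyl.rhoPartition ξ) m)))) *
          LaurentPolynomial.T m := by
  have h : ParkingWeyl.chX ξ N =
      ∑ᶠ m : ℤ, LaurentPolynomial.C (ParkingWeyl.ch r
          (ParkingWeyl.tensorInvariants r (∑ j, ξ j)
            (ParkingWeyl.parkingSignRep (∑ j, ξ j) (ParkingWeyl.rhoPartition ξ) m))) *
        LaurentPolynomial.T m := by
    rw [ParkingWeyl.chX_eq_finsum]
    exact finsum_congr fun m => by rw [ParkingWeyl.ch_weylGrade]
  refine ⟨h, h.trans (finsum_congr fun m => ?_)⟩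
  rw [ParkingWeyl.ch_tensorInvariants_eq_frobenius]
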